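/- Let $k$ be a perfect field of characteristic different from $2$ and $3$, let $a,b,n\in k$, and put $F(x,u)=u^3+aux^2+bx^3$. Let $$X_n:\quad F(x_0,x_1)+F(x_0,x_2)+F(x_0,x_3)=n x_0^3\quad\subset\ \mathbb{P}^3_k ,$$ and assume that the cubic surface $X_n$ is smooth over $k$. Let $r$ be a root of $$f_1(x)=x^3+ax+3b-n\in k[x]$$ in some extension field of $k$, put $$g_1(x)=ax^3+3r^2x^2-3r^2x+(4a+3r^2)\in k(r)[x],$$ and let $K$ be the splitting field of $f_1$ and $g_1$, that is, a splitting field over $k(r)$ of the product $f_1g_1$. Then $X_n\times_kK$ is split: with $X:=X_n\times_k K$ and $\bar X:=X\times_K\bar K$, where $\bar K$ is an algebraic closure of $K$, the pullback homomorphism $\operatorname{Pic}X\to\operatorname{Pic}\bar X$ is an isomorphism. -/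

import Mathlib

open CategoryTheory CategoryTheory.Limits AlgebraicGeometry Polynomial

universe u v

noncomputable section

/-! ### The Picard group of a scheme

A line bundle is presented by transition functions on an open cover. Taking the cover to be indexed
by the points of the scheme (one open neighbourhood of each point) loses no generality, since every
open cover is refined by such a cover. The Picard group is
`H¹(X, 𝒪_X^×) = colim Ȟ¹(𝒰, 𝒪_X^×)`, the group of line bundles up to isomorphism. -/

namespace SchemePic

variable {X Y : Scheme.{u}}

/-- Restriction of invertible functions to a smaller open set. -/
def res {U V : X.Opens} (h : U ≤ V) : Γ(X, V)ˣ →* Γ(X, U)ˣ :=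
  Units.map (X.presheaf.map (homOfLE h).op).hom.toMonoidHom

theorem res_res {U V W : X.Opens} (h : U ≤ V) (h' : V ≤ W) (s : Γ(X, W)ˣ) :
    res h (res h' s) = res (h.trans h') s := by
  ext
  change (X.presheaf.map (homOfLE h').op ≫ X.presheaf.map (homOfLE h).op).hom (s : Γ(X, W)) = _
  rw [← X.presheaf.map_comp]
  rfl

/-- Pullback of invertible functions along a morphism of schemes. -/
def pull (φ : Y ⟶ X) (U : X.Opens) : Γ(X, U)ˣ →* Γ(Y, φ ⁻¹ᵁ U)ˣ :=
  Units.map (φ.app U).hom.toMonoidHom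

theorem pull_res (φ : Y ⟶ X) {U V : X.Opens} (h : U ≤ V) (s : Γ(X, V)ˣ) :
    pull φ U (res h s) = res (φ.preimage_mono h) (pull φ V s) := by
  ext
  change (X.presheaf.map (homOfLE h).op ≫ φ.app U).hom (s : Γ(X, V)) = _
  rw [φ.naturality]
  rfl

variable (X) in
/-- A line bundle given by transition functions: every point `x` has a trivializing open
neighbourhood `U x`, and `g x y` is the invertible function on `U x ⊓ U y` that compares the
trivializations over `U x` and `U y`. -/
structure LineBundleCocycle where
  U : X → X.Opens
  mem : ∀ x, x ∈ U x
  g : ∀ x y, Γ(X, U x ⊓ U y)ˣ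
  cocycle : ∀ x y z,
    res (U := U x ⊓ U y ⊓ U z) inf_le_left (g x y) *
      res (U := U x ⊓ U y ⊓ U z) (le_inf (inf_le_left.trans inf_le_right) inf_le_right) (g y z) =
    res (U := U x ⊓ U y ⊓ U z) (le_inf (inf_le_left.trans inf_le_left) inf_le_right) (g x z)

namespace LineBundleCocycle

theorem cocycle' (c : LineBundleCocycle X) {x y z : X} {W : X.Opens}
    (hxy : W ≤ c.U x ⊓ c.U y) (hyz : W ≤ c.U y ⊓ c.U z) (hxz : W ≤ c.U x ⊓ c.U z) :
    res hxy (c.g x y) * res hyz (c.g y z) = res hxz (c.g x z) := by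
  have hW : W ≤ c.U x ⊓ c.U y ⊓ c.U z := le_inf hxy (hyz.trans inf_le_right)
  simpa only [map_mul, res_res] using congrArg (res hW) (c.cocycle x y z)

/-- Two families of transition functions define isomorphic line bundles: after shrinking the
neighbourhoods they differ by a change of the local trivializations. -/
def Iso (c d : LineBundleCocycle X) : Prop :=
  ∃ (W : X → X.Opens) (_ : ∀ x, x ∈ W x) (hc : ∀ x, W x ≤ c.U x) (hd : ∀ x, W x ≤ d.U x)
    (f : ∀ x, Γ(X, W x)ˣ), ∀ x y,
      res (U := W x ⊓ W y) inf_le_left (f x) * res (inf_le_inf (hc x) (hc y)) (c.g x y) =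
        res (inf_le_inf (hd x) (hd y)) (d.g x y) * res inf_le_right (f y)

theorem iso_equivalence : Equivalence (Iso (X := X)) where
  refl c := ⟨c.U, c.mem, fun _ ↦ le_rfl, fun _ ↦ le_rfl, fun _ ↦ 1, fun x y ↦ by simp⟩
  symm := by
    rintro c d ⟨W, hW, hc, hd, f, hf⟩
    refine ⟨W, hW, hd, hc, fun x ↦ (f x)⁻¹, fun x y ↦ ?_⟩
    rw [map_inv, map_inv, inv_mul_eq_iff_eq_mul, ← mul_assoc, hf, mul_inv_cancel_right]
  trans := by
    rintro c d e ⟨W, hW, hc, hd, f, hf⟩ ⟨W', hW', hd', he', f', hf'⟩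
    refine ⟨fun x ↦ W x ⊓ W' x, fun x ↦ ⟨hW x, hW' x⟩, fun x ↦ inf_le_left.trans (hc x),
      fun x ↦ inf_le_right.trans (he' x),
      fun x ↦ res inf_le_right (f' x) * res inf_le_left (f x), fun x y ↦ ?_⟩
    have h1 := congrArg (res (inf_le_inf (inf_le_left (a := W x) (b := W' x))
      (inf_le_left (a := W y) (b := W' y)))) (hf x y)
    have h2 := congrArg (res (inf_le_inf (inf_le_right (a := W x) (b := W' x))
      (inf_le_right (a := W y) (b := W' y)))) (hf' x y)
    simp only [map_mul, res_res] at h1 h2 ⊢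
    rw [mul_assoc, h1, ← mul_assoc, h2, mul_assoc]

/-- The trivial line bundle. -/
abbrev one : LineBundleCocycle X where
  U _ := ⊤
  mem _ := trivial
  g _ _ := 1
  cocycle _ _ _ := by simp

/-- The tensor product of line bundles: transition functions are multiplied. -/
abbrev mul (c d : LineBundleCocycle X) : LineBundleCocycle X where
  U x := c.U x ⊓ d.U x
  mem x := ⟨c.mem x, d.mem x⟩
  g x y := res (inf_le_inf inf_le_left inf_le_left) (c.g x y) *
    res (inf_le_inf inf_le_right inf_le_right) (d.g x y)
  cocycle x y z := by
    simp only [map_mul, res_res]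
    rw [mul_mul_mul_comm, cocycle', cocycle']

/-- The dual line bundle: transition functions are inverted. -/
abbrev inv (c : LineBundleCocycle X) : LineBundleCocycle X where
  U := c.U
  mem := c.mem
  g x y := (c.g x y)⁻¹
  cocycle x y z := by
    simp only [map_inv]
    rw [← mul_inv, c.cocycle]

/-- The pullback of a line bundle along a morphism. -/
abbrev pullback (φ : Y ⟶ X) (c : LineBundleCocycle X) : LineBundleCocycle Y where
  U y := φ ⁻¹ᵁ c.U (φ y)
  mem y := c.mem (φ y)
  g y z := pull φ _ (c.g (φ y) (φ z))
  cocycle x y z := by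
    have h := congrArg (pull φ _) (c.cocycle (φ x) (φ y) (φ z))
    simp only [map_mul, pull_res] at h
    exact h

theorem Iso.mul {c c' d d' : LineBundleCocycle X} (h : Iso c c') (h' : Iso d d') :
    Iso (c.mul d) (c'.mul d') := by
  obtain ⟨W, hW, hc, hc', f, hf⟩ := h
  obtain ⟨W', hW', hd, hd', f', hf'⟩ := h'
  refine ⟨fun x ↦ W x ⊓ W' x, fun x ↦ ⟨hW x, hW' x⟩, fun x ↦ inf_le_inf (hc x) (hd x),
    fun x ↦ inf_le_inf (hc' x) (hd' x),
    fun x ↦ res inf_le_left (f x) * res inf_le_right (f' x), fun x y ↦ ?_⟩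
  have h1 := congrArg (res (inf_le_inf (inf_le_left (a := W x) (b := W' x))
    (inf_le_left (a := W y) (b := W' y)))) (hf x y)
  have h2 := congrArg (res (inf_le_inf (inf_le_right (a := W x) (b := W' x))
    (inf_le_right (a := W y) (b := W' y)))) (hf' x y)
  simp only [LineBundleCocycle.mul, map_mul, res_res] at h1 h2 ⊢
  rw [mul_mul_mul_comm, h1, h2, mul_mul_mul_comm]

theorem Iso.inv {c c' : LineBundleCocycle X} (h : Iso c c') : Iso c.inv c'.inv := by
  obtain ⟨W, hW, hc, hc', f, hf⟩ := h
  refine ⟨W, hW, hc, hc', fun x ↦ (f x)⁻¹, fun x y ↦ ?_⟩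
  simp only [LineBundleCocycle.inv, map_inv]
  rw [← mul_inv, hf, mul_inv]

theorem Iso.pullback (φ : Y ⟶ X) {c c' : LineBundleCocycle X} (h : Iso c c') :
    Iso (c.pullback φ) (c'.pullback φ) := by
  obtain ⟨W, hW, hc, hc', f, hf⟩ := h
  refine ⟨fun y ↦ φ ⁻¹ᵁ W (φ y), fun y ↦ hW (φ y), fun y ↦ φ.preimage_mono (hc _),
    fun y ↦ φ.preimage_mono (hc' _), fun y ↦ pull φ _ (f (φ y)), fun x y ↦ ?_⟩
  have h := congrArg (pull φ _) (hf (φ x) (φ y))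
  simp only [map_mul, pull_res] at h
  exact h

variable (X) in
instance setoid : Setoid (LineBundleCocycle X) := ⟨Iso, iso_equivalence⟩

end LineBundleCocycle

end SchemePic

open SchemePic in
/-- The Picard group of a scheme: isomorphism classes of line bundles. -/
def SchemePic (X : Scheme.{u}) : Type u := Quotient (LineBundleCocycle.setoid X)

namespace SchemePic

variable {X Y : Scheme.{u}}

/-- The group law is the tensor product of line bundles. -/
instance : CommGroup (SchemePic X) where
  mul := Quotient.map₂ LineBundleCocycle.mul fun _ _ h _ _ h' ↦ h.mul h'
  one := Quotient.mk _ LineBundleCocycle.one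
  inv := Quotient.map LineBundleCocycle.inv fun _ _ h ↦ h.inv
  mul_assoc := by
    rintro ⟨c⟩ ⟨d⟩ ⟨e⟩
    refine Quotient.sound ⟨fun x ↦ c.U x ⊓ d.U x ⊓ e.U x,
      fun x ↦ ⟨⟨c.mem x, d.mem x⟩, e.mem x⟩, fun _ ↦ le_rfl, fun _ ↦ (inf_assoc _ _ _).le,
      fun _ ↦ 1, fun x y ↦ ?_⟩
    simp only [LineBundleCocycle.mul, map_mul, map_one, res_res, one_mul, mul_one, mul_assoc]
  one_mul := by
    rintro ⟨c⟩
    refine Quotient.sound ⟨c.U, c.mem, fun _ ↦ le_inf le_top le_rfl, fun _ ↦ le_rfl,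
      fun _ ↦ 1, fun x y ↦ ?_⟩
    simp only [LineBundleCocycle.mul, LineBundleCocycle.one, map_one, res_res, one_mul,
      mul_one]
  mul_one := by
    rintro ⟨c⟩
    refine Quotient.sound ⟨c.U, c.mem, fun _ ↦ le_inf le_rfl le_top, fun _ ↦ le_rfl,
      fun _ ↦ 1, fun x y ↦ ?_⟩
    simp only [LineBundleCocycle.mul, LineBundleCocycle.one, map_one, res_res, one_mul,
      mul_one]
  inv_mul_cancel := by
    rintro ⟨c⟩
    refine Quotient.sound ⟨c.U, c.mem, fun _ ↦ le_inf le_rfl le_rfl, fun _ ↦ le_top,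
      fun _ ↦ 1, fun x y ↦ ?_⟩
    simp only [LineBundleCocycle.mul, LineBundleCocycle.one, LineBundleCocycle.inv, map_one,
      map_inv, mul_one, inv_mul_cancel]
  mul_comm := by
    rintro ⟨c⟩ ⟨d⟩
    refine Quotient.sound ⟨fun x ↦ c.U x ⊓ d.U x, fun x ↦ ⟨c.mem x, d.mem x⟩,
      fun _ ↦ le_rfl, fun _ ↦ inf_comm _ _ |>.le, fun _ ↦ 1, fun x y ↦ ?_⟩
    simp only [LineBundleCocycle.mul, map_mul, map_one, res_res, one_mul, mul_one]
    rw [mul_comm]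

/-- The homomorphism `Pic X → Pic Y` given by pulling back line bundles along `φ : Y ⟶ X`. -/
def map (φ : Y ⟶ X) : SchemePic X →* SchemePic Y where
  toFun := Quotient.map (LineBundleCocycle.pullback φ) fun _ _ h ↦ h.pullback φ
  map_one' := Quotient.sound ⟨fun _ ↦ ⊤, fun _ ↦ trivial, fun _ ↦ le_rfl, fun _ ↦ le_rfl,
    fun _ ↦ 1, fun x y ↦ by
      have h : pull φ (⊤ ⊓ ⊤) 1 = 1 := map_one _
      rw [map_one, map_one, one_mul, mul_one]
      exact (congrArg (res _) h).trans (map_one _)⟩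
  map_mul' := by
    rintro ⟨c⟩ ⟨d⟩
    refine Quotient.sound ⟨fun y ↦ φ ⁻¹ᵁ (c.U (φ y) ⊓ d.U (φ y)),
      fun y ↦ ⟨c.mem (φ y), d.mem (φ y)⟩, fun _ ↦ le_rfl, fun _ ↦ le_rfl, fun _ ↦ 1,
      fun x y ↦ ?_⟩
    have h := map_mul (pull φ (c.U (φ x) ⊓ d.U (φ x) ⊓ (c.U (φ y) ⊓ d.U (φ y))))
      (res (inf_le_inf inf_le_left inf_le_left) (c.g (φ x) (φ y)))
      (res (inf_le_inf inf_le_right inf_le_right) (d.g (φ x) (φ y)))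
    rw [pull_res, pull_res] at h
    rw [map_one, map_one, one_mul, mul_one]
    exact congrArg (res _) h

end SchemePic

/-! ### Base change and split surfaces -/

/-- The base change `X ×_F E` of an `F`-scheme `f : X ⟶ Spec F` to an extension `E` of `F`. -/
abbrev BaseChange {F : Type u} [Field F] {X : Scheme.{u}} (f : X ⟶ Spec (.of F))
    (E : Type u) [Field E] [Algebra F E] : Scheme.{u} :=
  pullback f (Spec.map (CommRingCat.ofHom (algebraMap F E)))

/-- The projection `X ×_F E ⟶ X`. -/
abbrev BaseChange.proj {F : Type u} [Field F] {X : Scheme.{u}} (f : X ⟶ Spec (.of F))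
    (E : Type u) [Field E] [Algebra F E] : BaseChange f E ⟶ X :=
  pullback.fst f (Spec.map (CommRingCat.ofHom (algebraMap F E)))

/-- The structure morphism `X ×_F E ⟶ Spec E`. -/
abbrev BaseChange.toSpec {F : Type u} [Field F] {X : Scheme.{u}} (f : X ⟶ Spec (.of F))
    (E : Type u) [Field E] [Algebra F E] : BaseChange f E ⟶ Spec (.of E) :=
  pullback.snd f (Spec.map (CommRingCat.ofHom (algebraMap F E)))

/-- An `F`-scheme `X` is split if the pullback homomorphism `Pic X → Pic X̄` is an isomorphism,
where `X̄` is the base change of `X` to an algebraic closure of `F`. -/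
def IsSplit {F : Type u} [Field F] {X : Scheme.{u}} (f : X ⟶ Spec (.of F)) : Prop :=
  Function.Bijective (SchemePic.map (BaseChange.proj f (AlgebraicClosure F)))

/-! ### Quotients of graded algebras -/

namespace QuotientGrading

variable {k A : Type*} [Field k] [CommRing A] [Algebra k A] (𝒜 : ℕ → Submodule k A) (I : Ideal A)

/-- The grading of `A ⧸ I` by the images of the homogeneous parts of `A`. -/
def grading (i : ℕ) : Submodule k (A ⧸ I) :=
  (𝒜 i).map (Ideal.Quotient.mkₐ k I).toLinearMap

/-- The quotient map on the part of degree `i`. -/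
def mk (i : ℕ) : 𝒜 i →ₗ[k] grading 𝒜 I i :=
  (Ideal.Quotient.mkₐ k I).toLinearMap.restrict fun p hp ↦ ⟨p, hp, rfl⟩

variable [GradedAlgebra 𝒜]

instance gradedMonoid : SetLike.GradedMonoid (grading 𝒜 I) where
  one_mem := ⟨1, SetLike.GradedOne.one_mem, map_one (Ideal.Quotient.mkₐ k I)⟩
  mul_mem := by
    rintro i j _ _ ⟨p, hp, rfl⟩ ⟨q, hq, rfl⟩
    exact ⟨p * q, SetLike.GradedMul.mul_mem hp hq, map_mul (Ideal.Quotient.mkₐ k I) p q⟩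

/-- The homogeneous components of the class of an element of `A`. -/
def components : A →ₗ[k] DirectSum ℕ fun i ↦ grading 𝒜 I i :=
  (DirectSum.lmap (mk 𝒜 I)).comp (DirectSum.decomposeLinearEquiv 𝒜).toLinearMap

theorem components_of_mem {i : ℕ} {p : A} (hp : p ∈ 𝒜 i) :
    components 𝒜 I p = DirectSum.of (fun i ↦ grading 𝒜 I i) i (mk 𝒜 I i ⟨p, hp⟩) := by
  change DirectSum.lmap (mk 𝒜 I) (DirectSum.decompose 𝒜 p) = _
  rw [DirectSum.decompose_of_mem 𝒜 hp, DirectSum.lmap_of]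

theorem components_of_mem_ideal (hI : I.IsHomogeneous 𝒜) {p : A} (hp : p ∈ I) :
    components 𝒜 I p = 0 := by
  refine DFinsupp.ext fun i ↦ Subtype.ext ?_
  exact Ideal.Quotient.eq_zero_iff_mem.mpr (hI i hp)

theorem coe_components (p : A) :
    DirectSum.coeAddMonoidHom (grading 𝒜 I) (components 𝒜 I p) = Ideal.Quotient.mk I p := by
  induction p using DirectSum.Decomposition.inductionOn 𝒜 with
  | zero => rw [map_zero, map_zero, map_zero]
  | homogeneous m =>
    rw [components_of_mem 𝒜 I m.2]
    exact DirectSum.coeAddMonoidHom_of _ _ _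
  | add p q hp hq => rw [map_add, map_add, hp, hq, map_add]

theorem components_surjective : Function.Surjective (components 𝒜 I) := by
  suffices h : Function.Surjective (DirectSum.lmap (mk 𝒜 I)) by
    exact h.comp (DirectSum.decomposeLinearEquiv 𝒜).surjective
  refine (DirectSum.lmap_surjective (mk 𝒜 I)).mpr fun i ↦ ?_
  rintro ⟨_, p, hp, rfl⟩
  exact ⟨⟨p, hp⟩, rfl⟩

/-- The quotient of a graded algebra by a homogeneous ideal is graded. -/
@[reducible] def gradedAlgebra (hI : I.IsHomogeneous 𝒜) : GradedAlgebra (grading 𝒜 I) where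
  toGradedMonoid := gradedMonoid 𝒜 I
  decompose' x := components 𝒜 I (Quotient.out x)
  left_inv x := (coe_components 𝒜 I _).trans (Ideal.Quotient.mk_out x)
  right_inv := by
    intro y
    obtain ⟨p, rfl⟩ := components_surjective 𝒜 I y
    rw [coe_components]
    refine sub_eq_zero.mp ((map_sub (components 𝒜 I) _ p).symm.trans ?_)
    refine components_of_mem_ideal 𝒜 I hI (Ideal.Quotient.eq.mp ?_)
    exact Ideal.Quotient.mk_out _

end QuotientGrading

/-! ### Hypersurfaces in projective space -/

namespace ProjHypersurface

variable {k : Type u} [Field k] {N : ℕ} {d : ℕ}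

/-- The grading of the homogeneous coordinate ring `k[x₀, …, x_{N-1}] / (G)` by degree. -/
abbrev grading (G : MvPolynomial (Fin N) k) (i : ℕ) :
    Submodule k (MvPolynomial (Fin N) k ⧸ Ideal.span {G}) :=
  QuotientGrading.grading (MvPolynomial.homogeneousSubmodule (Fin N) k) (Ideal.span {G}) i

@[reducible] def gradedAlgebra {G : MvPolynomial (Fin N) k} (hG : G.IsHomogeneous d) :
    GradedAlgebra (grading G) :=
  letI := MvPolynomial.gradedAlgebra (R := k) (σ := Fin N)
  QuotientGrading.gradedAlgebra _ _
    (Ideal.homogeneous_span _ _ fun _ hx ↦ ⟨d, by rw [Set.mem_singleton_iff.mp hx]; exact hG⟩)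

/-- The hypersurface `{G = 0}` in projective space over `k`, for a homogeneous polynomial `G`, as
the scheme `Proj k[x₀, …, x_{N-1}] / (G)`. -/
def scheme {G : MvPolynomial (Fin N) k} (hG : G.IsHomogeneous d) : Scheme.{u} :=
  letI := gradedAlgebra hG
  Proj (grading G)

/-- The structure morphism of a projective hypersurface over `k`. -/
def toSpec {G : MvPolynomial (Fin N) k} (hG : G.IsHomogeneous d) : scheme hG ⟶ Spec (.of k) :=
  letI := gradedAlgebra hG
  Proj.toSpecZero (grading G) ≫ Spec.map (CommRingCat.ofHom (algebraMap k (grading G 0)))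

end ProjHypersurface

/-! ### The cubic surface `X_n` -/

namespace CubicSurface

variable {k : Type u} [Field k]

/-- The binary cubic form `F(x, u) = u³ + a u x² + b x³`. -/
def F {R : Type*} [CommRing R] [Algebra k R] (a b : k) (x u : R) : R :=
  u ^ 3 + a • (u * x ^ 2) + b • x ^ 3

/-- The cubic form `F(x₀, x₁) + F(x₀, x₂) + F(x₀, x₃) - n x₀³` that defines `X_n`. -/
def form (a b n : k) : MvPolynomial (Fin 4) k :=
  F a b (.X 0) (.X 1) + F a b (.X 0) (.X 2) + F a b (.X 0) (.X 3) - n • .X 0 ^ 3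

theorem form_isHomogeneous (a b n : k) : (form a b n).IsHomogeneous 3 := by
  have hX (i : Fin 4) : (MvPolynomial.X i : MvPolynomial (Fin 4) k).IsHomogeneous 1 :=
    MvPolynomial.isHomogeneous_X k i
  have hpow (i : Fin 4) : (MvPolynomial.X i ^ 3 : MvPolynomial (Fin 4) k).IsHomogeneous 3 :=
    (hX i).pow 3
  have hF (i : Fin 4) :
      (F a b (.X 0) (.X i) : MvPolynomial (Fin 4) k).IsHomogeneous 3 :=
    ((hpow i).add (Submodule.smul_mem (MvPolynomial.homogeneousSubmodule (Fin 4) k 3) a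
      ((hX i).mul ((hX 0).pow 2)))).add
      (Submodule.smul_mem (MvPolynomial.homogeneousSubmodule (Fin 4) k 3) b (hpow 0))
  exact (((hF 1).add (hF 2)).add (hF 3)).sub
    (Submodule.smul_mem (MvPolynomial.homogeneousSubmodule (Fin 4) k 3) n (hpow 0))

/-- The cubic surface `X_n : F(x₀, x₁) + F(x₀, x₂) + F(x₀, x₃) = n x₀³` in `ℙ³` over `k`. -/
def surface (a b n : k) : Scheme.{u} :=
  ProjHypersurface.scheme (form_isHomogeneous a b n)

/-- The structure morphism of `X_n` over `k`. -/
def toSpec (a b n : k) : surface a b n ⟶ Spec (.of k) :=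
  ProjHypersurface.toSpec (form_isHomogeneous a b n)

/-- The polynomial `f₁(x) = x³ + a x + 3b - n`. -/
def f₁ (a b n : k) : k[X] :=
  X ^ 3 + C a * X + C (3 * b - n)

/-- The polynomial `g₁(x) = a x³ + 3r² x² - 3r² x + (4a + 3r²)` over a field that contains `a` and
the root `r` of `f₁`. -/
def g₁ {l : Type v} [Field l] (a r : l) : l[X] :=
  C a * X ^ 3 + C (3 * r ^ 2) * X ^ 2 - C (3 * r ^ 2) * X + C (4 * a + 3 * r ^ 2)

end CubicSurface

end

set_option linter.unusedSectionVars false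

noncomputable section

/-! ### Line bundles on schemes whose local rings embed into a field -/

/-- An embedding of all local rings of a scheme into one field, compatible with sections. -/
structure FieldModel (X : Scheme.{u}) (F : Type v) [Field F] where
  emb : ∀ x : X, X.presheaf.stalk x →+* F
  emb_injective : ∀ x, Function.Injective (emb x)
  emb_germ : ∀ {U : X.Opens} (s : Γ(X, U)) {x y : X} (hx : x ∈ U) (hy : y ∈ U),
    emb x (X.presheaf.germ U x hx s) = emb y (X.presheaf.germ U y hy s)

namespace FieldModel

variable {X Y : Scheme.{u}} {F : Type v} [Field F] (M : FieldModel X F)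

/-- The elements of the field that are regular at `x`. -/
def reg (x : X) : Subring F := (M.emb x).range

/-- The nonzero elements of the field that are invertible at `x`. -/
def UnitAt (x : X) (f : F) : Prop := f ≠ 0 ∧ f ∈ M.reg x ∧ f⁻¹ ∈ M.reg x

variable {M}

namespace UnitAt

variable {x : X} {f g : F}

theorem ne_zero (h : M.UnitAt x f) : f ≠ 0 := h.1

theorem mem (h : M.UnitAt x f) : f ∈ M.reg x := h.2.1

theorem one : M.UnitAt x 1 := ⟨one_ne_zero, one_mem _, by rw [inv_one]; exact one_mem _⟩

theorem inv (h : M.UnitAt x f) : M.UnitAt x f⁻¹ :=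
  ⟨inv_ne_zero h.1, h.2.2, by rw [inv_inv]; exact h.2.1⟩

theorem mul (h : M.UnitAt x f) (h' : M.UnitAt x g) : M.UnitAt x (f * g) :=
  ⟨mul_ne_zero h.1 h'.1, mul_mem h.2.1 h'.2.1, by rw [mul_inv]; exact mul_mem h.2.2 h'.2.2⟩

theorem div (h : M.UnitAt x f) (h' : M.UnitAt x g) : M.UnitAt x (f / g) := by
  rw [div_eq_mul_inv]; exact h.mul h'.inv

theorem mul_mem_iff (h : M.UnitAt x f) : f * g ∈ M.reg x ↔ g ∈ M.reg x := by
  refine ⟨fun hg ↦ ?_, fun hg ↦ mul_mem h.mem hg⟩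
  simpa [h.ne_zero] using mul_mem h.inv.mem hg

theorem of_isUnit {s : X.presheaf.stalk x} (hs : IsUnit s) : M.UnitAt x (M.emb x s) := by
  obtain ⟨u, rfl⟩ := hs
  have h : M.emb x u * M.emb x (u⁻¹ : (X.presheaf.stalk x)ˣ) = 1 := by
    rw [← map_mul, Units.mul_inv, map_one]
  refine ⟨left_ne_zero_of_mul_eq_one h, ⟨_, rfl⟩, ?_⟩
  rw [← eq_inv_of_mul_eq_one_right h]
  exact ⟨_, rfl⟩

end UnitAt

variable (M)

theorem unitAt_germ {U : X.Opens} (s : Γ(X, U)ˣ) {x : X} (hx : x ∈ U) :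
    M.UnitAt x (M.emb x (X.presheaf.germ U x hx s)) :=
  .of_isUnit (s.isUnit.map (X.presheaf.germ U x hx).hom)

theorem section_ext {U : X.Opens} {s t : Γ(X, U)}
    (h : ∀ x (hx : x ∈ U), M.emb x (X.presheaf.germ U x hx s) = M.emb x (X.presheaf.germ U x hx t)) :
    s = t :=
  TopCat.Presheaf.section_ext X.sheaf U s t fun x hx ↦ M.emb_injective x (h x hx)

theorem exists_section {U : X.Opens} {f : F} (h : ∀ x ∈ U, f ∈ M.reg x) :
    ∃ s : Γ(X, U), ∀ x (hx : x ∈ U), M.emb x (X.presheaf.germ U x hx s) = f := by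
  have key (x : U) : ∃ (W : X.Opens) (_ : x.1 ∈ W) (_ : W ≤ U) (s : Γ(X, W)),
      ∀ y (hy : y ∈ W), M.emb y (X.presheaf.germ W y hy s) = f := by
    obtain ⟨g, hg⟩ := h x.1 x.2
    obtain ⟨W, hW, s, rfl⟩ := X.presheaf.exists_germ_eq g
    refine ⟨W ⊓ U, ⟨hW, x.2⟩, inf_le_right, X.presheaf.map (homOfLE inf_le_left).op s,
      fun y hy ↦ ?_⟩
    rw [TopCat.Presheaf.germ_res_apply, ← hg, M.emb_germ]
  choose W hW hWU s hs using key
  obtain ⟨t, ht, -⟩ := X.sheaf.existsUnique_gluing' W U (fun x ↦ homOfLE (hWU x))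
    (fun x hx ↦ TopologicalSpace.Opens.mem_iSup.mpr ⟨⟨x, hx⟩, hW ⟨x, hx⟩⟩) s (fun x y ↦ by
      refine M.section_ext fun z hz ↦ ?_
      erw [TopCat.Presheaf.germ_res_apply, TopCat.Presheaf.germ_res_apply]
      rw [hs, hs])
  refine ⟨t, fun x hx ↦ ?_⟩
  rw [← hs ⟨x, hx⟩ x (hW _), ← ht ⟨x, hx⟩]
  erw [TopCat.Presheaf.germ_res_apply]

theorem exists_unit_section {U : X.Opens} {f : F} (h : ∀ x ∈ U, M.UnitAt x f) :
    ∃ s : Γ(X, U)ˣ, ∀ x (hx : x ∈ U), M.emb x (X.presheaf.germ U x hx s) = f := by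
  obtain ⟨s, hs⟩ := M.exists_section fun x hx ↦ (h x hx).mem
  obtain ⟨t, ht⟩ := M.exists_section fun x hx ↦ (h x hx).inv.mem
  have hst : s * t = 1 := M.section_ext fun x hx ↦ by
    rw [map_mul, map_mul, hs, ht, map_one, map_one, mul_inv_cancel₀ (h x hx).ne_zero]
  exact ⟨⟨s, t, hst, (mul_comm _ _).trans hst⟩, hs⟩

/-- A family of nonzero elements of the field that is locally constant up to units. -/
def IsCartier (φ : X → F) : Prop :=
  ∀ x, φ x ≠ 0 ∧ ∃ U : X.Opens, x ∈ U ∧ ∀ y ∈ U, M.UnitAt y (φ x / φ y)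

variable {M} in
theorem IsCartier.mul {φ ψ : X → F} (hφ : M.IsCartier φ) (hψ : M.IsCartier ψ) :
    M.IsCartier fun x ↦ φ x * ψ x := by
  intro x
  obtain ⟨h0, U, hU, h⟩ := hφ x
  obtain ⟨h0', U', hU', h'⟩ := hψ x
  refine ⟨mul_ne_zero h0 h0', U ⊓ U', ⟨hU, hU'⟩, fun y hy ↦ ?_⟩
  rw [mul_div_mul_comm]
  exact (h y hy.1).mul (h' y hy.2)

variable {M} in
theorem IsCartier.inv {φ : X → F} (hφ : M.IsCartier φ) : M.IsCartier fun x ↦ (φ x)⁻¹ := by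
  intro x
  obtain ⟨h0, U, hU, h⟩ := hφ x
  refine ⟨inv_ne_zero h0, U, hU, fun y hy ↦ ?_⟩
  rw [← inv_div_inv]
  simpa using (h y hy).inv

theorem isCartier_const {f : F} (hf : f ≠ 0) :
    M.IsCartier fun _ ↦ f :=
  fun _ ↦ ⟨hf, ⊤, trivial, fun _ _ ↦ by rw [div_self hf]; exact .one⟩

open SchemePic

theorem emb_germ_res {U V : X.Opens} (h : U ≤ V) (s : Γ(X, V)ˣ) {x : X} (hx : x ∈ U) :
    M.emb x (X.presheaf.germ U x hx (res h s : Γ(X, U)ˣ)) =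
      M.emb x (X.presheaf.germ V x (h hx) s) :=
  congrArg _ (TopCat.Presheaf.germ_res_apply X.presheaf (homOfLE h) x hx (s : Γ(X, V)))

variable [PreirreducibleSpace X]

theorem _root_.AlgebraicGeometry.Scheme.Opens.exists_mem_inf {U V : X.Opens} {x y : X}
    (hx : x ∈ U) (hy : y ∈ V) : ∃ z, z ∈ U ⊓ V :=
  nonempty_preirreducible_inter U.isOpen V.isOpen ⟨x, hx⟩ ⟨y, hy⟩

theorem exists_mem_inf (c : LineBundleCocycle X) (x y : X) : ∃ z, z ∈ c.U x ⊓ c.U y :=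
  Scheme.Opens.exists_mem_inf (c.mem x) (c.mem y)

/-- The transition functions of a line bundle as elements of the field. -/
def rat (c : LineBundleCocycle X) (x y : X) : F :=
  M.emb _ (X.presheaf.germ _ (exists_mem_inf c x y).choose (exists_mem_inf c x y).choose_spec
    (c.g x y))

theorem rat_eq (c : LineBundleCocycle X) {x y z : X} (hz : z ∈ c.U x ⊓ c.U y) :
    M.rat c x y = M.emb z (X.presheaf.germ _ z hz (c.g x y)) :=
  M.emb_germ _ _ _

theorem unitAt_rat (c : LineBundleCocycle X) {x y z : X} (hx : z ∈ c.U x) (hy : z ∈ c.U y) :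
    M.UnitAt z (M.rat c x y) := by
  rw [M.rat_eq c ⟨hx, hy⟩]
  exact M.unitAt_germ _ _

theorem rat_ne_zero (c : LineBundleCocycle X) (x y : X) : M.rat c x y ≠ 0 :=
  (M.unitAt_rat c (exists_mem_inf c x y).choose_spec.1 (exists_mem_inf c x y).choose_spec.2).ne_zero

theorem rat_mul_rat (c : LineBundleCocycle X) (x y z : X) :
    M.rat c x y * M.rat c y z = M.rat c x z := by
  obtain ⟨w, hw⟩ := exists_mem_inf c x y
  obtain ⟨w, hw⟩ := Scheme.Opens.exists_mem_inf hw (c.mem z)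
  have h := congrArg (fun s : Γ(X, _)ˣ ↦ M.emb w (X.presheaf.germ (c.U x ⊓ c.U y ⊓ c.U z) w
    hw s)) (c.cocycle x y z)
  simp only [Units.val_mul, map_mul, M.emb_germ_res] at h
  rwa [← M.rat_eq, ← M.rat_eq, ← M.rat_eq] at h

theorem rat_div_rat (c : LineBundleCocycle X) (x y z : X) :
    M.rat c x z / M.rat c y z = M.rat c x y := by
  rw [← M.rat_mul_rat c x y z, mul_div_cancel_right₀ _ (M.rat_ne_zero _ _ _)]

theorem iso_iff (c d : LineBundleCocycle X) (x₀ : X) :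
    c.Iso d ↔ ∃ f : F, ∀ x, M.UnitAt x (f * (M.rat c x x₀ / M.rat d x x₀)) := by
  constructor
  · rintro ⟨W, hW, hc, hd, f, hf⟩
    have key (x y : X) : M.emb x (X.presheaf.germ _ x (hW x) (f x)) * M.rat c x y =
        M.rat d x y * M.emb y (X.presheaf.germ _ y (hW y) (f y)) := by
      obtain ⟨z, hz⟩ := Scheme.Opens.exists_mem_inf (hW x) (hW y)
      have h := congrArg (fun s : Γ(X, _)ˣ ↦ M.emb z (X.presheaf.germ (W x ⊓ W y) z hz s)) (hf x y)
      simp only [Units.val_mul, map_mul, M.emb_germ_res] at h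
      rwa [← M.rat_eq, ← M.rat_eq, M.emb_germ _ _ (hW x), M.emb_germ _ _ (hW y)] at h
    refine ⟨(M.emb x₀ (X.presheaf.germ _ x₀ (hW x₀) (f x₀)))⁻¹, fun x ↦ ?_⟩
    have h0 := (M.unitAt_germ (f x₀) (hW x₀)).ne_zero
    have hx := M.unitAt_germ (f x) (hW x)
    convert hx.inv using 1
    have := key x x₀
    have h1 := M.rat_ne_zero d x x₀
    have h2 := hx.ne_zero
    field_simp
    rw [mul_comm] at this
    rw [this, mul_comm]
  · rintro ⟨f, hf⟩
    have hf0 : f ≠ 0 := left_ne_zero_of_mul (hf x₀).ne_zero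
    have key (x : X) : ∃ u : Γ(X, c.U x ⊓ d.U x)ˣ, ∀ y (hy : y ∈ c.U x ⊓ d.U x),
        M.emb y (X.presheaf.germ _ y hy u) = (f * (M.rat c x x₀ / M.rat d x x₀))⁻¹ := by
      refine M.exists_unit_section fun y hy ↦ ?_
      have h := (hf y).mul ((M.unitAt_rat c hy.1 (c.mem y)).div (M.unitAt_rat d hy.2 (d.mem y)))
      rw [← M.rat_div_rat c x y x₀, ← M.rat_div_rat d x y x₀] at h
      convert h.inv using 2
      have h1 := M.rat_ne_zero d x x₀
      have h2 := M.rat_ne_zero c y x₀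
      have h3 := M.rat_ne_zero d y x₀
      field_simp
    choose u hu using key
    refine ⟨fun x ↦ c.U x ⊓ d.U x, fun x ↦ ⟨c.mem x, d.mem x⟩, fun _ ↦ inf_le_left,
      fun _ ↦ inf_le_right, u, fun x y ↦ Units.ext (M.section_ext fun z hz ↦ ?_)⟩
    simp only [Units.val_mul, map_mul, M.emb_germ_res, hu]
    rw [← M.rat_eq, ← M.rat_eq, ← M.rat_div_rat c x y x₀, ← M.rat_div_rat d x y x₀]
    have h1 := M.rat_ne_zero d x x₀
    have h2 := M.rat_ne_zero c y x₀
    have h3 := M.rat_ne_zero d y x₀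
    have h4 := M.rat_ne_zero c x x₀
    field_simp

theorem iso_one_iff (c : LineBundleCocycle X) (x₀ : X) :
    c.Iso .one ↔ ∃ f : F, ∀ x, M.UnitAt x (f * M.rat c x x₀) := by
  rw [M.iso_iff c _ x₀]
  have (x : X) : M.rat .one x x₀ = 1 := by
    rw [rat]
    simp
  simp only [this, div_one]

theorem isCartier_rat (c : LineBundleCocycle X) (x₀ : X) : M.IsCartier fun x ↦ M.rat c x x₀ := by
  refine fun x ↦ ⟨M.rat_ne_zero _ _ _, c.U x, c.mem x, fun y hy ↦ ?_⟩
  rw [M.rat_div_rat]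
  exact M.unitAt_rat c hy (c.mem y)

variable {M} in
theorem IsCartier.exists_cocycle {φ : X → F} (hφ : M.IsCartier φ) :
    ∃ c : LineBundleCocycle X, ∀ x y, M.rat c x y = φ x / φ y := by
  choose h0 U hU hφ using hφ
  have key (x y : X) : ∃ s : Γ(X, U x ⊓ U y)ˣ, ∀ z (hz : z ∈ U x ⊓ U y),
      M.emb z (X.presheaf.germ _ z hz s) = φ x / φ y := by
    refine M.exists_unit_section fun z hz ↦ ?_
    convert (hφ x z hz.1).div (hφ y z hz.2) using 1
    have := h0 z
    have := h0 y
    field_simp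
  choose g hg using key
  refine ⟨⟨U, hU, g, fun x y z ↦ Units.ext (M.section_ext fun w hw ↦ ?_)⟩, fun x y ↦ ?_⟩
  · simp only [Units.val_mul, map_mul, M.emb_germ_res, hg]
    have := h0 z
    have := h0 y
    field_simp
  · exact hg x y _ _

end FieldModel

namespace SchemePic

variable {X Y Z : Scheme.{u}}

theorem map_comp_apply (φ : Y ⟶ X) (ψ : Z ⟶ Y) (c : SchemePic X) :
    map (ψ ≫ φ) c = map ψ (map φ c) := by
  obtain ⟨c⟩ := c
  refine Quotient.sound ⟨fun z ↦ ψ ⁻¹ᵁ φ ⁻¹ᵁ c.U (φ (ψ z)), fun z ↦ c.mem _, fun z ↦ le_rfl,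
    fun z ↦ le_rfl, fun _ ↦ 1, fun x y ↦ ?_⟩
  rw [map_one, map_one, one_mul, mul_one]
  rfl

theorem map_id_apply (c : SchemePic X) : map (𝟙 X) c = c := by
  obtain ⟨c⟩ := c
  refine Quotient.sound ⟨c.U, c.mem, fun z ↦ le_rfl, fun z ↦ le_rfl, fun _ ↦ 1, fun x y ↦ ?_⟩
  rw [map_one, map_one, one_mul, mul_one]
  rfl

theorem map_bijective_of_isIso (φ : Y ⟶ X) [IsIso φ] : Function.Bijective (map φ) :=
  ⟨Function.LeftInverse.injective (g := map (inv φ)) fun c ↦ by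
      rw [← map_comp_apply, IsIso.inv_hom_id, map_id_apply],
    Function.RightInverse.surjective (g := map (inv φ)) fun c ↦ by
      rw [← map_comp_apply, IsIso.hom_inv_id, map_id_apply]⟩

end SchemePic

namespace FieldModel

open SchemePic

variable {X Y : Scheme.{u}} {F : Type v} [Field F] (M : FieldModel X F)

theorem reg_le_of_specializes {w x : X} (h : w ⤳ x) : M.reg x ≤ M.reg w := by
  rintro _ ⟨s, rfl⟩
  obtain ⟨U, hU, s, rfl⟩ := X.presheaf.exists_germ_eq s
  exact ⟨X.presheaf.germ U w (h.mem_open U.isOpen hU) s, M.emb_germ _ _ _⟩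

variable {M} in
theorem IsCartier.unitAt_of_specializes {φ : X → F} (hφ : M.IsCartier φ) {w x : X} (h : w ⤳ x) :
    M.UnitAt w (φ x / φ w) := by
  obtain ⟨U, hU, hφ⟩ := (hφ x).2
  exact hφ w (h.mem_open U.isOpen hU)

/-- A family of local equations of an integral closed subscheme of codimension one, with generic
point `w`. -/
structure IsPrimeDivisor (δ : X → F) : Prop where
  isCartier : M.IsCartier δ
  mem : ∀ x, δ x ∈ M.reg x
  generic : ∃ w : X, ∀ x, M.UnitAt x (δ x) ∨ (w ⤳ x ∧
    (∀ f ∈ M.reg x, ∀ g ∈ M.reg x, f * g / δ x ∈ M.reg x → f / δ x ∈ M.reg x ∨ g / δ x ∈ M.reg x) ∧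
    ∀ f ∈ M.reg x, f / δ x ∈ M.reg w → f / δ x ∈ M.reg x)

variable {M}

theorem IsPrimeDivisor.div_mem {δ : X → F} (hδ : M.IsPrimeDivisor δ) {ψ : X → F}
    (hψ : M.IsCartier ψ) (hmem : ∀ x, ψ x ∈ M.reg x) {y : X} (hy : ¬ M.UnitAt y (δ y))
    (h : ψ y / δ y ∈ M.reg y) (z : X) : ψ z / δ z ∈ M.reg z := by
  obtain ⟨w, hw⟩ := hδ.generic
  by_cases hz : M.UnitAt z (δ z)
  · rw [div_eq_mul_inv]
    exact mul_mem (hmem z) hz.inv.mem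
  · obtain ⟨hwy, -⟩ := (hw y).resolve_left hy
    obtain ⟨hwz, -, hsat⟩ := (hw z).resolve_left hz
    refine hsat _ (hmem z) ?_
    have h1 := (hψ.unitAt_of_specializes hwz).div (hψ.unitAt_of_specializes hwy)
    have h2 := (hδ.isCartier.unitAt_of_specializes hwy).div
      (hδ.isCartier.unitAt_of_specializes hwz)
    have := mul_mem (h1.mul h2).mem (M.reg_le_of_specializes hwy h)
    have := (hψ w).1
    have := (hψ y).1
    have := (hδ.isCartier w).1
    have := (hδ.isCartier y).1
    have := (hδ.isCartier z).1
    convert ‹_ * _ ∈ M.reg w› using 1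
    field_simp

/-- An effective divisor that is bounded by a sum of prime divisors is itself a sum of some of
these prime divisors. -/
theorem exists_prod_of_div_mem (L : List (X → F)) (hL : ∀ δ ∈ L, M.IsPrimeDivisor δ) (φ : X → F)
    (hφ : M.IsCartier φ) (hmem : ∀ x, φ x ∈ M.reg x)
    (hdiv : ∀ x, (L.map (· x)).prod / φ x ∈ M.reg x) :
    ∃ L' : List (X → F), L' ⊆ L ∧ ∀ x, M.UnitAt x (φ x / (L'.map (· x)).prod) := by
  induction L generalizing φ with
  | nil =>
    refine ⟨[], List.Subset.refl _, fun x ↦ ?_⟩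
    have := hdiv x
    simp only [List.map_nil, List.prod_nil, one_div, div_one] at this ⊢
    exact ⟨(hφ x).1, hmem x, this⟩
  | cons δ L ih =>
    have hδ := hL δ List.mem_cons_self
    have hL' : ∀ δ ∈ L, M.IsPrimeDivisor δ := fun δ h ↦ hL δ (List.mem_cons_of_mem _ h)
    by_cases h : ∀ x, φ x / δ x ∈ M.reg x
    · obtain ⟨L', hs, hu⟩ := ih hL' (fun x ↦ φ x * (δ x)⁻¹) (hφ.mul hδ.isCartier.inv)
        (fun x ↦ by rw [← div_eq_mul_inv]; exact h x) (fun x ↦ by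
          have := hdiv x
          rw [List.map_cons, List.prod_cons] at this
          convert this using 1
          have := (hφ x).1
          have := (hδ.isCartier x).1
          field_simp)
      refine ⟨δ :: L', List.cons_subset_cons _ hs, fun x ↦ ?_⟩
      convert hu x using 1
      rw [List.map_cons, List.prod_cons, div_mul_eq_div_div, div_eq_mul_inv (φ x)]
    · have hdiv' (z : X) : (L.map (· z)).prod / φ z ∈ M.reg z := by
        have hdz := hdiv z
        rw [List.map_cons, List.prod_cons] at hdz
        by_cases hz : M.UnitAt z (δ z)
        · rwa [mul_div_assoc, hz.mul_mem_iff] at hdz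
        · obtain ⟨w, hw⟩ := hδ.generic
          obtain ⟨-, hprime, -⟩ := (hw z).resolve_left hz
          have h0 := (hφ z).1
          have h1 := (hδ.isCartier z).1
          have hPm : (L.map (· z)).prod ∈ M.reg z :=
            list_prod_mem fun f hf ↦ by
              obtain ⟨δ', hδ', rfl⟩ := List.mem_map.mp hf
              exact (hL' _ hδ').mem z
          rcases hprime _ (hmem z) _ hdz (by convert hPm using 1; field_simp) with h' | h'
          · exact absurd (hδ.div_mem hφ hmem hz h') h
          · convert h' using 1
            field_simp
      obtain ⟨L', hs, hu⟩ := ih hL' φ hφ hmem hdiv'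
      exact ⟨L', List.Subset.trans hs (List.subset_cons_self _ _), hu⟩

theorem exists_prod_of_mul_mem (L : List (X → F)) (hL : ∀ δ ∈ L, M.IsPrimeDivisor δ) (φ : X → F)
    (hφ : M.IsCartier φ) (hmem : ∀ x, φ x * (L.map (· x)).prod ∈ M.reg x)
    (hdiv : ∀ x, (φ x)⁻¹ * (L.map (· x)).prod ∈ M.reg x) :
    ∃ L' : List (X → F), L' ⊆ L ∧
      ∀ x, M.UnitAt x (φ x * (L.map (· x)).prod / (L'.map (· x)).prod) := by
  have hC (L : List (X → F)) (hL : ∀ δ ∈ L, M.IsPrimeDivisor δ) :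
      M.IsCartier fun x ↦ (L.map (· x)).prod := by
    induction L with
    | nil => exact isCartier_const M one_ne_zero
    | cons δ L ih =>
      exact (hL δ List.mem_cons_self).isCartier.mul
        (ih fun δ h ↦ hL δ (List.mem_cons_of_mem _ h))
  obtain ⟨L', hs, hu⟩ := exists_prod_of_div_mem (L ++ L)
    (fun δ h ↦ hL δ (by simpa using h)) _ (hφ.mul (hC L hL)) hmem (fun x ↦ by
      convert hdiv x using 1
      have := (hφ x).1
      have := (hC L hL x).1
      rw [List.map_append, List.prod_append]
      field_simp)
  exact ⟨L', fun δ h ↦ by simpa using hs h, hu⟩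

/-! ### Comparison along a morphism -/

variable {F' : Type v} [Field F'] (M' : FieldModel Y F') (f : Y ⟶ X) (j : F →+* F')

variable (M) in
/-- The pullback of germs along a morphism is given by a homomorphism of fields. -/
def Compatible : Prop :=
  ∀ (y : Y) (s : X.presheaf.stalk (f y)), M'.emb y (f.stalkMap y s) = j (M.emb (f y) s)

variable {M'} {f} {j}

theorem Compatible.map_mem (h : M.Compatible M' f j) {y : Y} {g : F} (hg : g ∈ M.reg (f y)) :
    j g ∈ M'.reg y := by
  obtain ⟨s, rfl⟩ := hg
  exact ⟨_, h y s⟩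

theorem Compatible.unitAt (h : M.Compatible M' f j) {y : Y} {g : F} (hg : M.UnitAt (f y) g) :
    M'.UnitAt y (j g) :=
  ⟨(map_ne_zero j).mpr hg.1, h.map_mem hg.2.1, by rw [← map_inv₀]; exact h.map_mem hg.2.2⟩

theorem isUnit_of_unitAt {x : X} {s : X.presheaf.stalk x} (h : M.UnitAt x (M.emb x s)) :
    IsUnit s := by
  obtain ⟨t, ht⟩ := h.2.2
  refine IsUnit.of_mul_eq_one t (M.emb_injective x ?_)
  rw [map_mul, map_one, ht, mul_inv_cancel₀ h.ne_zero]

theorem Compatible.unitAt_of_mem (h : M.Compatible M' f j) {y : Y} {g : F}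
    (hg : g ∈ M.reg (f y)) (hu : M'.UnitAt y (j g)) : M.UnitAt (f y) g := by
  obtain ⟨s, rfl⟩ := hg
  rw [← h y s] at hu
  exact .of_isUnit ((isUnit_map_iff (f.stalkMap y).hom s).mp (isUnit_of_unitAt hu))

theorem Compatible.isCartier (h : M.Compatible M' f j) {φ : X → F} (hφ : M.IsCartier φ) :
    M'.IsCartier fun y ↦ j (φ (f y)) := by
  intro y
  obtain ⟨h0, U, hU, hu⟩ := hφ (f y)
  refine ⟨(map_ne_zero j).mpr h0, f ⁻¹ᵁ U, hU, fun z hz ↦ ?_⟩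
  rw [← map_div₀]
  exact h.unitAt (hu _ hz)

variable [PreirreducibleSpace X] [PreirreducibleSpace Y]

theorem Compatible.rat_pullback (h : M.Compatible M' f j) (c : LineBundleCocycle X) (x y : Y) :
    M'.rat (c.pullback f) x y = j (M.rat c (f x) (f y)) := by
  obtain ⟨z, hz⟩ := exists_mem_inf (c.pullback f) x y
  have hz' : f z ∈ c.U (f x) ⊓ c.U (f y) := hz
  rw [M'.rat_eq _ hz, M.rat_eq c hz', ← h]
  exact congrArg (M'.emb z)
    (Scheme.Hom.germ_stalkMap_apply f _ z hz' (c.g (f x) (f y) : Γ(X, _))).symm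

theorem Compatible.map_surjective (h : M.Compatible M' f j) (y₀ : Y)
    (H : ∀ d : LineBundleCocycle Y, ∃ φ, M.IsCartier φ ∧ ∃ g : F',
      ∀ y, M'.UnitAt y (g * (j (φ (f y)) / M'.rat d y y₀))) :
    Function.Surjective (SchemePic.map f) := by
  rintro ⟨d⟩
  obtain ⟨φ, hφ, g, hg⟩ := H d
  obtain ⟨c, hc⟩ := hφ.exists_cocycle
  refine ⟨Quotient.mk _ c, Quotient.sound ((M'.iso_iff _ _ y₀).mpr
    ⟨g * j (φ (f y₀)), fun y ↦ ?_⟩)⟩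
  convert hg y using 1
  rw [h.rat_pullback, hc, map_div₀]
  have := (map_ne_zero j).mpr (hφ (f y₀)).1
  field_simp

theorem Compatible.map_injective (h : M.Compatible M' f j) (y₀ : Y)
    (H : ∀ (c : LineBundleCocycle X) (g : F'),
      (∀ y, M'.UnitAt y (g * j (M.rat c (f y) (f y₀)))) →
      ∃ g' : F, ∀ x, M.UnitAt x (g' * M.rat c x (f y₀))) :
    Function.Injective (SchemePic.map f) := by
  refine (injective_iff_map_eq_one _).mpr ?_
  rintro ⟨c⟩ hc
  obtain ⟨g, hg⟩ := (M'.iso_one_iff _ y₀).mp (Quotient.exact hc)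
  refine Quotient.sound ((M.iso_one_iff _ (f y₀)).mpr (H c g fun y ↦ ?_))
  rw [← h.rat_pullback]
  exact hg y

end FieldModel

namespace FieldModel

open SchemePic

section OpenImmersion

variable {X Y : Scheme.{u}} {F : Type v} [Field F] (M : FieldModel X F) (f : Y ⟶ X)
  [IsOpenImmersion f]

/-- The restriction along an open immersion. -/
def restrict : FieldModel Y F where
  emb y := (M.emb (f y)).comp (inv (f.stalkMap y)).hom
  emb_injective y := (M.emb_injective _).comp
    (asIso (f.stalkMap y)).commRingCatIsoToRingEquiv.symm.injective
  emb_germ {U} s x y hx hy := by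
    have key (z : Y) (hz : z ∈ U) : (inv (f.stalkMap z)).hom (Y.presheaf.germ U z hz s) =
        X.presheaf.germ (f ''ᵁ U) (f z) (Set.mem_image_of_mem f hz) ((f.appIso U).inv s) := by
      have h : f.stalkMap z (X.presheaf.germ (f ''ᵁ U) (f z) (Set.mem_image_of_mem f hz)
          ((f.appIso U).inv s)) = Y.presheaf.germ U z hz s := by
        refine (Scheme.Hom.germ_stalkMap_apply f _ z (Set.mem_image_of_mem f hz) _).trans ?_
        have := congrArg (fun φ ↦ φ.hom s) (f.appIso_inv_app U)
        simp only [CommRingCat.hom_comp, RingHom.comp_apply] at this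
        erw [this]
        exact TopCat.Presheaf.germ_res_apply' Y.presheaf _ z _ s
      rw [← h]
      exact congrArg (fun φ ↦ φ.hom (X.presheaf.germ (f ''ᵁ U) (f z) (Set.mem_image_of_mem f hz)
          ((f.appIso U).inv s))) (IsIso.hom_inv_id (f.stalkMap z))
    simp only [RingHom.comp_apply, key]
    exact M.emb_germ _ _ _

theorem compatible_restrict : M.Compatible (M.restrict f) f (RingHom.id F) := fun y s ↦
  congrArg (M.emb (f y)) (congrArg (fun φ ↦ φ.hom s) (IsIso.hom_inv_id (f.stalkMap y)))

theorem reg_restrict (y : Y) : (M.restrict f).reg y = M.reg (f y) := by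
  refine le_antisymm ?_ fun g hg ↦ (M.compatible_restrict f).map_mem hg
  rintro _ ⟨s, rfl⟩
  exact ⟨_, rfl⟩

theorem unitAt_restrict {y : Y} {g : F} : (M.restrict f).UnitAt y g ↔ M.UnitAt (f y) g := by
  rw [UnitAt, UnitAt, reg_restrict]

end OpenImmersion

section Spec

variable {R : CommRingCat.{u}} {F : Type v} [Field F] (M : FieldModel (Spec R) F)

variable (R) in
/-- The ring homomorphism from the coordinate ring to a stalk. -/
def toStalkHom (x : PrimeSpectrum R) : R →+* (Spec R).presheaf.stalk x :=
  (StructureSheaf.toStalk R x).hom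

theorem exists_stalk_mul_eq (x : PrimeSpectrum R) (s : (Spec R).presheaf.stalk x) :
    ∃ a b : R, b ∉ x.asIdeal ∧
      s * toStalkHom R x b = toStalkHom R x a := by
  obtain ⟨⟨a, b⟩, h⟩ := IsLocalization.surj (M := x.asIdeal.primeCompl)
    (S := (Spec.structureSheaf R).presheaf.stalk x) s
  exact ⟨a, b, b.2, h⟩

theorem isUnit_toStalk (x : PrimeSpectrum R) {b : R} (hb : b ∉ x.asIdeal) :
    IsUnit (toStalkHom R x b) :=
  IsLocalization.map_units (M := x.asIdeal.primeCompl)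
    ((Spec.structureSheaf R).presheaf.stalk x) ⟨b, hb⟩

/-- The embedding of the global sections. -/
def const (x : Spec R) : R →+* F := (M.emb x).comp (toStalkHom R x)

theorem const_eq (x y : Spec R) : M.const x = M.const y := by
  ext r
  exact M.emb_germ (U := ⊤) _ _ _

theorem mem_reg_iff (x z : Spec R) {f : F} :
    f ∈ M.reg x ↔ ∃ a b : R, b ∉ x.asIdeal ∧ f * M.const z b = M.const z a := by
  rw [M.const_eq z x]
  constructor
  · rintro ⟨s, rfl⟩
    obtain ⟨a, b, hb, h⟩ := exists_stalk_mul_eq x s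
    exact ⟨a, b, hb, (map_mul (M.emb x) _ _).symm.trans (congrArg (M.emb x) h)⟩
  · rintro ⟨a, b, hb, h⟩
    have hb' : M.UnitAt x (M.const x b) := .of_isUnit (isUnit_toStalk x hb)
    rw [← hb'.mul_mem_iff, mul_comm, h]
    exact ⟨_, rfl⟩

theorem unitAt_const (x z : Spec R) {b : R} (hb : b ∉ x.asIdeal) : M.UnitAt x (M.const z b) := by
  rw [M.const_eq z x]
  exact .of_isUnit (isUnit_toStalk x hb)

theorem const_mem (x z : Spec R) (b : R) : M.const z b ∈ M.reg x := by
  rw [M.const_eq z x]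
  exact ⟨_, rfl⟩

theorem const_injective [IsDomain R] (z : Spec R) : Function.Injective (M.const z) := by
  rw [injective_iff_map_eq_zero]
  intro a ha
  by_contra h
  exact (M.unitAt_const ⟨⊥, Ideal.isPrime_bot⟩ z (b := a) h).ne_zero ha

theorem isPrimeDivisor_const [IsDomain R] (z : Spec R) {p : R} (hp : Prime p) :
    M.IsPrimeDivisor fun _ ↦ M.const z p := by
  have hinj := M.const_injective z
  have h0 : M.const z p ≠ 0 := (map_ne_zero_iff _ hinj).mpr hp.ne_zero
  have hP : (Ideal.span {p}).IsPrime := (Ideal.span_singleton_prime hp.ne_zero).mpr hp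
  let w : Spec R := ⟨_, hP⟩
  refine ⟨isCartier_const M h0, fun x ↦ M.const_mem x z p, ⟨w, fun x ↦ ?_⟩⟩
  by_cases hx : p ∈ x.asIdeal
  swap
  · exact .inl (M.unitAt_const x z hx)
  have hne {b : R} (hb : b ∉ x.asIdeal) : M.const z b ≠ 0 := (M.unitAt_const x z hb).ne_zero
  have hpb {b : R} (hb : b ∉ x.asIdeal) : ¬ p ∣ b := fun h ↦ hb (x.asIdeal.mem_of_dvd h hx)
  have key {f : F} {a b : R} (hb : b ∉ x.asIdeal) (h : f * M.const z b = M.const z a) (hd : p ∣ a) :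
      f / M.const z p ∈ M.reg x := by
    obtain ⟨c, rfl⟩ := hd
    rw [M.mem_reg_iff x z]
    refine ⟨c, b, hb, ?_⟩
    rw [map_mul] at h
    field_simp
    rw [h]
  refine .inr ⟨?_, fun f hf g hg hfg ↦ ?_, fun f hf hfw ↦ ?_⟩
  · exact (PrimeSpectrum.le_iff_specializes w x).mp
      ((Ideal.span_singleton_le_iff_mem _).mpr hx)
  · rw [M.mem_reg_iff x z] at hf hg hfg
    obtain ⟨a, b, hb, h⟩ := hf
    obtain ⟨a', b', hb', h'⟩ := hg
    obtain ⟨c, d, hd, h''⟩ := hfg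
    have : a * a' * d = p * (c * b * b') := hinj (by
      simp only [map_mul, ← h, ← h', ← h'']
      field_simp)
    rcases hp.dvd_or_dvd (Dvd.intro _ this.symm) with h1 | h1
    · rcases hp.dvd_or_dvd h1 with h1 | h1
      · exact .inl (key hb h h1)
      · exact .inr (key hb' h' h1)
    · exact absurd h1 (hpb hd)
  · rw [M.mem_reg_iff x z] at hf
    rw [M.mem_reg_iff w z] at hfw
    obtain ⟨a, b, hb, h⟩ := hf
    obtain ⟨c, d, hd, h'⟩ := hfw
    refine key hb h ?_
    have : a * d = p * (c * b) := hinj (by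
      simp only [map_mul, ← h, ← h']
      field_simp)
    refine (hp.dvd_or_dvd (Dvd.intro _ this.symm)).resolve_right fun h1 ↦ hd ?_
    exact Ideal.mem_span_singleton.mpr h1

theorem exists_unitAt_of_isCartier [IsDomain R] [UniqueFactorizationMonoid R] {φ : Spec R → F}
    (hφ : M.IsCartier φ) (hf : ∀ x, ∃ y, φ x ∈ M.reg y) : ∃ f, ∀ x, M.UnitAt x (f * φ x) := by
  let z : Spec R := ⟨⊥, Ideal.isPrime_bot⟩
  have hinj := M.const_injective z
  have hne {b : R} (hb : b ≠ 0) : M.const z b ≠ 0 := (map_ne_zero_iff _ hinj).mpr hb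
  have key (x : Spec R) : ∃ (a b : R) (U : (Spec R).Opens), a ≠ 0 ∧ b ≠ 0 ∧ x ∈ U ∧
      ∀ y ∈ U, M.const z b * φ y ∈ M.reg y ∧ M.const z a * (φ y)⁻¹ ∈ M.reg y := by
    obtain ⟨y, hy⟩ := hf x
    obtain ⟨h0, U, hU, hu⟩ := hφ x
    rw [M.mem_reg_iff y z] at hy
    obtain ⟨a, b, hb, h⟩ := hy
    have hb0 : b ≠ 0 := by rintro rfl; exact hb (zero_mem _)
    refine ⟨a, b, U, ?_, hb0, hU, fun w hw ↦ ⟨?_, ?_⟩⟩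
    · rintro rfl
      rw [map_zero] at h
      exact mul_ne_zero h0 (hne hb0) h
    · rw [← (hu w hw).mul_mem_iff]
      convert M.const_mem w z a using 1
      have := (hφ w).1
      field_simp
      linear_combination h
    · rw [← (hu w hw).inv.mul_mem_iff]
      convert M.const_mem w z b using 1
      have := (hφ w).1
      field_simp
      linear_combination -h
  choose a b U ha hb hU hab using key
  obtain ⟨t, ht⟩ := isCompact_univ.elim_finite_subcover (fun x ↦ (U x : Set (Spec R)))
    (fun x ↦ (U x).isOpen) (fun x _ ↦ Set.mem_iUnion.mpr ⟨x, hU x⟩)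
  set A := ∏ x ∈ t, a x with hA
  set B := ∏ x ∈ t, b x with hB
  have hA0 : A ≠ 0 := Finset.prod_ne_zero_iff.mpr fun x _ ↦ ha x
  have hB0 : B ≠ 0 := Finset.prod_ne_zero_iff.mpr fun x _ ↦ hb x
  have hmem (y : Spec R) : M.const z B * φ y ∈ M.reg y ∧ M.const z A * (φ y)⁻¹ ∈ M.reg y := by
    obtain ⟨x, hx, hy⟩ := Set.mem_iUnion₂.mp (ht (Set.mem_univ y))
    obtain ⟨h1, h2⟩ := hab x y hy
    obtain ⟨c, hc⟩ := Finset.dvd_prod_of_mem a hx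
    obtain ⟨d, hd⟩ := Finset.dvd_prod_of_mem b hx
    rw [hA, hB, hc, hd, map_mul, map_mul, mul_assoc, mul_assoc, mul_left_comm,
      mul_left_comm (M.const z (a x))]
    exact ⟨mul_mem (M.const_mem y z d) h1, mul_mem (M.const_mem y z c) h2⟩
  obtain ⟨s, hs, u, hu⟩ := UniqueFactorizationMonoid.exists_prime_factors (A * B)
    (mul_ne_zero hA0 hB0)
  obtain ⟨L', hL', hu'⟩ := exists_prod_of_div_mem
    (s.toList.map fun p (_ : Spec R) ↦ M.const z p)
    (fun δ hδ ↦ by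
      obtain ⟨p, hp, rfl⟩ := List.mem_map.mp hδ
      exact M.isPrimeDivisor_const z (hs p (Multiset.mem_toList.mp hp)))
    (fun x ↦ M.const z B * φ x) ((isCartier_const M (hne hB0)).mul hφ) (fun y ↦ (hmem y).1)
    (fun y ↦ by
      have e : ((s.toList.map fun p (_ : Spec R) ↦ M.const z p).map (· y)).prod * M.const z u =
          M.const z (A * B) := by
        rw [List.map_map, ← hu, map_mul, ← Multiset.prod_toList s, map_list_prod]
        rfl
      have hun : M.UnitAt y (M.const z u) :=
        M.unitAt_const y z fun h ↦ y.2.ne_top (Ideal.eq_top_of_isUnit_mem _ h u.isUnit)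
      rw [← hun.mul_mem_iff, mul_div_assoc', mul_comm, e, map_mul]
      convert (hmem y).2 using 1
      have := hne hB0
      have := (hφ y).1
      field_simp)
  by_cases hy : Nonempty (Spec R)
  swap
  · exact ⟨0, fun x ↦ absurd ⟨x⟩ hy⟩
  have hc : ∀ (L' : List (Spec R → F)), L' ⊆ (s.toList.map fun p (_ : Spec R) ↦ M.const z p) →
      ∀ x, (L'.map (· x)).prod = (L'.map (· z)).prod := by
    intro L' hL' x
    congr 1
    refine List.map_congr_left fun δ hδ ↦ ?_
    obtain ⟨p, -, rfl⟩ := List.mem_map.mp (hL' hδ)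
    rfl
  refine ⟨M.const z B / (L'.map (· z)).prod, fun x ↦ ?_⟩
  convert hu' x using 1
  rw [hc L' hL' x, div_mul_eq_mul_div]

end Spec

end FieldModel

/-! ### The projective spectrum of a graded domain -/

namespace ProjModel

variable {A σ : Type u} [CommRing A] [IsDomain A] [SetLike σ A] [AddSubgroupClass σ A]
  (𝒜 : ℕ → σ) [GradedRing 𝒜]

theorem algebraMap_ne_zero {a : A} (ha : a ≠ 0) : algebraMap A (FractionRing A) a ≠ 0 :=
  (map_ne_zero_iff _ (IsFractionRing.injective A _)).mpr ha

theorem ne_zero_of_notMem {x : ProjectiveSpectrum 𝒜} {b : A} (hb : b ∉ x.asHomogeneousIdeal) :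
    b ≠ 0 := fun h ↦ hb (h ▸ zero_mem _)

/-- The fraction in the field of fractions defined by a homogeneous fraction. -/
def toFrac (x : ProjectiveSpectrum 𝒜) :
    HomogeneousLocalization.AtPrime 𝒜 x.asHomogeneousIdeal.toIdeal →+* FractionRing A :=
  (IsLocalization.lift (M := x.asHomogeneousIdeal.toIdeal.primeCompl)
    (S := Localization.AtPrime x.asHomogeneousIdeal.toIdeal) (g := algebraMap A (FractionRing A))
    fun y ↦ IsUnit.mk0 _ (algebraMap_ne_zero (ne_zero_of_notMem 𝒜 y.2))).comp (algebraMap _ _)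

theorem toFrac_mul (x : ProjectiveSpectrum 𝒜)
    (c : HomogeneousLocalization.NumDenSameDeg 𝒜 x.asHomogeneousIdeal.toIdeal.primeCompl) :
    toFrac 𝒜 x (.mk c) * algebraMap A (FractionRing A) c.den =
      algebraMap A (FractionRing A) c.num := by
  rw [toFrac, RingHom.comp_apply, HomogeneousLocalization.algebraMap_apply,
    HomogeneousLocalization.val_mk, Localization.mk_eq_mk', mul_comm]
  exact (IsLocalization.lift_mk'_spec (M := x.asHomogeneousIdeal.toIdeal.primeCompl)
    (S := Localization.AtPrime x.asHomogeneousIdeal.toIdeal) (g := algebraMap A (FractionRing A))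
    (hg := fun y ↦ IsUnit.mk0 _ (algebraMap_ne_zero (ne_zero_of_notMem 𝒜 y.2)))
    _ _ _).mp rfl |>.symm

theorem toFrac_mk (x : ProjectiveSpectrum 𝒜)
    (c : HomogeneousLocalization.NumDenSameDeg 𝒜 x.asHomogeneousIdeal.toIdeal.primeCompl) :
    toFrac 𝒜 x (.mk c) =
      algebraMap A (FractionRing A) c.num / algebraMap A (FractionRing A) c.den :=
  eq_div_of_mul_eq (algebraMap_ne_zero (ne_zero_of_notMem 𝒜 c.den_mem)) (toFrac_mul 𝒜 x c)

theorem toFrac_injective (x : ProjectiveSpectrum 𝒜) : Function.Injective (toFrac 𝒜 x) := by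
  rw [injective_iff_map_eq_zero]
  intro c hc
  obtain ⟨c, rfl⟩ := HomogeneousLocalization.mk_surjective c
  have h := toFrac_mul 𝒜 x c
  rw [hc, zero_mul, eq_comm, FaithfulSMul.algebraMap_eq_zero_iff] at h
  exact HomogeneousLocalization.mk_eq_zero_of_num c (Subtype.ext h)

variable {𝒜} in
theorem irrelevant_not_le_bot (x : ProjectiveSpectrum 𝒜) :
    ¬ HomogeneousIdeal.irrelevant 𝒜 ≤ ⊥ := fun h ↦ x.not_irrelevant_le (h.trans bot_le)

/-- The generic point. -/
def generic (h : ¬ HomogeneousIdeal.irrelevant 𝒜 ≤ ⊥) : ProjectiveSpectrum 𝒜 where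
  asHomogeneousIdeal := ⊥
  isPrime := Ideal.isPrime_bot
  not_irrelevant_le := h

theorem generic_mem (h : ¬ HomogeneousIdeal.irrelevant 𝒜 ≤ ⊥)
    {U : TopologicalSpace.Opens (ProjectiveSpectrum 𝒜)} {x : ProjectiveSpectrum 𝒜} (hx : x ∈ U) :
    generic 𝒜 h ∈ U := by
  have : x ∈ closure {generic 𝒜 h} :=
    (ProjectiveSpectrum.le_iff_mem_closure 𝒜 _ _).mp (bot_le : (⊥ : HomogeneousIdeal 𝒜) ≤ _)
  obtain ⟨y, hy, rfl⟩ := mem_closure_iff.mp this U U.isOpen hx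
  exact hy

theorem toFrac_section {U : TopologicalSpace.Opens (ProjectiveSpectrum 𝒜)}
    (s : (ProjectiveSpectrum.Proj.structureSheaf 𝒜).1.obj (.op U))
    (h : ¬ HomogeneousIdeal.irrelevant 𝒜 ≤ ⊥) {x : ProjectiveSpectrum 𝒜} (hx : x ∈ U) :
    toFrac 𝒜 x (s.1 ⟨x, hx⟩) = toFrac 𝒜 (generic 𝒜 h) (s.1 ⟨_, generic_mem 𝒜 h hx⟩) := by
  obtain ⟨V, hxV, iVU, n, a, b, hb, e⟩ := s.2 ⟨x, hx⟩
  have h1 := e ⟨x, hxV⟩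
  have h2 := e ⟨_, generic_mem 𝒜 h hxV⟩
  refine (congrArg (toFrac 𝒜 x) h1).trans (Eq.trans ?_ (congrArg (toFrac 𝒜 _) h2).symm)
  exact (toFrac_mk 𝒜 x ⟨n, a, b, hb ⟨x, hxV⟩⟩).trans (toFrac_mk 𝒜 (generic 𝒜 h)
    ⟨n, a, b, hb ⟨_, generic_mem 𝒜 h hxV⟩⟩).symm

instance : PreirreducibleSpace (Proj 𝒜) where
  isPreirreducible_univ := by
    rintro U V hU hV ⟨x, -, hx⟩ ⟨y, -, hy⟩
    exact ⟨generic 𝒜 (irrelevant_not_le_bot x), trivial, generic_mem 𝒜 _ (U := ⟨U, hU⟩) hx,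
      generic_mem 𝒜 _ (U := ⟨V, hV⟩) hy⟩

/-- The local rings of `Proj 𝒜` as subrings of the field of fractions. -/
def model : FieldModel (Proj 𝒜) (FractionRing A) where
  emb x := (toFrac 𝒜 x).comp (Proj.stalkIso 𝒜 x).hom.hom
  emb_injective x := (toFrac_injective 𝒜 x).comp
    (Proj.stalkIso 𝒜 x).commRingCatIsoToRingEquiv.injective
  emb_germ {U} s x y hx hy := by
    have key (z : Proj 𝒜) (hz : z ∈ U) : (Proj.stalkIso 𝒜 z).hom.hom
        ((Proj 𝒜).presheaf.germ U z hz s) = s.1 ⟨z, hz⟩ :=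
      Proj.stalkIso'_germ 𝒜 U z hz s
    simp only [RingHom.comp_apply]
    rw [key, key]
    exact (toFrac_section 𝒜 s (irrelevant_not_le_bot x) hx).trans
      (toFrac_section 𝒜 s (irrelevant_not_le_bot x) hy).symm

theorem model_emb_germ {U : (Proj 𝒜).Opens} (s : Γ(Proj 𝒜, U)) (x : Proj 𝒜) (hx : x ∈ U) :
    (model 𝒜).emb x ((Proj 𝒜).presheaf.germ U x hx s) = toFrac 𝒜 x (s.1 ⟨x, hx⟩) :=
  congrArg (toFrac 𝒜 x) (Proj.stalkIso'_germ 𝒜 U x hx s)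

variable {𝒜}

theorem mem_reg_iff {x : Proj 𝒜} {f : FractionRing A} : f ∈ (model 𝒜).reg x ↔
    ∃ n, ∃ a ∈ 𝒜 n, ∃ b ∈ 𝒜 n, b ∉ x.asHomogeneousIdeal ∧
      f = algebraMap A (FractionRing A) a / algebraMap A (FractionRing A) b := by
  constructor
  · rintro ⟨s, rfl⟩
    obtain ⟨c, hc⟩ := HomogeneousLocalization.mk_surjective ((Proj.stalkIso 𝒜 x).hom.hom s)
    refine ⟨c.deg, c.num, c.num.2, c.den, c.den.2, c.den_mem, ?_⟩
    exact (congrArg (toFrac 𝒜 x) hc.symm).trans (toFrac_mk 𝒜 x c)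
  · rintro ⟨n, a, ha, b, hb, hbx, rfl⟩
    refine ⟨(Proj.stalkIso 𝒜 x).inv.hom (.mk ⟨n, ⟨a, ha⟩, ⟨b, hb⟩, hbx⟩), ?_⟩
    refine Eq.trans ?_ (toFrac_mk 𝒜 x ⟨n, ⟨a, ha⟩, ⟨b, hb⟩, hbx⟩)
    exact congrArg (toFrac 𝒜 x) (congrArg (fun φ ↦ φ.hom
      (HomogeneousLocalization.mk ⟨n, ⟨a, ha⟩, ⟨b, hb⟩, hbx⟩)) (Proj.stalkIso 𝒜 x).inv_hom_id)

theorem mem_reg {x : Proj 𝒜} {n : ℕ} {a b : A} (ha : a ∈ 𝒜 n) (hb : b ∈ 𝒜 n)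
    (hbx : b ∉ x.asHomogeneousIdeal) :
    algebraMap A (FractionRing A) a / algebraMap A (FractionRing A) b ∈ (model 𝒜).reg x :=
  mem_reg_iff.mpr ⟨n, a, ha, b, hb, hbx, rfl⟩

theorem unitAt {x : Proj 𝒜} {n : ℕ} {a b : A} (ha : a ∈ 𝒜 n) (hb : b ∈ 𝒜 n)
    (hax : a ∉ x.asHomogeneousIdeal) (hbx : b ∉ x.asHomogeneousIdeal) :
    (model 𝒜).UnitAt x (algebraMap A (FractionRing A) a / algebraMap A (FractionRing A) b) :=
  ⟨div_ne_zero (algebraMap_ne_zero (ne_zero_of_notMem 𝒜 hax))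
    (algebraMap_ne_zero (ne_zero_of_notMem 𝒜 hbx)), mem_reg ha hb hbx,
    by rw [inv_div]; exact mem_reg hb ha hax⟩

/-- A fraction that is regular on a basic open set is a fraction with a power of the corresponding
element as denominator. -/
theorem exists_eq_div_pow {d : ℕ} (hd : 0 < d) {q : A} (hq : q ∈ 𝒜 d) {f : FractionRing A}
    (hf : ∀ x : Proj 𝒜, q ∉ x.asHomogeneousIdeal → f ∈ (model 𝒜).reg x) (hq0 : q ≠ 0) :
    ∃ n, ∃ a ∈ 𝒜 (n * d), f * algebraMap A (FractionRing A) q ^ n =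
      algebraMap A (FractionRing A) a := by
  obtain ⟨s, hs⟩ := (model 𝒜).exists_section (U := Proj.basicOpen 𝒜 q) hf
  obtain ⟨c, rfl⟩ : ∃ c, (Proj.awayToSection 𝒜 q).hom c = s := by
    refine ⟨(Proj.basicOpenIsoAway 𝒜 q hq hd).inv.hom s, ?_⟩
    exact congrArg (fun φ ↦ φ.hom s) (Proj.basicOpenIsoAway 𝒜 q hq hd).inv_hom_id
  obtain ⟨n, a, ha, rfl⟩ := HomogeneousLocalization.Away.mk_surjective 𝒜 hq c
  have hne : ¬ HomogeneousIdeal.irrelevant 𝒜 ≤ ⊥ := fun h ↦ hq0 (by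
    have := h (HomogeneousIdeal.mem_irrelevant_of_mem 𝒜 hd hq)
    exact this)
  refine ⟨n, a, ha, ?_⟩
  have hg : q ∉ (generic 𝒜 hne).asHomogeneousIdeal := hq0
  rw [← hs (generic 𝒜 hne) hg, ← map_pow]
  refine Eq.trans ?_ (toFrac_mul 𝒜 (generic 𝒜 hne) ⟨n • d, ⟨a, ha⟩, ⟨q ^ n,
    SetLike.pow_mem_graded n hq⟩, fun h ↦ hq0 (eq_zero_of_pow_eq_zero h)⟩)
  exact congrArg (· * _) (model_emb_germ 𝒜 _ _ _)

end ProjModel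

/-! ### Base change of projective spectra -/

/-- A commutative square of schemes is cartesian if it is so on the members of an open cover. -/
theorem isPullback_of_charts {X Y S T : Scheme.{u}} {φ : Y ⟶ X} {pY : Y ⟶ T} {pX : X ⟶ S}
    {t : T ⟶ S} (w : φ ≫ pX = pY ≫ t) {I : Type u} {U V : I → Scheme.{u}} (i : ∀ a, U a ⟶ X)
    (i' : ∀ a, V a ⟶ Y) (g : ∀ a, V a ⟶ U a) [∀ a, IsOpenImmersion (i a)]
    (hc : ∀ x : X, ∃ a, ∃ y : U a, i a y = x) (h1 : ∀ a, IsPullback (g a) (i' a) (i a) φ)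
    (h2 : ∀ a, IsPullback (g a) (i' a ≫ pY) (i a ≫ pX) t) : IsPullback φ pY pX t := by
  let ψ : Y ⟶ pullback pX t := pullback.lift φ pY w
  have hψ1 : ψ ≫ pullback.fst pX t = φ := pullback.lift_fst _ _ _
  have hψ2 : ψ ≫ pullback.snd pX t = pY := pullback.lift_snd _ _ _
  have sqA (a) : IsPullback (g a) (i' a ≫ ψ) (i a) (pullback.fst pX t) := by
    refine IsPullback.of_bot (h₃₁ := t) (v₂₁ := pullback.snd pX t) (v₂₂ := pX) ?_ ?_
      (IsPullback.of_hasPullback pX t)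
    · rw [Category.assoc, hψ2]; exact h2 a
    · rw [Category.assoc, hψ1]; exact (h1 a).w
  have sqB (a) : IsPullback (𝟙 (V a)) (i' a) (i' a ≫ ψ) ψ := by
    refine IsPullback.of_right (h₁₂ := g a) (h₂₂ := pullback.fst pX t) (v₁₃ := i a) ?_ ?_ (sqA a)
    · rw [Category.id_comp, hψ1]; exact h1 a
    · rw [Category.id_comp]
  have hoi (a) : IsOpenImmersion (i' a ≫ ψ) :=
    MorphismProperty.of_isPullback (P := @IsOpenImmersion) (sqA a) inferInstance
  have hcov (x : ↑(pullback pX t)) : ∃ a, ∃ y : V a, (i' a ≫ ψ) y = x := by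
    obtain ⟨a, y, hy⟩ := hc (pullback.fst pX t x)
    obtain ⟨z, -, hz⟩ := Scheme.Pullback.exists_preimage_pullback y x hy
    refine ⟨a, (sqA a).isoPullback.inv z, ?_⟩
    rw [← hz, ← Scheme.Hom.comp_apply, IsPullback.isoPullback_inv_snd]
  have hiso : IsIso ψ := by
    refine IsZariskiLocalAtTarget.of_openCover (P := MorphismProperty.isomorphisms Scheme.{u})
      (Scheme.Cover.mkOfCovers I V (fun a ↦ i' a ≫ ψ) hcov hoi) fun a ↦ ?_
    change IsIso (pullback.snd ψ (i' a ≫ ψ))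
    have := (sqB a).flip.isoPullback_inv_snd
    rw [← this]
    infer_instance
  exact IsPullback.of_iso_pullback ⟨w⟩ (asIso ψ) hψ1 hψ2

namespace ProjModel

section Compatible

variable {A B σ τ : Type u} [CommRing A] [IsDomain A] [SetLike σ A] [AddSubgroupClass σ A]
  [CommRing B] [IsDomain B] [SetLike τ B] [AddSubgroupClass τ B]
  {𝒜 : ℕ → σ} {ℬ : ℕ → τ} [GradedRing 𝒜] [GradedRing ℬ]

theorem toFrac_localRingHom (f : 𝒜 →+*ᵍ ℬ)
    (hf : HomogeneousIdeal.irrelevant ℬ ≤ (HomogeneousIdeal.irrelevant 𝒜).map f)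
    {j : FractionRing A →+* FractionRing B}
    (hj : ∀ a, j (algebraMap A _ a) = algebraMap B _ (f a)) (y : ProjectiveSpectrum ℬ)
    (c : HomogeneousLocalization.AtPrime 𝒜
      (ProjectiveSpectrum.comap f hf y).asHomogeneousIdeal.toIdeal) :
    toFrac ℬ y (HomogeneousLocalization.localRingHom f _ _ rfl c) = j (toFrac 𝒜 _ c) := by
  obtain ⟨c, rfl⟩ := HomogeneousLocalization.mk_surjective c
  refine Eq.trans ?_ (congrArg j (toFrac_mk 𝒜 _ c)).symm
  rw [map_div₀, hj, hj]
  exact toFrac_mk ℬ y _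

theorem compatible_map (f : 𝒜 →+*ᵍ ℬ)
    (hf : HomogeneousIdeal.irrelevant ℬ ≤ (HomogeneousIdeal.irrelevant 𝒜).map f)
    {j : FractionRing A →+* FractionRing B}
    (hj : ∀ a, j (algebraMap A _ a) = algebraMap B _ (f a)) :
    (model 𝒜).Compatible (model ℬ) (Proj.map f hf) j := by
  intro y s
  refine Eq.trans ?_ (toFrac_localRingHom f hf hj y _)
  refine congrArg (toFrac ℬ y) ?_
  have h := Proj.localRingHom_comp_stalkIso_apply f hf y s
  have h' : (Proj.map f hf).stalkMap y s = (Proj.sheafedSpaceMap f hf).hom.stalkMap y s := rfl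
  refine (congrArg (fun z ↦ (Proj.stalkIso ℬ y).hom.hom z) (h'.trans h.symm)).trans ?_
  exact Iso.inv_hom_id_apply (Proj.stalkIso ℬ y) _

end Compatible

section Structure

variable {k A : Type u} [Field k] [CommRing A] [Algebra k A] (𝒜 : ℕ → Submodule k A)
  [GradedAlgebra 𝒜]

/-- The structure morphism of the projective spectrum of a graded algebra over a field. -/
def structureMap : Proj 𝒜 ⟶ Spec (.of k) :=
  Proj.toSpecZero 𝒜 ≫ Spec.map (CommRingCat.ofHom (algebraMap k (𝒜 0)))

/-- The scalars in a homogeneous localization. -/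
def scalars (P : Submonoid A) : k →+* HomogeneousLocalization 𝒜 P :=
  (HomogeneousLocalization.fromZeroRingHom 𝒜 P).comp (algebraMap k (𝒜 0))

theorem awayι_structureMap {s : A} {d : ℕ} (hs : s ∈ 𝒜 d) (hd : 0 < d) :
    Proj.awayι 𝒜 s hs hd ≫ structureMap 𝒜 = Spec.map (CommRingCat.ofHom (scalars 𝒜 _)) := by
  rw [structureMap, Proj.awayι_toSpecZero_assoc, ← Spec.map_comp]
  rfl

end Structure

end ProjModel

theorem isBaseChange_of_basis {R S M N ι : Type*} [CommRing R] [CommRing S] [Algebra R S]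
    [AddCommGroup M] [Module R M] [AddCommGroup N] [Module R N] [Module S N] [IsScalarTower R S N]
    (b : Module.Basis ι R M) (b' : Module.Basis ι S N) (f : M →ₗ[R] N) (h : ∀ i, f (b i) = b' i) :
    IsBaseChange S f := by
  let e := (Algebra.TensorProduct.basis S b).equiv b' (Equiv.refl ι)
  refine IsBaseChange.of_equiv e fun x ↦ ?_
  have : (e.toLinearMap.restrictScalars R).comp (TensorProduct.mk R S M 1) = f := by
    refine b.ext fun i ↦ ?_
    rw [h]
    refine Eq.trans (congrArg e (Algebra.TensorProduct.basis_apply (A := S) b i).symm) ?_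
    exact Module.Basis.equiv_apply ..
  exact LinearMap.congr_fun this x

theorem isPushout_of_basis {k E C D ι : Type u} [CommRing k] [CommRing E] [CommRing C] [CommRing D]
    [Algebra k E] (e : Module.Basis ι k E) {α : k →+* C} {β : E →+* D} {γ : C →+* D}
    (w : ∀ x, γ (α x) = β (algebraMap k E x))
    (hli : ∀ g : ι →₀ C, (g.sum fun i c ↦ γ c * β (e i)) = 0 → g = 0)
    (hsp : ∀ d, ∃ g : ι →₀ C, d = g.sum fun i c ↦ γ c * β (e i)) :
    IsPushout (CommRingCat.ofHom α) (CommRingCat.ofHom (algebraMap k E)) (CommRingCat.ofHom γ)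
      (CommRingCat.ofHom β) := by
  let := α.toAlgebra
  let := β.toAlgebra
  let := γ.toAlgebra
  let : Algebra k D := (β.comp (algebraMap k E)).toAlgebra
  have : IsScalarTower k E D := .of_algebraMap_eq' rfl
  have : IsScalarTower k C D := .of_algebraMap_eq fun x ↦ (w x).symm
  have hs (g : ι →₀ C) : Finsupp.linearCombination C (fun i ↦ β (e i)) g =
      g.sum fun i c ↦ γ c * β (e i) := by
    rw [Finsupp.linearCombination_apply]
    rfl
  let b : Module.Basis ι C D := .mk (v := fun i ↦ β (e i))
    (linearIndependent_iff.mpr fun g hg ↦ hli g ((hs g).symm.trans hg)) (by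
      rintro d -
      obtain ⟨g, rfl⟩ := hsp d
      rw [← hs]
      exact Finsupp.mem_span_range_iff_exists_finsupp.mpr ⟨g, rfl⟩)
  have hb (i : ι) : b i = β (e i) := Module.Basis.mk_apply _ _ i
  have : Algebra.IsPushout k C E D := ⟨isBaseChange_of_basis e b _ fun i ↦ (hb i).symm⟩
  exact CommRingCat.isPushout_of_isPushout k C E D

namespace ProjModel

section

variable {k E A B ι : Type u} [Field k] [Field E] [Algebra k E] [CommRing A] [Algebra k A]
  [CommRing B] [Algebra E B] [Algebra A B] {𝒜 : ℕ → Submodule k A} {ℬ : ℕ → Submodule E B}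
  [GradedAlgebra 𝒜] [GradedAlgebra ℬ] {f : 𝒜 →+*ᵍ ℬ} {e : Module.Basis ι k E}
  {eB : Module.Basis ι A B}

theorem repr_mem (hf : ∀ a, f a = algebraMap A B a) (he : ∀ i, eB i = algebraMap E B (e i))
    {n : ℕ} {b : B} (hb : b ∈ ℬ n) (i : ι) : eB.repr b i ∈ 𝒜 n := by
  classical
  let p : A →ₗ[k] A := GradedAlgebra.proj 𝒜 n
  have hp0 : p 0 = 0 := map_zero p
  have key : eB.repr b = (eB.repr b).mapRange p hp0 := by
    apply eB.repr.symm.injective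
    rw [LinearEquiv.symm_apply_apply, eB.repr_symm_apply, Finsupp.linearCombination_apply,
      Finsupp.sum_mapRange_index (by simp)]
    have h1 : GradedAlgebra.proj ℬ n b = b := by
      exact DirectSum.decompose_of_mem_same ℬ hb
    have h2 := congrArg (GradedAlgebra.proj ℬ n) (eB.linearCombination_repr b)
    rw [h1, Finsupp.linearCombination_apply, map_finsuppSum] at h2
    refine h2.symm.trans (Finset.sum_congr rfl fun i _ ↦ ?_)
    beta_reduce
    rw [Algebra.smul_def, Algebra.smul_def, he, mul_comm, mul_comm _ (algebraMap E B (e i)),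
      ← Algebra.smul_def, ← Algebra.smul_def, map_smul, ← hf, ← hf]
    congr 1
    exact (GradedRingHom.map_directSumDecompose (𝒜 := 𝒜) (ℬ := ℬ) f (x := eB.repr b i)
      (i := n)).symm
  rw [key, Finsupp.mapRange_apply]
  exact SetLike.coe_mem _

variable (𝒜) in
theorem val_scalars (P : Submonoid A) (c : k) : (scalars 𝒜 P c).val =
    algebraMap A (Localization P) (algebraMap k A c) := by
  rw [← Localization.mk_one_eq_algebraMap]
  rfl

theorem isPushout_away (hf : ∀ a, f a = algebraMap A B a)
    (hc : ∀ c, algebraMap A B (algebraMap k A c) = algebraMap E B (algebraMap k E c))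
    (he : ∀ i, eB i = algebraMap E B (e i)) {d : ℕ} {s : A} (hs : s ∈ 𝒜 d) :
    IsPushout (CommRingCat.ofHom (scalars 𝒜 (.powers s))) (CommRingCat.ofHom (algebraMap k E))
      (CommRingCat.ofHom (HomogeneousLocalization.Away.map f s))
      (CommRingCat.ofHom (scalars ℬ (.powers (f s)))) := by
  let LA := Localization (Submonoid.powers s)
  let LB := Localization (Submonoid.powers (f s))
  have hle : Submonoid.powers s ≤ (Submonoid.powers (f s)).comap (algebraMap A B) := by
    rintro _ ⟨n, rfl⟩
    exact ⟨n, by rw [hf, map_pow]⟩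
  have hval (c : HomogeneousLocalization.Away 𝒜 s) :
      (HomogeneousLocalization.Away.map f s c).val =
        IsLocalization.map LB (algebraMap A B) hle c.val := by
    obtain ⟨c, rfl⟩ := HomogeneousLocalization.mk_surjective c
    rw [HomogeneousLocalization.val_mk, Localization.mk_eq_mk', IsLocalization.map_mk',
      ← Localization.mk_eq_mk']
    change Localization.mk _ _ = Localization.mk _ _
    congr 1
    · exact hf _
    · exact Subtype.ext (hf _)
  have hvs (c : E) : (scalars ℬ (.powers (f s)) c).val =
      algebraMap B LB (algebraMap E B c) := val_scalars ℬ _ c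
  refine isPushout_of_basis e ?_ ?_ ?_
  · intro x
    apply HomogeneousLocalization.val_injective
    rw [hval, hvs, val_scalars, IsLocalization.map_eq, hc]
  · intro g hg
    have h := congrArg (algebraMap (HomogeneousLocalization.Away ℬ (f s)) LB) hg
    rw [map_zero, map_finsuppSum] at h
    have hM : Algebra.algebraMapSubmonoid B (Submonoid.powers s) = Submonoid.powers (f s) := by
      rw [hf]
      exact Algebra.algebraMapSubmonoid_powers _
    have : IsLocalization (Algebra.algebraMapSubmonoid B (Submonoid.powers s)) LB := by
      rw [hM]
      infer_instance
    let : Algebra LA LB := (IsLocalization.map LB (algebraMap A B) hle).toAlgebra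
    have : IsScalarTower A LA LB := .of_algebraMap_eq fun a ↦ (IsLocalization.map_eq hle a).symm
    have hli := eB.linearIndependent.localization_localization LA (Submonoid.powers s) LB
    let v : HomogeneousLocalization.Away 𝒜 s → LA := HomogeneousLocalization.val
    have hv0 : v 0 = 0 := HomogeneousLocalization.val_zero
    have h0 := linearIndependent_iff.mp hli (g.mapRange v hv0) (by
      rw [Finsupp.linearCombination_apply, Finsupp.sum_mapRange_index (by simp), ← h]
      refine Finsupp.sum_congr fun i _ ↦ ?_
      rw [map_mul, Algebra.smul_def, Function.comp_apply, he]
      exact (congrArg₂ (· * ·) (hval _) (hvs _)).symm)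
    refine Finsupp.ext fun i ↦ HomogeneousLocalization.val_injective _ ?_
    exact ((Finsupp.mapRange_apply (hf := hv0)).symm.trans (DFunLike.congr_fun h0 i)).trans hv0.symm
  · intro z
    obtain ⟨n, b, hb, rfl⟩ := HomogeneousLocalization.Away.mk_surjective ℬ (f.2 hs) z
    classical
    let m (a : A) : HomogeneousLocalization.Away 𝒜 s :=
      if ha : a ∈ 𝒜 (n • d) then HomogeneousLocalization.Away.mk 𝒜 hs n a ha else 0
    have hm (a : A) (ha : a ∈ 𝒜 (n • d)) : (m a).val =
        Localization.mk a (⟨s ^ n, n, rfl⟩ : Submonoid.powers s) := by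
      simp only [m, dif_pos ha]
      rfl
    have hm0 : m 0 = 0 := by
      apply HomogeneousLocalization.val_injective
      rw [hm 0 (zero_mem _), Localization.mk_zero, HomogeneousLocalization.val_zero]
    refine ⟨(eB.repr b).mapRange m hm0, HomogeneousLocalization.val_injective _ ?_⟩
    rw [Finsupp.sum_mapRange_index (by simp)]
    refine Eq.trans ?_
      (map_finsuppSum (algebraMap (HomogeneousLocalization.Away ℬ (f s)) LB) _ _).symm
    have h1 : b = (eB.repr b).sum fun i a ↦ f a * eB i := by
      refine (eB.linearCombination_repr b).symm.trans ((Finsupp.linearCombination_apply _ _).trans ?_)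
      exact Finsupp.sum_congr fun i _ ↦ by rw [Algebra.smul_def, hf]
    have h2 (i : ι) : algebraMap (HomogeneousLocalization.Away ℬ (f s)) LB
        (HomogeneousLocalization.Away.map f s (m (eB.repr b i)) * scalars ℬ _ (e i)) =
        Localization.mk 1 (⟨f s ^ n, n, rfl⟩ : Submonoid.powers (f s)) * algebraMap B LB (f (eB.repr b i) * eB i) := by
      rw [map_mul]
      refine (congrArg₂ (· * ·) (hval _) (hvs (e i))).trans ?_
      rw [hm _ (repr_mem hf he hb i), Localization.mk_eq_mk', IsLocalization.map_mk', map_mul,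
        ← he, ← mul_assoc, ← Localization.mk_one_eq_algebraMap (f _), Localization.mk_mul, one_mul,
        mul_one, Localization.mk_eq_mk']
      congr 2
      · exact (hf _).symm
      · exact Subtype.ext ((map_pow (algebraMap A B) s n).trans (congrArg (· ^ n) (hf s).symm))
    have h3 : ((eB.repr b).sum fun i a ↦ Localization.mk 1
        (⟨f s ^ n, n, rfl⟩ : Submonoid.powers (f s)) * algebraMap B LB (f a * eB i)) = _ :=
      Finset.sum_congr rfl fun i _ ↦ (h2 i).symm
    refine Eq.trans ?_ h3
    rw [HomogeneousLocalization.Away.val_mk, ← Finsupp.mul_sum, ← map_finsuppSum, ← h1,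
      ← Localization.mk_one_eq_algebraMap, Localization.mk_mul, one_mul, mul_one]
    rfl

theorem irrelevant_le_map (hf : ∀ a, f a = algebraMap A B a)
    (he : ∀ i, eB i = algebraMap E B (e i)) :
    HomogeneousIdeal.irrelevant ℬ ≤ (HomogeneousIdeal.irrelevant 𝒜).map f := by
  refine toIdeal_le_toIdeal_iff.mp
    ((HomogeneousIdeal.toIdeal_irrelevant_le _).mpr fun n hn b hb ↦ ?_)
  rw [← eB.linearCombination_repr b, Finsupp.linearCombination_apply]
  refine Ideal.sum_mem _ fun i _ ↦ ?_
  beta_reduce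
  rw [Algebra.smul_def, ← hf]
  exact Ideal.mul_mem_right _ _ (Ideal.mem_map_of_mem f
    (HomogeneousIdeal.mem_irrelevant_of_mem 𝒜 hn (repr_mem hf he hb i)))

theorem isPullback_map (hf : ∀ a, f a = algebraMap A B a)
    (hc : ∀ c, algebraMap A B (algebraMap k A c) = algebraMap E B (algebraMap k E c))
    (he : ∀ i, eB i = algebraMap E B (e i))
    (hirr : HomogeneousIdeal.irrelevant ℬ ≤ (HomogeneousIdeal.irrelevant 𝒜).map f) :
    IsPullback (Proj.map f hirr) (structureMap ℬ) (structureMap 𝒜)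
      (Spec.map (CommRingCat.ofHom (algebraMap k E))) := by
  have h2 {d : ℕ} (hd : 0 < d) {s : A} (hs : s ∈ 𝒜 d) :
      IsPullback (Spec.map (CommRingCat.ofHom (HomogeneousLocalization.Away.map f s)))
        (Proj.awayι ℬ (f s) (f.2 hs) hd ≫ structureMap ℬ)
        (Proj.awayι 𝒜 s hs hd ≫ structureMap 𝒜)
        (Spec.map (CommRingCat.ofHom (algebraMap k E))) := by
    have e1 := awayι_structureMap 𝒜 hs hd
    have hfs : f s ∈ ℬ d := f.2 hs
    have e2 := awayι_structureMap ℬ hfs hd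
    rw [e1, e2]
    exact isPullback_SpecMap_of_isPushout _ _ _ _ (isPushout_away hf hc he hs)
  have h1 {d : ℕ} (hd : 0 < d) {s : A} (hs : s ∈ 𝒜 d) :
      IsPullback (Spec.map (CommRingCat.ofHom (HomogeneousLocalization.Away.map f s)))
        (Proj.awayι ℬ (f s) (f.2 hs) hd) (Proj.awayι 𝒜 s hs hd) (Proj.map f hirr) := by
    refine IsOpenImmersion.isPullback _ _ _ _ (Proj.awayι_comp_map f hirr hd s hs) ?_
    rw [Proj.opensRange_awayι, Proj.opensRange_awayι, Proj.map_preimage_basicOpen]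
  have h4 {d : ℕ} (hd : 0 < d) {s : A} (hs : s ∈ 𝒜 d) :
      Proj.awayι ℬ (f s) (f.2 hs) hd ≫ Proj.map f hirr ≫ structureMap 𝒜 =
        Proj.awayι ℬ (f s) (f.2 hs) hd ≫ structureMap ℬ ≫
          Spec.map (CommRingCat.ofHom (algebraMap k E)) := by
    rw [← Category.assoc, ← (h1 hd hs).w, Category.assoc, (h2 hd hs).w, Category.assoc]
  let I : Type u := Σ n : ℕ+, 𝒜 n
  have hoi {d : ℕ} (hd : 0 < d) {s : A} (hs : s ∈ 𝒜 d) :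
      IsOpenImmersion (Proj.awayι 𝒜 s hs hd) := inferInstance
  have (a : I) : IsOpenImmersion (Proj.awayι 𝒜 a.2.1 a.2.2 a.1.2) := hoi _ _
  refine isPullback_of_charts ?_ (fun a : I ↦ Proj.awayι 𝒜 a.2.1 a.2.2 a.1.2)
    (fun a : I ↦ Proj.awayι ℬ (f a.2.1) (f.2 a.2.2) a.1.2)
    (fun a : I ↦ Spec.map (CommRingCat.ofHom (HomogeneousLocalization.Away.map f a.2.1)))
    (fun x ↦ (Proj.affineOpenCover 𝒜).openCover.exists_eq x) (fun a ↦ h1 a.1.2 a.2.2)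
    fun a ↦ h2 a.1.2 a.2.2
  refine (Proj.mapAffineOpenCover f hirr).openCover.hom_ext _ _ fun (a : I) ↦ ?_
  change Proj.awayι ℬ (f a.2.1) (f.2 a.2.2) a.1.2 ≫ _ =
    Proj.awayι ℬ (f a.2.1) (f.2 a.2.2) a.1.2 ≫ _
  exact h4 a.1.2 a.2.2

end

end ProjModel

theorem isSplit_of_isPullback {F : Type u} [Field F] {X Y : Scheme.{u}} {f : X ⟶ Spec (.of F)}
    {φ : Y ⟶ X} {p : Y ⟶ Spec (.of (AlgebraicClosure F))}
    (h : IsPullback φ p f (Spec.map (CommRingCat.ofHom (algebraMap F (AlgebraicClosure F)))))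
    (hb : Function.Bijective (SchemePic.map φ)) : IsSplit f := by
  have h1 : h.isoPullback.inv ≫ φ = BaseChange.proj f (AlgebraicClosure F) :=
    h.isoPullback_inv_fst
  have h2 : ⇑(SchemePic.map (BaseChange.proj f (AlgebraicClosure F))) =
      SchemePic.map h.isoPullback.inv ∘ SchemePic.map φ := by
    funext c
    rw [← h1]
    exact SchemePic.map_comp_apply _ _ c
  change Function.Bijective ⇑(SchemePic.map _)
  rw [h2]
  exact (SchemePic.map_bijective_of_isIso _).comp hb

theorem isSplit_of_iso {F : Type u} [Field F] {X Y X' : Scheme.{u}} {f : X ⟶ Spec (.of F)}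
    {φ : Y ⟶ X'} {p : Y ⟶ Spec (.of (AlgebraicClosure F))} (e : X' ≅ X)
    (h : IsPullback φ p (e.hom ≫ f)
      (Spec.map (CommRingCat.ofHom (algebraMap F (AlgebraicClosure F)))))
    (hb : Function.Bijective (SchemePic.map φ)) : IsSplit f := by
  refine isSplit_of_isPullback (φ := φ ≫ e.hom) (p := p)
    (h.of_iso (Iso.refl _) e (Iso.refl _) (Iso.refl _) (by simp) (by simp) (by simp) (by simp)) ?_
  have h2 : ⇑(SchemePic.map (φ ≫ e.hom)) = SchemePic.map φ ∘ SchemePic.map e.hom :=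
    funext fun c ↦ SchemePic.map_comp_apply _ _ c
  rw [h2]
  exact hb.comp (SchemePic.map_bijective_of_isIso _)

/-- A basis of an algebra induces a basis modulo an element of the base ring. -/
theorem exists_basis_quotient {R S ι : Type*} [CommRing R] [CommRing S] [Algebra R S]
    (b : Module.Basis ι R S) {g : R} {g' : S} (hg : algebraMap R S g = g')
    [Algebra (R ⧸ Ideal.span {g}) (S ⧸ Ideal.span {g'})]
    (hm : ∀ r : R, algebraMap (R ⧸ Ideal.span {g}) (S ⧸ Ideal.span {g'}) (Ideal.Quotient.mk _ r) =
      Ideal.Quotient.mk _ (algebraMap R S r)) :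
    ∃ b' : Module.Basis ι (R ⧸ Ideal.span {g}) (S ⧸ Ideal.span {g'}),
      ∀ i, b' i = Ideal.Quotient.mk _ (b i) := by
  classical
  have hsmul (r : R) (s : S) : (Ideal.Quotient.mk (Ideal.span {g}) r) •
      (Ideal.Quotient.mk (Ideal.span {g'}) s) = Ideal.Quotient.mk _ (r • s) := by
    rw [Algebra.smul_def, hm, Algebra.smul_def, map_mul]
  refine ⟨.mk (v := fun i ↦ Ideal.Quotient.mk _ (b i)) ?_ ?_, fun i ↦ Module.Basis.mk_apply _ _ i⟩
  · refine linearIndependent_iff'.mpr fun t c hc i hi ↦ ?_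
    choose r hr using fun i ↦ Ideal.Quotient.mk_surjective (c i)
    have h1 : Ideal.Quotient.mk (Ideal.span {g'}) (∑ i ∈ t, r i • b i) = 0 := by
      rw [map_sum, ← hc]
      exact Finset.sum_congr rfl fun i _ ↦ by rw [← hr, hsmul]
    obtain ⟨s, hs⟩ := Ideal.mem_span_singleton.mp (Ideal.Quotient.eq_zero_iff_mem.mp h1)
    have h2 := congrArg (fun x ↦ b.repr x i) hs
    rw [← hr, Ideal.Quotient.eq_zero_iff_mem, Ideal.mem_span_singleton]
    refine ⟨b.repr s i, ?_⟩
    rw [← hg, ← Algebra.smul_def] at h2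
    simpa [Finsupp.single_apply, hi] using h2
  · rintro s -
    obtain ⟨s, rfl⟩ := Ideal.Quotient.mk_surjective s
    rw [← b.linearCombination_repr s, Finsupp.linearCombination_apply, Finsupp.sum, map_sum]
    refine Submodule.sum_mem _ fun i _ ↦ ?_
    rw [← hsmul]
    exact Submodule.smul_mem _ _ (Submodule.subset_span ⟨i, rfl⟩)

namespace CubicSurface

variable {k : Type u} [Field k]

/-- The homogeneous coordinate ring of the cubic surface. -/
abbrev CoordRing (a b n : k) : Type u := MvPolynomial (Fin 4) k ⧸ Ideal.span {form a b n}

/-- The grading of the homogeneous coordinate ring. -/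
abbrev gr (a b n : k) : ℕ → Submodule k (CoordRing a b n) := ProjHypersurface.grading (form a b n)

instance gradedAlgebra (a b n : k) : GradedAlgebra (gr a b n) :=
  ProjHypersurface.gradedAlgebra (form_isHomogeneous a b n)

section BaseChange

variable {E : Type u} [Field E] [Algebra k E]

theorem map_form (a b n : k) : MvPolynomial.map (algebraMap k E) (form a b n) =
    form (algebraMap k E a) (algebraMap k E b) (algebraMap k E n) := by
  simp only [form, F, MvPolynomial.smul_eq_C_mul, map_add, map_sub, map_mul, map_pow,
    MvPolynomial.map_X, MvPolynomial.map_C]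

variable (E) in
/-- Extension of scalars on homogeneous coordinate rings. -/
def extend (a b n : k) :
    gr a b n →+*ᵍ gr (algebraMap k E a) (algebraMap k E b) (algebraMap k E n) where
  __ := Ideal.quotientMap _ (MvPolynomial.map (algebraMap k E)) <| by
    rw [Ideal.span_singleton_le_iff_mem, Ideal.mem_comap, map_form]
    exact Ideal.mem_span_singleton_self _
  map_mem := by
    rintro i _ ⟨p, hp, rfl⟩
    exact ⟨MvPolynomial.map (algebraMap k E) p, MvPolynomial.IsHomogeneous.map hp _, rfl⟩

theorem extend_mk (a b n : k) (p : MvPolynomial (Fin 4) k) :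
    extend E a b n (Ideal.Quotient.mk _ p) =
      Ideal.Quotient.mk _ (MvPolynomial.map (algebraMap k E) p) := rfl

theorem exists_basis_extend {ι : Type u} (e : Module.Basis ι k E) (a b n : k)
    [Algebra (CoordRing a b n)
      (CoordRing (algebraMap k E a) (algebraMap k E b) (algebraMap k E n))]
    (hm : ∀ x, extend E a b n x = algebraMap _ _ x) :
    ∃ eB : Module.Basis ι (CoordRing a b n)
      (CoordRing (algebraMap k E a) (algebraMap k E b) (algebraMap k E n)),
      ∀ i, eB i = algebraMap E _ (e i) := by
  let : Algebra (MvPolynomial (Fin 4) k) (MvPolynomial (Fin 4) E) :=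
    MvPolynomial.algebraMvPolynomial
  have h : Algebra.IsPushout k (MvPolynomial (Fin 4) k) E (MvPolynomial (Fin 4) E) := inferInstance
  obtain ⟨eB, heB⟩ := exists_basis_quotient (h.out.basis e) (map_form (E := E) a b n)
    fun r ↦ (hm _).symm
  refine ⟨eB, fun i ↦ (heB i).trans ?_⟩
  rw [IsBaseChange.basis_apply]
  rfl

end BaseChange

end CubicSurface

namespace ProjModel

theorem algebraMap_injective_of_basis {A B ι : Type*} [CommRing A] [CommRing B] [Algebra A B]
    [Nonempty ι] (eB : Module.Basis ι A B) :
    Function.Injective (algebraMap A B) := by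
  refine (injective_iff_map_eq_zero _).mpr fun a ha ↦ ?_
  obtain ⟨i⟩ := ‹Nonempty ι›
  have h : a • eB i = 0 := by rw [Algebra.smul_def, ha, zero_mul]
  simpa using congrArg (fun b ↦ eB.repr b i) h

section

variable {k E A B ι : Type u} [Field k] [Field E] [Algebra k E] [CommRing A] [IsDomain A]
  [Algebra k A] [CommRing B] [IsDomain B] [Algebra E B] [Algebra A B] {𝒜 : ℕ → Submodule k A}
  {ℬ : ℕ → Submodule E B} [GradedAlgebra 𝒜] [GradedAlgebra ℬ] {f : 𝒜 →+*ᵍ ℬ}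
  {e : Module.Basis ι k E} {eB : Module.Basis ι A B}

/-- The neighbourhoods of a point of a projective spectrum contain basic neighbourhoods. -/
theorem exists_basicOpen_le {x : Proj 𝒜} {U : (Proj 𝒜).Opens} (hx : x ∈ U) :
    ∃ d, 0 < d ∧ ∃ q ∈ 𝒜 d, q ∉ x.asHomogeneousIdeal ∧
      ∀ z : Proj 𝒜, q ∉ z.asHomogeneousIdeal → z ∈ U := by
  obtain ⟨_, ⟨r, rfl⟩, hxr, hrU⟩ :=
    (ProjectiveSpectrum.isTopologicalBasis_basic_opens 𝒜).exists_subset_of_mem_open hx U.isOpen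
  obtain ⟨i, hi⟩ : ∃ i, (DirectSum.decompose 𝒜 r i : A) ∉ x.asHomogeneousIdeal := by
    by_contra! h
    exact hxr ((x.asHomogeneousIdeal.isHomogeneous.mem_iff ..).mpr h)
  obtain ⟨n, hn, t, ht, htx⟩ : ∃ n, 0 < n ∧ ∃ t ∈ 𝒜 n, t ∉ x.asHomogeneousIdeal := by
    by_contra! h
    exact x.not_irrelevant_le (toIdeal_le_toIdeal_iff.mp
      ((HomogeneousIdeal.toIdeal_irrelevant_le _).mpr h))
  refine ⟨i + n, by omega, _, SetLike.mul_mem_graded (SetLike.coe_mem _) ht,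
    fun h ↦ (x.isPrime.mem_or_mem h).elim hi htx, fun z hz ↦ hrU fun hr ↦ hz ?_⟩
  exact Ideal.mul_mem_right _ _ (z.asHomogeneousIdeal.isHomogeneous i hr)

theorem exists_unitAt_descent (hf : ∀ a, f a = algebraMap A B a)
    (he : ∀ i, eB i = algebraMap E B (e i))
    {hirr : HomogeneousIdeal.irrelevant ℬ ≤ (HomogeneousIdeal.irrelevant 𝒜).map f}
    (hsurj : Function.Surjective (Proj.map f hirr))
    {j : FractionRing A →+* FractionRing B}
    (hj : ∀ a, j (algebraMap A _ a) = algebraMap B _ (f a))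
    (hconst : ∀ h, (∀ y, h ∈ (model ℬ).reg y) → ∃ μ : E, h = algebraMap B _ (algebraMap E B μ))
    {φ : Proj 𝒜 → FractionRing A} (hφ : (model 𝒜).IsCartier φ) {g₀ : FractionRing B}
    (hg₀ : ∀ y, (model ℬ).UnitAt y (g₀ * j (φ (Proj.map f hirr y)))) (y₀ : Proj ℬ) :
    ∃ g, ∀ x, (model 𝒜).UnitAt x (g * φ x) := by
  have hcomp := compatible_map f hirr hj
  have hjne {a : A} (ha : a ≠ 0) : j (algebraMap A _ a) ≠ 0 :=
    (map_ne_zero j).mpr (algebraMap_ne_zero ha)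
  -- presentations of `g₀` adapted to the points
  have key (x : Proj 𝒜) : ∃ d, ∃ q ∈ 𝒜 d, ∃ p ∈ ℬ d, q ∉ x.asHomogeneousIdeal ∧
      g₀ * j (φ x) * j (algebraMap A _ q) = algebraMap B _ p := by
    obtain ⟨h0, U, hxU, hU⟩ := hφ x
    obtain ⟨d, hd, q, hq, hqx, hqU⟩ := exists_basicOpen_le hxU
    have hq0 : f q ≠ 0 := by
      intro h
      have := hjne (ne_zero_of_notMem 𝒜 hqx)
      rw [hj, h, map_zero] at this
      exact this rfl
    obtain ⟨n, p, hp, hnp⟩ := exists_eq_div_pow (𝒜 := ℬ) hd (f.2 hq) (f := g₀ * j (φ x))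
      (fun y hy ↦ by
        have h1 := (hg₀ y).mul (hcomp.unitAt (hU (Proj.map f hirr y) (hqU _ hy)))
        have h2 : φ (Proj.map f hirr y) ≠ 0 := (hφ _).1
        rw [mul_assoc, ← map_mul, mul_div_cancel₀ _ h2] at h1
        exact h1.mem) hq0
    refine ⟨n * d, q ^ n, ?_, p, hp, ?_, ?_⟩
    · exact SetLike.pow_mem_graded n hq
    · exact fun h ↦ hqx (x.isPrime.mem_of_pow_mem n h)
    · rw [← hnp, map_pow, map_pow, hj]
      rfl
  choose d q hq p hp hqx hpq using key
  have hφx (x) : ∃ α β : A, α ≠ 0 ∧ β ≠ 0 ∧ φ x = algebraMap A _ α / algebraMap A _ β := by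
    obtain ⟨α, β, hβ, h⟩ := IsFractionRing.div_surjective (A := A) (φ x)
    refine ⟨α, β, ?_, nonZeroDivisors.ne_zero hβ, h.symm⟩
    rintro rfl
    rw [map_zero, zero_div] at h
    exact (hφ x).1 h.symm
  choose α β hα hβ hαβ using hφx
  have hg₀0 : g₀ ≠ 0 := left_ne_zero_of_mul (hg₀ y₀).ne_zero
  have hp0 (x) : p x ≠ 0 := by
    intro h
    have := hpq x
    rw [h, map_zero] at this
    exact mul_ne_zero (mul_ne_zero hg₀0 ((map_ne_zero j).mpr (hφ x).1))
      (hjne (ne_zero_of_notMem 𝒜 (hqx x))) this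
  have hcross (x z) : algebraMap A B (α x * q x * β z) * p z =
      algebraMap A B (α z * q z * β x) * p x := by
    apply IsFractionRing.injective B (FractionRing B)
    have h1 := hpq x
    have h2 := hpq z
    rw [hαβ, map_div₀] at h1 h2
    have h3 := hjne (hβ x)
    have h4 := hjne (hβ z)
    rw [map_mul (algebraMap B _), map_mul (algebraMap B _), ← h1, ← h2, ← hf, ← hf, ← hj, ← hj]
    simp only [map_mul]
    field_simp
  let x₀ := Proj.map f hirr y₀
  obtain ⟨i, hi⟩ : ∃ i, eB.repr (p x₀) i ≠ 0 := by
    by_contra! h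
    exact hp0 x₀ (eB.repr.map_eq_zero_iff.mp (Finsupp.ext h))
  let g : FractionRing A := algebraMap A _ (eB.repr (p x₀) i * β x₀) /
    algebraMap A _ (α x₀ * q x₀)
  have hgx (x) : g * φ x = algebraMap A _ (eB.repr (p x) i) / algebraMap A _ (q x) := by
    have h := congrArg (fun b ↦ eB.repr b i) (hcross x₀ x)
    simp only [← Algebra.smul_def, map_smul, Finsupp.smul_apply, smul_eq_mul] at h
    have h' := congrArg (algebraMap A (FractionRing A)) h
    have n1 := algebraMap_ne_zero (hα x₀)
    have n2 := algebraMap_ne_zero (ne_zero_of_notMem 𝒜 (hqx x₀))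
    have n3 := algebraMap_ne_zero (hβ x)
    have n4 := algebraMap_ne_zero (ne_zero_of_notMem 𝒜 (hqx x))
    simp only [g, hαβ, map_mul] at h' ⊢
    rw [div_mul_div_comm, div_eq_div_iff (mul_ne_zero (mul_ne_zero n1 n2) n3) n4]
    linear_combination -h'
  have hreg (x) : g * φ x ∈ (model 𝒜).reg x := by
    rw [hgx]
    exact mem_reg (repr_mem hf he (hp x) i) (hq x) (hqx x)
  obtain ⟨μ, hμ⟩ := hconst (j g / g₀) fun y ↦ by
    have h1 := hcomp.map_mem (hreg (Proj.map f hirr y))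
    have h2 := (hg₀ y).inv.mem
    have h3 := Subring.mul_mem _ h1 h2
    convert h3 using 1
    have := (map_ne_zero j).mpr (hφ (Proj.map f hirr y)).1
    rw [map_mul]
    field_simp
  have hg0 : g ≠ 0 := div_ne_zero (algebraMap_ne_zero (mul_ne_zero hi (hβ x₀)))
    (algebraMap_ne_zero (mul_ne_zero (hα x₀) (ne_zero_of_notMem 𝒜 (hqx x₀))))
  have hμ0 : μ ≠ 0 := by
    rintro rfl
    rw [map_zero, map_zero, div_eq_zero_iff] at hμ
    exact hμ.elim ((map_ne_zero j).mpr hg0) hg₀0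
  refine ⟨g, fun x ↦ ?_⟩
  obtain ⟨y, rfl⟩ := hsurj x
  refine hcomp.unitAt_of_mem (hreg _) ?_
  have h1 : j (g * φ (Proj.map f hirr y)) =
      algebraMap B _ (algebraMap E B μ) * (g₀ * j (φ (Proj.map f hirr y))) := by
    rw [← hμ, map_mul]
    field_simp
  rw [h1]
  refine .mul ?_ (hg₀ y)
  have hu : IsUnit (algebraMap E B μ) := (IsUnit.mk0 μ hμ0).map _
  have := unitAt (𝒜 := ℬ) (x := y) (a := algebraMap E B μ) (b := 1) (n := 0)
    (SetLike.algebraMap_mem_graded ..) (SetLike.GradedOne.one_mem) ?_ ?_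
  · rwa [map_one, div_one] at this
  · exact fun h ↦ y.isPrime.ne_top (Ideal.eq_top_of_isUnit_mem _ h hu)
  · exact fun h ↦ y.isPrime.ne_top (Ideal.eq_top_of_isUnit_mem _ h isUnit_one)

theorem map_injective (hf : ∀ a, f a = algebraMap A B a)
    (he : ∀ i, eB i = algebraMap E B (e i))
    {hirr : HomogeneousIdeal.irrelevant ℬ ≤ (HomogeneousIdeal.irrelevant 𝒜).map f}
    (hsurj : Function.Surjective (Proj.map f hirr))
    {j : FractionRing A →+* FractionRing B}
    (hj : ∀ a, j (algebraMap A _ a) = algebraMap B _ (f a))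
    (hconst : ∀ h, (∀ y, h ∈ (model ℬ).reg y) → ∃ μ : E, h = algebraMap B _ (algebraMap E B μ))
    (y₀ : Proj ℬ) : Function.Injective (SchemePic.map (Proj.map f hirr)) :=
  (compatible_map f hirr hj).map_injective y₀ fun c _ hg ↦
    exists_unitAt_descent hf he hsurj hj hconst (FieldModel.isCartier_rat _ c _) hg y₀

end

theorem fractionRing_map_algebraMap {A B : Type*} [CommRing A] [CommRing B] [IsDomain B]
    {g : A →+* B} (hg : Function.Injective g) (x : A) :
    IsFractionRing.map (K := FractionRing A) (L := FractionRing B) hg (algebraMap A _ x) =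
      algebraMap B _ (g x) :=
  IsLocalization.map_eq _ x

end ProjModel

namespace ProjModel

/-- The regular functions on a projective variety over an algebraically closed field are
constant. -/
theorem exists_eq_const {E A : Type u} [Field E] [IsAlgClosed E] [CommRing A] [IsDomain A]
    [Algebra E A] {𝒜 : ℕ → Submodule E A} [GradedAlgebra 𝒜] {ι : Type*} [Fintype ι] [DecidableEq ι]
    {X : ι → A} (hX : ∀ i, X i ∈ 𝒜 1) (i₀ : ι) (hi₀ : X i₀ ≠ 0)
    (hspan : ∀ m, 𝒜 m ≤ Submodule.span E
      ((fun s : ι → ℕ ↦ ∏ i, X i ^ s i) '' (Finset.univ.piAntidiag m : Finset (ι → ℕ))))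
    {f : FractionRing A} (hf : ∀ y, f ∈ (model 𝒜).reg y) :
    ∃ μ : E, f = algebraMap A _ (algebraMap E A μ) := by
  have key (i) : ∃ n, ∃ a ∈ 𝒜 n, f * algebraMap A _ (X i ^ n) = algebraMap A _ a := by
    by_cases h : X i = 0
    · exact ⟨1, 0, zero_mem _, by simp [h]⟩
    · obtain ⟨n, a, ha, e⟩ := exists_eq_div_pow one_pos (hX i) (fun x _ ↦ hf x) h
      exact ⟨n, a, by simpa using ha, by rw [map_pow, e]⟩
  choose n a ha hna using key
  let M := ∑ i, n i
  have hmon (s : ι → ℕ) (hs : ∑ i, s i = M) :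
      ∃ b ∈ 𝒜 M, f * algebraMap A _ (∏ i, X i ^ s i) = algebraMap A _ b := by
    obtain ⟨i, hi⟩ : ∃ i, n i ≤ s i := by
      by_contra! h
      exact absurd hs (Finset.sum_lt_sum_of_nonempty ⟨i₀, Finset.mem_univ _⟩ fun i _ ↦ h i).ne
    let s' : ι → ℕ := Function.update s i (s i - n i)
    have h1 : ∏ i, X i ^ s i = X i ^ n i * ∏ j, X j ^ s' j := by
      rw [← Finset.mul_prod_erase _ _ (Finset.mem_univ i),
        ← Finset.mul_prod_erase _ (fun j ↦ X j ^ s' j) (Finset.mem_univ i), ← mul_assoc]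
      congr 1
      · rw [← pow_add]
        simp [s', hi]
      · refine Finset.prod_congr rfl fun j hj ↦ ?_
        simp [s', Finset.ne_of_mem_erase hj]
    have h2 : n i + ∑ j, s' j = M := by
      rw [← hs, ← Finset.add_sum_erase _ _ (Finset.mem_univ i),
        ← Finset.add_sum_erase _ s (Finset.mem_univ i), ← add_assoc]
      congr 1
      · simp [s', hi]
      · refine Finset.sum_congr rfl fun j hj ↦ ?_
        simp [s', Finset.ne_of_mem_erase hj]
    refine ⟨a i * ∏ j, X j ^ s' j, ?_, ?_⟩
    · rw [← h2]
      refine SetLike.mul_mem_graded (ha i) ?_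
      refine SetLike.prod_mem_graded (A := 𝒜) s' _ fun j _ ↦ ?_
      simpa using SetLike.pow_mem_graded (s' j) (hX j)
    · rw [h1, map_mul, map_mul, ← mul_assoc, hna]
  have hall (v : 𝒜 M) : ∃ b : 𝒜 M, f * algebraMap A _ (v : A) = algebraMap A _ (b : A) := by
    have hv := hspan M v.2
    suffices H : ∀ v ∈ Submodule.span E ((fun s : ι → ℕ ↦ ∏ i, X i ^ s i) ''
        (Finset.univ.piAntidiag M : Finset (ι → ℕ))),
        ∃ b ∈ 𝒜 M, f * algebraMap A _ v = algebraMap A _ b by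
      obtain ⟨b, hb, e⟩ := H _ hv
      exact ⟨⟨b, hb⟩, e⟩
    intro v hv
    induction hv using Submodule.span_induction with
    | mem v h =>
      obtain ⟨s, hs, rfl⟩ := h
      exact hmon s (Finset.mem_piAntidiag.mp hs).1
    | zero => exact ⟨0, zero_mem _, by simp⟩
    | add v w _ _ hv hw =>
      obtain ⟨b, hb, e⟩ := hv
      obtain ⟨c, hc, e'⟩ := hw
      exact ⟨b + c, add_mem hb hc, by rw [map_add, map_add, mul_add, e, e']⟩
    | smul t v _ hv =>
      obtain ⟨b, hb, e⟩ := hv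
      refine ⟨t • b, Submodule.smul_mem _ _ hb, ?_⟩
      rw [Algebra.smul_def, Algebra.smul_def, map_mul, map_mul, mul_left_comm, e]
  choose T hT using hall
  have hinj := IsFractionRing.injective A (FractionRing A)
  let L : Module.End E (𝒜 M) :=
    { toFun := T
      map_add' v w := Subtype.ext (hinj (by
        rw [← hT, Submodule.coe_add, Submodule.coe_add, map_add, map_add, mul_add, hT, hT]))
      map_smul' t v := Subtype.ext (hinj (by
        rw [← hT, Submodule.coe_smul, RingHom.id_apply, Submodule.coe_smul, Algebra.smul_def,
          Algebra.smul_def, map_mul, map_mul, mul_left_comm, hT])) }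
  have hfin : Module.Finite E (𝒜 M) := by
    have := Module.Finite.span_of_finite E ((Finset.finite_toSet (Finset.univ.piAntidiag M)).image
      (fun s : ι → ℕ ↦ ∏ i, X i ^ s i))
    exact Submodule.finiteDimensional_of_le (hspan M)
  have hnt : Nontrivial (𝒜 M) := by
    refine ⟨⟨⟨X i₀ ^ M, by simpa using SetLike.pow_mem_graded M (hX i₀)⟩, 0, fun h ↦ ?_⟩⟩
    exact pow_ne_zero M hi₀ (congrArg Subtype.val h)
  obtain ⟨μ, hμ⟩ := Module.End.exists_eigenvalue L
  obtain ⟨v, hv⟩ := hμ.exists_hasEigenvector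
  refine ⟨μ, ?_⟩
  have h1 : (T v : A) = μ • (v : A) := congrArg Subtype.val hv.apply_eq_smul
  have h2 := hT v
  rw [h1, Algebra.smul_def, map_mul] at h2
  refine mul_right_cancel₀ (algebraMap_ne_zero fun h ↦ hv.2 (Subtype.ext h)) h2

end ProjModel

namespace CubicSurface

variable {k E : Type u} [Field k] [Field E] [Algebra k E] (a b n : k)

/-- The homogeneous coordinates on the cubic surface. -/
def coord (i : Fin 4) : CoordRing a b n := Ideal.Quotient.mk _ (.X i)

theorem coord_mem (i : Fin 4) : coord a b n i ∈ gr a b n 1 :=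
  ⟨.X i, MvPolynomial.isHomogeneous_X k i, rfl⟩

theorem gr_le_span (m : ℕ) : gr a b n m ≤ Submodule.span k
    ((fun s : Fin 4 → ℕ ↦ ∏ i, coord a b n i ^ s i) ''
      (Finset.univ.piAntidiag m : Finset (Fin 4 → ℕ))) := by
  rintro _ ⟨p, hp, rfl⟩
  change Ideal.Quotient.mkₐ k _ p ∈ _
  rw [p.as_sum, map_sum]
  refine Submodule.sum_mem _ fun s hs ↦ ?_
  rw [← mul_one (p.coeff s), ← smul_eq_mul, ← MvPolynomial.smul_monomial, map_smul]
  refine Submodule.smul_mem _ _ (Submodule.subset_span ⟨s, ?_, ?_⟩)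
  · have h := hp (MvPolynomial.mem_support_iff.mp hs)
    simp only [Finset.mem_coe, Finset.mem_piAntidiag, Finset.mem_univ, implies_true, and_true]
    rw [← h, Finsupp.weight_apply, Finsupp.sum_fintype _ _ (by simp)]
    simp
  · rw [MvPolynomial.monomial_eq, map_one, one_mul, Finsupp.prod_fintype _ _ (by simp), map_prod]
    simp only [map_pow]
    rfl

theorem exists_coord_notMem (x : ProjectiveSpectrum (gr a b n)) :
    ∃ i, coord a b n i ∉ x.asHomogeneousIdeal := by
  by_contra! h
  refine x.not_irrelevant_le (toIdeal_le_toIdeal_iff.mp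
    ((HomogeneousIdeal.toIdeal_irrelevant_le _).mpr fun m hm p hp ↦ ?_))
  refine Submodule.span_le (p := x.asHomogeneousIdeal.toIdeal.restrictScalars k) |>.mpr ?_
    (gr_le_span a b n m hp)
  rintro _ ⟨s, hs, rfl⟩
  have hs' := (Finset.mem_piAntidiag.mp hs).1
  obtain ⟨i, hi⟩ : ∃ i, s i ≠ 0 := by
    by_contra! h0
    simp [h0] at hs'
    omega
  exact Ideal.mem_of_dvd _ ((dvd_pow_self _ hi).trans (Finset.dvd_prod_of_mem _ (Finset.mem_univ i)))
    (h i)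

theorem exists_eq_const [IsAlgClosed k] [IsDomain (CoordRing a b n)]
    (x : ProjectiveSpectrum (gr a b n)) {f : FractionRing (CoordRing a b n)}
    (hf : ∀ y, f ∈ (ProjModel.model (gr a b n)).reg y) :
    ∃ μ : k, f = algebraMap (CoordRing a b n) _ (algebraMap k (CoordRing a b n) μ) := by
  obtain ⟨i₀, hi₀⟩ := exists_coord_notMem a b n x
  have h0 : coord a b n i₀ ≠ 0 := fun h ↦ hi₀ (h ▸ zero_mem _)
  exact ProjModel.exists_eq_const (𝒜 := gr a b n) (X := coord a b n) (coord_mem a b n) i₀ h0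
    (gr_le_span a b n) hf

theorem extend_irrelevant : HomogeneousIdeal.irrelevant
    (gr (algebraMap k E a) (algebraMap k E b) (algebraMap k E n)) ≤
      (HomogeneousIdeal.irrelevant (gr a b n)).map (extend E a b n) := by
  let := (extend E a b n).toRingHom.toAlgebra
  obtain ⟨eB, heB⟩ := exists_basis_extend (E := E) (Module.Free.chooseBasis k E) a b n fun _ ↦ rfl
  exact ProjModel.irrelevant_le_map (fun _ ↦ rfl) heB

variable (E) in
/-- The projection from the base change of the cubic surface. -/
def extendMap : Proj (gr (algebraMap k E a) (algebraMap k E b) (algebraMap k E n)) ⟶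
    Proj (gr a b n) :=
  Proj.map (extend E a b n) (extend_irrelevant a b n)

theorem isPullback_extendMap : IsPullback (extendMap E a b n)
    (toSpec (algebraMap k E a) (algebraMap k E b) (algebraMap k E n)) (toSpec a b n)
    (Spec.map (CommRingCat.ofHom (algebraMap k E))) := by
  let := (extend E a b n).toRingHom.toAlgebra
  obtain ⟨eB, heB⟩ := exists_basis_extend (E := E) (Module.Free.chooseBasis k E) a b n fun _ ↦ rfl
  exact ProjModel.isPullback_map (fun _ ↦ rfl)
    (fun c ↦ congrArg (Ideal.Quotient.mk _) (MvPolynomial.map_C _ _)) heB _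

theorem extendMap_surjective : Function.Surjective (extendMap E a b n) := by
  have h : Surjective (Spec.map (CommRingCat.ofHom (algebraMap k E))) :=
    ⟨fun x ↦ ⟨(⊥ : PrimeSpectrum E), Subsingleton.elim (α := PrimeSpectrum k) _ _⟩⟩
  exact (MorphismProperty.of_isPullback (P := @Surjective) (isPullback_extendMap a b n).flip h).surj

theorem extend_injective : Function.Injective (extend E a b n) := by
  let := (extend E a b n).toRingHom.toAlgebra
  obtain ⟨eB, heB⟩ := exists_basis_extend (E := E) (Module.Free.chooseBasis k E) a b n fun _ ↦ rfl
  exact ProjModel.algebraMap_injective_of_basis eB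

variable [IsDomain (CoordRing a b n)]
  [IsDomain (CoordRing (algebraMap k E a) (algebraMap k E b) (algebraMap k E n))]

variable (E) in
/-- Extension of scalars on fields of fractions. -/
def extendFrac : FractionRing (CoordRing a b n) →+*
    FractionRing (CoordRing (algebraMap k E a) (algebraMap k E b) (algebraMap k E n)) :=
  IsFractionRing.map (j := (extend E a b n).toRingHom) (extend_injective a b n)

theorem extendFrac_algebraMap (x : CoordRing a b n) :
    extendFrac E a b n (algebraMap _ _ x) = algebraMap _ _ (extend E a b n x) :=
  ProjModel.fractionRing_map_algebraMap _ x

theorem compatible_extendMap : (ProjModel.model (gr a b n)).Compatible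
    (ProjModel.model (gr (algebraMap k E a) (algebraMap k E b) (algebraMap k E n)))
    (extendMap E a b n) (extendFrac E a b n) :=
  ProjModel.compatible_map _ _ (extendFrac_algebraMap a b n)

theorem map_extendMap_injective [IsAlgClosed E]
    (y₀ : Proj (gr (algebraMap k E a) (algebraMap k E b) (algebraMap k E n))) :
    Function.Injective (SchemePic.map (extendMap E a b n)) := by
  let := (extend E a b n).toRingHom.toAlgebra
  obtain ⟨eB, heB⟩ := exists_basis_extend (E := E) (Module.Free.chooseBasis k E) a b n fun _ ↦ rfl
  exact ProjModel.map_injective (fun _ ↦ rfl) heB (extendMap_surjective a b n)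
    (extendFrac_algebraMap a b n) (fun h hh ↦ exists_eq_const _ _ _ y₀ hh) y₀

end CubicSurface

/-! ### Divisors defined by two linear equations -/

namespace ProjModel

variable {E A : Type u} [Field E] [CommRing A] [IsDomain A] [Algebra E A] {𝒜 : ℕ → Submodule E A}
  [GradedAlgebra 𝒜]

/-- The fraction `f` is a local equation at `x` of the subscheme defined by `α` and `β`. -/
def IsLocalEq (𝒜 : ℕ → Submodule E A) [GradedAlgebra 𝒜] (α β : A) (x : ProjectiveSpectrum 𝒜)
    (f : FractionRing A) : Prop :=
  ∃ D, (D = α ∨ D = β) ∧ ∃ l ∈ 𝒜 1, l ∉ x.asHomogeneousIdeal ∧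
    ∃ m, ∃ q ∈ 𝒜 m, q ∉ x.asHomogeneousIdeal ∧ ∃ s ∈ 𝒜 m, ∃ s' ∈ 𝒜 m,
      q * α = D * s ∧ q * β = D * s' ∧ f = algebraMap A _ D / algebraMap A _ l

theorem mem_of_mul_mem {D z : A} {N : ℕ} (hD : D ∈ 𝒜 1) (hD0 : D ≠ 0) (h : D * z ∈ 𝒜 (1 + N)) :
    z ∈ 𝒜 N := by
  have h1 := DirectSum.coe_decompose_mul_add_of_left_mem 𝒜 (b := z) (j := N) hD
  rw [DirectSum.decompose_of_mem_same 𝒜 h] at h1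
  rw [mul_left_cancel₀ hD0 h1]
  exact SetLike.coe_mem _

variable {α β : A} {δ : Proj 𝒜 → FractionRing A}

theorem isCartier_of_isLocalEq (hα : α ∈ 𝒜 1) (hβ : β ∈ 𝒜 1) (hα0 : α ≠ 0) (hβ0 : β ≠ 0)
    (h : ∀ x, IsLocalEq 𝒜 α β x (δ x)) : (model 𝒜).IsCartier δ := by
  have key {D l q s D' l' : A} {m : ℕ} {z : Proj 𝒜} (hl : l ∈ 𝒜 1) (hl' : l' ∈ 𝒜 1)
      (hq : q ∈ 𝒜 m) (hs : s ∈ 𝒜 m) (hqz : q ∉ z.asHomogeneousIdeal)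
      (hlz : l' ∉ z.asHomogeneousIdeal) (hl0 : l ≠ 0) (hD0 : D ≠ 0) (e : q * D' = D * s) :
      (algebraMap A (FractionRing A) D' / algebraMap A _ l') /
        (algebraMap A (FractionRing A) D / algebraMap A _ l) ∈ (model 𝒜).reg z := by
    have h1 := mem_reg (𝒜 := 𝒜) (SetLike.mul_mem_graded hs hl) (SetLike.mul_mem_graded hq hl')
      (fun h ↦ (z.isPrime.mem_or_mem h).elim hqz hlz)
    convert h1 using 1
    have e' := congrArg (algebraMap A (FractionRing A)) e
    have n1 := algebraMap_ne_zero hl0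
    have n2 := algebraMap_ne_zero hD0
    have n3 := algebraMap_ne_zero (ne_zero_of_notMem 𝒜 hqz)
    have n4 := algebraMap_ne_zero (ne_zero_of_notMem 𝒜 hlz)
    simp only [map_mul] at e' ⊢
    rw [div_div_div_eq, div_eq_div_iff (mul_ne_zero n4 n2) (mul_ne_zero n3 n4)]
    linear_combination (algebraMap A (FractionRing A) l * algebraMap A (FractionRing A) l') * e'
  have hD1 {D : A} (h : D = α ∨ D = β) : D ≠ 0 := by rcases h with rfl | rfl <;> assumption
  intro x
  obtain ⟨D, hD, l, hl, hlx, m, q, hq, hqx, s, hs, s', hs', e, e', hδ⟩ := h x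
  refine ⟨?_, Proj.basicOpen 𝒜 (l * q),
    fun hx ↦ (x.isPrime.mem_or_mem hx).elim hlx hqx, fun z hz ↦ ?_⟩
  · rw [hδ]
    exact div_ne_zero (algebraMap_ne_zero (hD1 hD)) (algebraMap_ne_zero (ne_zero_of_notMem 𝒜 hlx))
  have hlz : l ∉ z.asHomogeneousIdeal := fun h ↦ hz (Ideal.mul_mem_right _ _ h)
  have hqz : q ∉ z.asHomogeneousIdeal := fun h ↦ hz (Ideal.mul_mem_left _ _ h)
  obtain ⟨D₂, hD₂, l₂, hl₂, hlz₂, m₂, q₂, hq₂, hqz₂, s₂, hs₂, s₂', hs₂', e₂, e₂', hδ₂⟩ := h z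
  have n1 := ne_zero_of_notMem 𝒜 hlz
  have n2 := ne_zero_of_notMem 𝒜 hlz₂
  have h1 : δ x / δ z ∈ (model 𝒜).reg z := by
    rw [hδ, hδ₂]
    rcases hD with rfl | rfl
    · exact key hl₂ hl hq₂ hs₂ hqz₂ hlz n2 (hD1 hD₂) e₂
    · exact key hl₂ hl hq₂ hs₂' hqz₂ hlz n2 (hD1 hD₂) e₂'
  have h2 : δ z / δ x ∈ (model 𝒜).reg z := by
    rw [hδ, hδ₂]
    rcases hD₂ with rfl | rfl
    · exact key hl hl₂ hq hs hqz hlz₂ n1 (hD1 hD) e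
    · exact key hl hl₂ hq hs' hqz hlz₂ n1 (hD1 hD) e'
  refine ⟨div_ne_zero ?_ ?_, h1, by rwa [inv_div]⟩
  · rw [hδ]
    exact div_ne_zero (algebraMap_ne_zero (hD1 hD)) (algebraMap_ne_zero n1)
  · rw [hδ₂]
    exact div_ne_zero (algebraMap_ne_zero (hD1 hD₂)) (algebraMap_ne_zero n2)

theorem isPrimeDivisor_of_isLocalEq (hα : α ∈ 𝒜 1) (hβ : β ∈ 𝒜 1) (hα0 : α ≠ 0) (hβ0 : β ≠ 0)
    (h : ∀ x, IsLocalEq 𝒜 α β x (δ x)) (w : Proj 𝒜)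
    (hw : w.asHomogeneousIdeal.toIdeal = Ideal.span {α, β}) : (model 𝒜).IsPrimeDivisor δ := by
  have hmem (x : Proj 𝒜) : δ x ∈ (model 𝒜).reg x := by
    obtain ⟨D, hD, l, hl, hlx, m, q, hq, hqx, s, hs, s', hs', e, e', hδ⟩ := h x
    rw [hδ]
    refine mem_reg ?_ hl hlx
    rcases hD with rfl | rfl <;> assumption
  refine ⟨isCartier_of_isLocalEq hα hβ hα0 hβ0 h, hmem, w, fun x ↦ ?_⟩
  obtain ⟨D, hD, l, hl, hlx, m, q, hq, hqx, s, hs, s', hs', e, e', hδ⟩ := h x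
  have hD1 : D ∈ 𝒜 1 := by rcases hD with rfl | rfl <;> assumption
  have hD0 : D ≠ 0 := by rcases hD with rfl | rfl <;> assumption
  have hDw : D ∈ w.asHomogeneousIdeal.toIdeal := by
    rw [hw]
    rcases hD with rfl | rfl <;> exact Ideal.subset_span (by simp)
  by_cases hDx : D ∈ x.asHomogeneousIdeal
  swap
  · exact .inl (hδ ▸ unitAt hD1 hl hDx hlx)
  right
  have hmx {γ t : A} (e : q * γ = D * t) : γ ∈ x.asHomogeneousIdeal :=
    (x.isPrime.mem_or_mem (e ▸ Ideal.mul_mem_right _ _ hDx : q * γ ∈ _)).resolve_left hqx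
  have hle : w.asHomogeneousIdeal.toIdeal ≤ x.asHomogeneousIdeal.toIdeal := by
    rw [hw, Ideal.span_le]
    rintro _ (rfl | rfl)
    · exact hmx e
    · exact hmx e'
  -- an element of the ideal is locally divisible by the local equation
  have key {n : ℕ} {a b : A} (ha : a ∈ 𝒜 n) (hb : b ∈ 𝒜 n) (hbx : b ∉ x.asHomogeneousIdeal)
      (haw : a ∈ w.asHomogeneousIdeal.toIdeal) :
      algebraMap A (FractionRing A) a / algebraMap A _ b / δ x ∈ (model 𝒜).reg x := by
    rw [hw] at haw
    obtain ⟨y, z, rfl⟩ := Ideal.mem_span_pair.mp haw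
    have e1 : D * (l * (y * s + z * s')) = l * (q * (y * α + z * β)) := by
      linear_combination -(l * y) * e - (l * z) * e'
    have h1 : l * (y * s + z * s') ∈ 𝒜 (m + n) := by
      refine mem_of_mul_mem hD1 hD0 ?_
      rw [e1]
      exact SetLike.mul_mem_graded hl (SetLike.mul_mem_graded hq ha)
    have h2 := mem_reg (𝒜 := 𝒜) h1 (SetLike.mul_mem_graded hq hb)
      (fun h ↦ (x.isPrime.mem_or_mem h).elim hqx hbx)
    convert h2 using 1
    have e2 := congrArg (algebraMap A (FractionRing A)) e1
    have n1 := algebraMap_ne_zero (ne_zero_of_notMem 𝒜 hbx)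
    have n2 := algebraMap_ne_zero hD0
    have n3 := algebraMap_ne_zero (ne_zero_of_notMem 𝒜 hqx)
    have n4 := algebraMap_ne_zero (ne_zero_of_notMem 𝒜 hlx)
    rw [hδ]
    rw [map_mul, map_mul, map_mul, map_mul _ q (y * α + z * β)] at e2
    rw [map_mul, map_mul _ q b, div_div_div_eq, div_eq_div_iff (mul_ne_zero n1 n2)
      (mul_ne_zero n3 n1)]
    linear_combination -(algebraMap A (FractionRing A) b) * e2
  have hlw : l ∉ w.asHomogeneousIdeal := fun h ↦ hlx (hle h)
  have hδx : δ x ≠ 0 := by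
    rw [hδ]
    exact div_ne_zero (algebraMap_ne_zero hD0) (algebraMap_ne_zero (ne_zero_of_notMem 𝒜 hlx))
  refine ⟨(ProjectiveSpectrum.le_iff_mem_closure 𝒜 _ _).mp hle |> specializes_iff_mem_closure.mpr,
    fun f hf g hg hfg ↦ ?_, fun f hf hfw ↦ ?_⟩
  · obtain ⟨n, a, ha, b, hb, hbx, rfl⟩ := mem_reg_iff.mp hf
    obtain ⟨n', a', ha', b', hb', hbx', rfl⟩ := mem_reg_iff.mp hg
    obtain ⟨n₂, a₂, ha₂, b₂, hb₂, hbx₂, e₂⟩ := mem_reg_iff.mp hfg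
    have h3 : (a * a') * (l * b₂) = D * (a₂ * (b * b')) := by
      apply IsFractionRing.injective A (FractionRing A)
      have n1 := algebraMap_ne_zero (ne_zero_of_notMem 𝒜 hbx)
      have n2 := algebraMap_ne_zero (ne_zero_of_notMem 𝒜 hbx')
      have n3 := algebraMap_ne_zero (ne_zero_of_notMem 𝒜 hbx₂)
      have n4 := algebraMap_ne_zero (ne_zero_of_notMem 𝒜 hlx)
      have n5 := algebraMap_ne_zero hD0
      rw [hδ] at e₂
      simp only [map_mul]
      field_simp at e₂
      linear_combination e₂
    have h4 : (a * a') * (l * b₂) ∈ w.asHomogeneousIdeal := h3 ▸ Ideal.mul_mem_right _ _ hDw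
    have h5 : a * a' ∈ w.asHomogeneousIdeal := (w.isPrime.mem_or_mem h4).resolve_right fun h ↦
      (w.isPrime.mem_or_mem h).elim hlw fun h ↦ hbx₂ (hle h)
    exact (w.isPrime.mem_or_mem h5).imp (key ha hb hbx) (key ha' hb' hbx')
  · obtain ⟨n, a, ha, b, hb, hbx, rfl⟩ := mem_reg_iff.mp hf
    obtain ⟨n₂, a₂, ha₂, b₂, hb₂, hbw₂, e₂⟩ := mem_reg_iff.mp hfw
    have h3 : a * (l * b₂) = D * (a₂ * b) := by
      apply IsFractionRing.injective A (FractionRing A)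
      have n1 := algebraMap_ne_zero (ne_zero_of_notMem 𝒜 hbx)
      have n3 := algebraMap_ne_zero (ne_zero_of_notMem 𝒜 hbw₂)
      have n4 := algebraMap_ne_zero (ne_zero_of_notMem 𝒜 hlx)
      have n5 := algebraMap_ne_zero hD0
      rw [hδ] at e₂
      simp only [map_mul]
      field_simp at e₂
      linear_combination e₂
    have h4 : a * (l * b₂) ∈ w.asHomogeneousIdeal := h3 ▸ Ideal.mul_mem_right _ _ hDw
    exact key ha hb hbx ((w.isPrime.mem_or_mem h4).resolve_right fun h ↦
      (w.isPrime.mem_or_mem h).elim hlw hbw₂)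

/-- Three divisors that make up a plane section are locally divisible by the equation of the
plane. -/
theorem prod_div_mem {h l : A} {α : Fin 3 → A} {Q : A} {f : Fin 3 → FractionRing A}
    {x : Proj 𝒜} (hh : h ∈ 𝒜 1) (hQ : Q ∈ 𝒜 2) (h0 : h ≠ 0) (hα : ∀ i, α i ∈ 𝒜 1)
    (e : α 0 * α 1 * α 2 = h * Q) (hf : ∀ i, IsLocalEq 𝒜 h (α i) x (f i)) (hl : l ∈ 𝒜 1)
    (hlx : l ∉ x.asHomogeneousIdeal) :
    f 0 * f 1 * f 2 / (algebraMap A _ h / algebraMap A _ l) ∈ (model 𝒜).reg x := by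
  choose D hD m hm hmx _ _ _ _ _ _ _ _ _ _ hfe using hf
  have hD1 (i) : D i ∈ 𝒜 1 := by rcases hD i with h | h <;> rw [h]; exacts [hh, hα i]
  have hmem (i) : f i ∈ (model 𝒜).reg x := by
    rw [hfe]
    exact mem_reg (hD1 i) (hm i) (hmx i)
  have n0 := algebraMap_ne_zero h0
  have nl := algebraMap_ne_zero (ne_zero_of_notMem 𝒜 hlx)
  have nm (i) := algebraMap_ne_zero (ne_zero_of_notMem 𝒜 (hmx i))
  have hone (i) (hi : D i = h) : f i / (algebraMap A _ h / algebraMap A _ l) ∈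
      (model 𝒜).reg x := by
    have h1 := mem_reg (𝒜 := 𝒜) hl (hm i) (hmx i)
    convert h1 using 1
    have := nm i
    rw [hfe, hi]
    field_simp
  rcases hD 0 with h1 | h1
  · have := Subring.mul_mem _ (hone 0 h1) (Subring.mul_mem _ (hmem 1) (hmem 2))
    convert this using 1
    ring
  rcases hD 1 with h2 | h2
  · have := Subring.mul_mem _ (hone 1 h2) (Subring.mul_mem _ (hmem 0) (hmem 2))
    convert this using 1
    ring
  rcases hD 2 with h3 | h3
  · have := Subring.mul_mem _ (hone 2 h3) (Subring.mul_mem _ (hmem 0) (hmem 1))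
    convert this using 1
    ring
  have h4 := mem_reg (𝒜 := 𝒜) (SetLike.mul_mem_graded hQ hl)
    (SetLike.mul_mem_graded (SetLike.mul_mem_graded (hm 0) (hm 1)) (hm 2))
    (fun h ↦ (x.isPrime.mem_or_mem h).elim
      (fun h ↦ (x.isPrime.mem_or_mem h).elim (hmx 0) (hmx 1)) (hmx 2))
  convert h4 using 1
  have e' := congrArg (algebraMap A (FractionRing A)) e
  have n1 := nm 0
  have n2 := nm 1
  have n3 := nm 2
  rw [hfe, hfe, hfe, h1, h2, h3]
  simp only [map_mul] at e' ⊢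
  field_simp
  linear_combination e'

end ProjModel

/-! ### Tritangent planes of the cubic surface -/

namespace ProjModel

theorem IsLocalEq.map {k E A B : Type u} [Field k] [Field E] [CommRing A] [IsDomain A]
    [Algebra k A] [CommRing B] [IsDomain B] [Algebra E B] {𝒜 : ℕ → Submodule k A}
    {ℬ : ℕ → Submodule E B} [GradedAlgebra 𝒜] [GradedAlgebra ℬ] (f : 𝒜 →+*ᵍ ℬ)
    {j : FractionRing A →+* FractionRing B} (hj : ∀ a, j (algebraMap A _ a) = algebraMap B _ (f a))
    {α β : A} {x : ProjectiveSpectrum 𝒜} {y : ProjectiveSpectrum ℬ}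
    (hxy : ∀ a, f a ∈ y.asHomogeneousIdeal → a ∈ x.asHomogeneousIdeal) {g : FractionRing A}
    (h : IsLocalEq 𝒜 α β x g) : IsLocalEq ℬ (f α) (f β) y (j g) := by
  obtain ⟨D, hD, l, hl, hlx, m, q, hq, hqx, s, hs, s', hs', e, e', rfl⟩ := h
  refine ⟨f D, hD.imp (congrArg f) (congrArg f), f l, f.2 hl, fun h ↦ hlx (hxy _ h), m, f q, f.2 hq,
    fun h ↦ hqx (hxy _ h), f s, f.2 hs, f s', f.2 hs', ?_, ?_, ?_⟩
  · rw [← map_mul, e, map_mul]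
  · rw [← map_mul, e', map_mul]
  · rw [map_div₀, hj, hj]

end ProjModel

namespace CubicSurface

variable {k E : Type u} [Field k] [Field E] [Algebra k E]

/-- The linear form with given coefficients. -/
def lin (v : Fin 4 → k) : MvPolynomial (Fin 4) k := ∑ i, .C (v i) * .X i

theorem lin_isHomogeneous (v : Fin 4 → k) : (lin v).IsHomogeneous 1 := by
  refine MvPolynomial.IsHomogeneous.sum _ _ _ fun i _ ↦ ?_
  simpa using (MvPolynomial.isHomogeneous_C (Fin 4) (v i)).mul (MvPolynomial.isHomogeneous_X k i)

theorem map_lin (v : Fin 4 → k) :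
    MvPolynomial.map (algebraMap k E) (lin v) = lin fun i ↦ algebraMap k E (v i) := by
  simp [lin]

theorem eval_lin (v z : Fin 4 → k) : MvPolynomial.eval z (lin v) = v ⬝ᵥ z := by
  simp [lin, dotProduct]

section

variable (a b n : k)

/-- The linear form with given coefficients on the cubic surface. -/
def linMk (v : Fin 4 → k) : CoordRing a b n := Ideal.Quotient.mk _ (lin v)

theorem linMk_mem (v : Fin 4 → k) : linMk a b n v ∈ gr a b n 1 := ⟨_, lin_isHomogeneous v, rfl⟩

theorem mk_mem {m : ℕ} {p : MvPolynomial (Fin 4) k} (hp : p.IsHomogeneous m) :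
    (Ideal.Quotient.mk _ p : CoordRing a b n) ∈ gr a b n m := ⟨_, hp, rfl⟩

theorem extend_linMk (v : Fin 4 → k) : extend E a b n (linMk a b n v) =
    linMk _ _ _ fun i ↦ algebraMap k E (v i) := by
  rw [linMk, extend_mk, map_lin]
  rfl

theorem form_ne_zero : form a b n ≠ 0 := by
  intro h
  have := congrArg (MvPolynomial.eval ![0, 1, 0, 0]) h
  simp [form, F] at this

theorem linMk_ne_zero {v z : Fin 4 → k} (hv : v ⬝ᵥ z ≠ 0) : linMk a b n v ≠ 0 := by
  intro h
  have h0 : lin v ≠ 0 := by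
    intro h
    rw [← eval_lin, h, map_zero] at hv
    exact hv rfl
  obtain ⟨s, hs⟩ := Ideal.mem_span_singleton.mp (Ideal.Quotient.eq_zero_iff_mem.mp h)
  have hs0 : s ≠ 0 := by
    rintro rfl
    exact h0 (hs.trans (mul_zero _))
  have h1 := MvPolynomial.totalDegree_mul_of_isDomain (form_ne_zero a b n) hs0
  rw [← hs, (lin_isHomogeneous v).totalDegree h0,
    (form_isHomogeneous a b n).totalDegree (form_ne_zero a b n)] at h1
  omega

/-- The partial derivatives of the equation have no common zero on the surface. -/
def Nonsingular : Prop := ∀ x : ProjectiveSpectrum (gr a b n), ∃ i,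
  Ideal.Quotient.mk _ (MvPolynomial.pderiv i (form a b n)) ∉ x.asHomogeneousIdeal

/-- A plane that meets the cubic surface in three lines. The vectors `p i` and `q i` form a dual
basis to the equations of the plane and of the `i`-th line. -/
structure TritangentPlane where
  plane : Fin 4 → k
  line : Fin 3 → Fin 4 → k
  p : Fin 3 → Fin 4 → k
  q : Fin 3 → Fin 4 → k
  plane_p : ∀ i, plane ⬝ᵥ p i = 1
  plane_q : ∀ i, plane ⬝ᵥ q i = 0
  line_p : ∀ i, line i ⬝ᵥ p i = 0
  line_q : ∀ i, line i ⬝ᵥ q i = 1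
  quad : MvPolynomial (Fin 4) k
  quad_isHomogeneous : quad.IsHomogeneous 2
  form_eq : form a b n = lin (line 0) * lin (line 1) * lin (line 2) + lin plane * quad

end

namespace TritangentPlane

variable {a b n : k} (T : TritangentPlane a b n)

variable (E) in
/-- Extension of scalars of a tritangent plane. -/
def extend : TritangentPlane (algebraMap k E a) (algebraMap k E b) (algebraMap k E n) where
  plane i := algebraMap k E (T.plane i)
  line j i := algebraMap k E (T.line j i)
  p j i := algebraMap k E (T.p j i)
  q j i := algebraMap k E (T.q j i)
  plane_p j := by simpa [dotProduct] using congrArg (algebraMap k E) (T.plane_p j)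
  plane_q j := by simpa [dotProduct] using congrArg (algebraMap k E) (T.plane_q j)
  line_p j := by simpa [dotProduct] using congrArg (algebraMap k E) (T.line_p j)
  line_q j := by simpa [dotProduct] using congrArg (algebraMap k E) (T.line_q j)
  quad := MvPolynomial.map (algebraMap k E) T.quad
  quad_isHomogeneous := T.quad_isHomogeneous.map _
  form_eq := by
    rw [← map_form, T.form_eq]
    simp only [map_add, map_mul, map_lin]

theorem exists_form_eq (i : Fin 3) : ∃ R : MvPolynomial (Fin 4) k, R.IsHomogeneous 2 ∧
    form a b n = lin (T.line i) * R + lin T.plane * T.quad := by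
  have h (v w : Fin 4 → k) : (lin v * lin w).IsHomogeneous 2 :=
    (lin_isHomogeneous v).mul (lin_isHomogeneous w)
  fin_cases i
  · exact ⟨_, h (T.line 1) (T.line 2), T.form_eq.trans (by simp only [Fin.zero_eta]; ring)⟩
  · exact ⟨_, h (T.line 0) (T.line 2), T.form_eq.trans (by simp only [Fin.mk_one]; ring)⟩
  · exact ⟨_, h (T.line 0) (T.line 1), T.form_eq.trans (by simp only [Fin.reduceFinMk]; ring)⟩

/-- The projection onto the functions on a line. -/
def proj (i : Fin 3) : MvPolynomial (Fin 4) k →ₐ[k] MvPolynomial (Fin 4) k :=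
  MvPolynomial.aeval fun j ↦ .X j - .C (T.p i j) * lin T.plane - .C (T.q i j) * lin (T.line i)

theorem proj_lin (i : Fin 3) (v : Fin 4 → k) : T.proj i (lin v) =
    lin v - .C (v ⬝ᵥ T.p i) * lin T.plane - .C (v ⬝ᵥ T.q i) * lin (T.line i) := by
  have h : T.proj i (lin v) = ∑ j, .C (v j) *
      (.X j - .C (T.p i j) * lin T.plane - .C (T.q i j) * lin (T.line i)) := by
    rw [lin, map_sum]
    refine Finset.sum_congr rfl fun j _ ↦ ?_
    rw [map_mul, MvPolynomial.algHom_C, proj, MvPolynomial.aeval_X]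
    rfl
  rw [h]
  simp only [dotProduct, map_sum, map_mul, mul_sub, Finset.sum_sub_distrib, Finset.sum_mul, lin,
    mul_assoc]

theorem proj_plane (i : Fin 3) : T.proj i (lin T.plane) = 0 := by
  rw [proj_lin, T.plane_p, T.plane_q]
  simp

theorem proj_line (i : Fin 3) : T.proj i (lin (T.line i)) = 0 := by
  rw [proj_lin, T.line_p, T.line_q]
  simp

theorem mem_span_of_proj_eq_zero (i : Fin 3) {f : MvPolynomial (Fin 4) k} (hf : T.proj i f = 0) :
    f ∈ Ideal.span {lin T.plane, lin (T.line i)} := by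
  let J := Ideal.span {lin T.plane, lin (T.line i)}
  have h1 : lin T.plane ∈ J := Ideal.subset_span (by simp)
  have h2 : lin (T.line i) ∈ J := Ideal.subset_span (by simp)
  have h : (Ideal.Quotient.mkₐ k J).comp (T.proj i) = Ideal.Quotient.mkₐ k J := by
    refine MvPolynomial.algHom_ext fun j ↦ ?_
    rw [AlgHom.comp_apply, proj, MvPolynomial.aeval_X]
    refine Ideal.Quotient.eq.mpr ?_
    have := J.neg_mem (J.add_mem (J.mul_mem_left (.C (T.p i j)) h1)
      (J.mul_mem_left (.C (T.q i j)) h2))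
    convert this using 1
    ring
  have h3 := AlgHom.congr_fun h f
  rw [AlgHom.comp_apply, hf, map_zero] at h3
  exact Ideal.Quotient.eq_zero_iff_mem.mp h3.symm

theorem exists_proj_X_ne_zero (i : Fin 3) : ∃ j, T.proj i (.X j) ≠ 0 := by
  let L : (Fin 4 → k) →ₗ[k] (Fin 2 → k) := (Matrix.of ![T.plane, T.line i]).mulVecLin
  obtain ⟨z, hz, hz0⟩ := (Submodule.ne_bot_iff _).mp
    (LinearMap.ker_ne_bot_of_finrank_lt (f := L) (by simp))
  have e0 : T.plane ⬝ᵥ z = 0 := congrFun (LinearMap.mem_ker.mp hz) 0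
  have e1 : T.line i ⬝ᵥ z = 0 := congrFun (LinearMap.mem_ker.mp hz) 1
  by_contra! h
  refine hz0 (funext fun j ↦ ?_)
  have h1 := congrArg (MvPolynomial.eval z) (h j)
  rw [proj, MvPolynomial.aeval_X] at h1
  simpa [eval_lin, e0, e1] using h1

theorem exists_generic (i : Fin 3) : ∃ w : ProjectiveSpectrum (gr a b n),
    w.asHomogeneousIdeal.toIdeal =
      Ideal.span {linMk a b n T.plane, linMk a b n (T.line i)} := by
  obtain ⟨R, -, hR⟩ := T.exists_form_eq i
  have hform : T.proj i (form a b n) = 0 := by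
    rw [hR, map_add, map_mul, map_mul, proj_plane, proj_line, zero_mul, zero_mul, add_zero]
  let θ : CoordRing a b n →+* MvPolynomial (Fin 4) k :=
    Ideal.Quotient.lift _ (T.proj i).toRingHom fun f hf ↦ by
      obtain ⟨s, rfl⟩ := Ideal.mem_span_singleton.mp hf
      change T.proj i _ = 0
      rw [map_mul, hform, zero_mul]
  have hθ (f) : θ (Ideal.Quotient.mk _ f) = T.proj i f := rfl
  have hker : RingHom.ker θ = Ideal.span {linMk a b n T.plane, linMk a b n (T.line i)} := by
    refine le_antisymm (fun f hf ↦ ?_) (Ideal.span_le.mpr ?_)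
    · obtain ⟨f, rfl⟩ := Ideal.Quotient.mk_surjective f
      have h1 := Ideal.mem_map_of_mem (Ideal.Quotient.mk (Ideal.span {form a b n}))
        (T.mem_span_of_proj_eq_zero i (f := f) hf)
      rwa [Ideal.map_span, Set.image_pair] at h1
    · rintro _ (rfl | rfl)
      · exact T.proj_plane i
      · exact T.proj_line i
  have hhom : (Ideal.span {linMk a b n T.plane, linMk a b n (T.line i)}).IsHomogeneous
      (gr a b n) := by
    refine Ideal.homogeneous_span _ _ ?_
    rintro _ (rfl | rfl)
    · exact ⟨1, linMk_mem a b n _⟩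
    · exact ⟨1, linMk_mem a b n _⟩
  refine ⟨⟨⟨_, hhom⟩, ?_, fun h ↦ ?_⟩, rfl⟩
  · change (Ideal.span _).IsPrime
    rw [← hker]
    exact RingHom.ker_isPrime θ
  · obtain ⟨j, hj⟩ := T.exists_proj_X_ne_zero i
    have h1 := h (HomogeneousIdeal.mem_irrelevant_of_mem (gr a b n) one_pos (coord_mem a b n j))
    have h2 : coord a b n j ∈ RingHom.ker θ := hker ▸ h1
    exact hj h2

theorem exists_isLocalEq (hns : Nonsingular a b n) [IsDomain (CoordRing a b n)] (i : Fin 3)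
    (x : ProjectiveSpectrum (gr a b n)) : ∃ f, ProjModel.IsLocalEq (gr a b n)
      (linMk a b n T.plane) (linMk a b n (T.line i)) x f := by
  obtain ⟨c, hc⟩ := exists_coord_notMem a b n x
  by_cases h1 : linMk a b n T.plane ∈ x.asHomogeneousIdeal
  swap
  · exact ⟨_, _, .inl rfl, _, coord_mem a b n c, hc, 1, _, linMk_mem a b n _, h1, _,
      linMk_mem a b n _, _, linMk_mem a b n _, rfl, rfl, rfl⟩
  by_cases h2 : linMk a b n (T.line i) ∈ x.asHomogeneousIdeal
  swap
  · exact ⟨_, _, .inr rfl, _, coord_mem a b n c, hc, 1, _, linMk_mem a b n _, h2, _,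
      linMk_mem a b n _, _, linMk_mem a b n _, rfl, rfl, rfl⟩
  obtain ⟨R, hR, e⟩ := T.exists_form_eq i
  let π : MvPolynomial (Fin 4) k →+* CoordRing a b n := Ideal.Quotient.mk _
  have e' : linMk a b n (T.line i) * π R + linMk a b n T.plane * π T.quad = 0 := by
    have h : π (form a b n) = 0 :=
      Ideal.Quotient.eq_zero_iff_mem.mpr (Ideal.mem_span_singleton_self _)
    have h' := (congrArg π e).symm.trans h
    rwa [map_add, map_mul, map_mul] at h'
  by_cases h3 : π R ∈ x.asHomogeneousIdeal
  swap
  · refine ⟨_, _, .inl rfl, _, coord_mem a b n c, hc, 2, π R, mk_mem a b n hR, h3, _,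
      mk_mem a b n hR, -π T.quad, neg_mem (mk_mem a b n T.quad_isHomogeneous), mul_comm _ _, ?_, rfl⟩
    linear_combination e'
  by_cases h4 : π T.quad ∈ x.asHomogeneousIdeal
  swap
  · refine ⟨_, _, .inr rfl, _, coord_mem a b n c, hc, 2, π T.quad,
      mk_mem a b n T.quad_isHomogeneous, h4, -π R, neg_mem (mk_mem a b n hR), _,
      mk_mem a b n T.quad_isHomogeneous, ?_, mul_comm _ _, rfl⟩
    linear_combination e'
  obtain ⟨j, hj⟩ := hns x
  refine absurd ?_ hj
  have hd := congrArg (fun f ↦ π (MvPolynomial.pderiv j f)) e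
  simp only [map_add, Derivation.leibniz, smul_eq_mul, map_mul] at hd
  refine (congrArg (· ∈ x.asHomogeneousIdeal) hd).mpr ?_
  exact add_mem (add_mem (Ideal.mul_mem_right _ _ h2) (Ideal.mul_mem_right _ _ h3))
    (add_mem (Ideal.mul_mem_right _ _ h1) (Ideal.mul_mem_right _ _ h4))

end TritangentPlane

end CubicSurface

/-! ### Line bundles that are trivial outside of the tritangent planes -/

theorem FieldModel.isCartier_list_prod {X : Scheme.{u}} {F : Type v} [Field F] {M : FieldModel X F}
    (L : List (X → F)) (hL : ∀ δ ∈ L, M.IsCartier δ) : M.IsCartier fun x ↦ (L.map (· x)).prod := by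
  induction L with
  | nil => exact isCartier_const M one_ne_zero
  | cons δ L ih =>
    exact (hL δ List.mem_cons_self).mul (ih fun δ h ↦ hL δ (List.mem_cons_of_mem _ h))

namespace ProjModel

variable {E A : Type u} [Field E] [CommRing A] [IsDomain A] [Algebra E A] {𝒜 : ℕ → Submodule E A}
  [GradedAlgebra 𝒜]

theorem pow_mem_of_le {e N N' : ℕ} {H l : A} {x : Proj 𝒜} {f : FractionRing A} (hH : H ∈ 𝒜 e)
    (hl : l ∈ 𝒜 1) (hlx : l ∉ x.asHomogeneousIdeal) (hN : N ≤ N')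
    (h : f * (algebraMap A _ H / algebraMap A _ l ^ e) ^ N ∈ (model 𝒜).reg x) :
    f * (algebraMap A _ H / algebraMap A _ l ^ e) ^ N' ∈ (model 𝒜).reg x := by
  obtain ⟨m, rfl⟩ := Nat.exists_eq_add_of_le hN
  rw [pow_add, ← mul_assoc]
  refine mul_mem h (pow_mem ?_ _)
  rw [← map_pow]
  refine mem_reg hH ?_ fun h ↦ hlx (x.isPrime.mem_of_pow_mem _ h)
  simpa using SetLike.pow_mem_graded e hl

theorem exists_pow_mem [CompactSpace (Proj 𝒜)] {e : ℕ} {H : A} (hH : H ∈ 𝒜 e) (hH0 : H ≠ 0)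
    {φ : Proj 𝒜 → FractionRing A} (hφ : (model 𝒜).IsCartier φ)
    (hu : ∀ x : Proj 𝒜, H ∉ x.asHomogeneousIdeal → φ x ∈ (model 𝒜).reg x) :
    ∃ N, ∀ x : Proj 𝒜, ∀ l ∈ 𝒜 1, l ∉ x.asHomogeneousIdeal →
      φ x * (algebraMap A _ H / algebraMap A _ l ^ e) ^ N ∈ (model 𝒜).reg x := by
  suffices h : ∃ N, ∀ x ∈ (Set.univ : Set (Proj 𝒜)), ∀ l ∈ 𝒜 1, l ∉ x.asHomogeneousIdeal →
      φ x * (algebraMap A _ H / algebraMap A _ l ^ e) ^ N ∈ (model 𝒜).reg x by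
    simpa using h
  refine isCompact_univ.induction_on (p := fun S ↦ ∃ N, ∀ x ∈ S, ∀ l ∈ 𝒜 1,
    l ∉ x.asHomogeneousIdeal → φ x * (algebraMap A _ H / algebraMap A _ l ^ e) ^ N ∈
      (model 𝒜).reg x) ⟨0, fun x hx ↦ hx.elim⟩ ?_ ?_ ?_
  · rintro S T hST ⟨N, hN⟩
    exact ⟨N, fun x hx ↦ hN x (hST hx)⟩
  · rintro S T ⟨N, hN⟩ ⟨N', hN'⟩
    refine ⟨max N N', fun x hx l hl hlx ↦ ?_⟩
    rcases hx with hx | hx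
    · exact pow_mem_of_le hH hl hlx (le_max_left _ _) (hN x hx l hl hlx)
    · exact pow_mem_of_le hH hl hlx (le_max_right _ _) (hN' x hx l hl hlx)
  · intro x _
    obtain ⟨h0, U, hxU, hU⟩ := hφ x
    obtain ⟨d, hd, q, hq, hqx, hqU⟩ := exists_basicOpen_le hxU
    have hq0 := ne_zero_of_notMem 𝒜 hqx
    obtain ⟨m, s, hs, e1⟩ := exists_eq_div_pow (𝒜 := 𝒜) (Nat.add_pos_left hd e)
      (SetLike.mul_mem_graded hq hH) (f := φ x) (fun z hz ↦ by
        have h1 : H ∉ z.asHomogeneousIdeal := fun h ↦ hz (Ideal.mul_mem_left _ _ h)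
        have h2 : q ∉ z.asHomogeneousIdeal := fun h ↦ hz (Ideal.mul_mem_right _ _ h)
        have h3 := mul_mem (hU z (hqU z h2)).mem (hu z h1)
        rwa [div_mul_cancel₀ _ (hφ z).1] at h3) (mul_ne_zero hq0 hH0)
    refine ⟨_, mem_nhdsWithin_of_mem_nhds ((Proj.basicOpen 𝒜 q).isOpen.mem_nhds hqx), m,
      fun z hz l hl hlz ↦ ?_⟩
    have h1 := (hU z (hqU z hz)).inv.mem
    have h2 : φ x * (algebraMap A _ H / algebraMap A _ l ^ e) ^ m ∈ (model 𝒜).reg z := by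
      have hl' : l ^ (e * m) ∈ 𝒜 (e * m) := by simpa using SetLike.pow_mem_graded (e * m) hl
      have hq' : q ^ m ∈ 𝒜 (m * d) := by simpa using SetLike.pow_mem_graded m hq
      have h3 := mem_reg (𝒜 := 𝒜) (x := z) (b := q ^ m * l ^ (e * m)) hs
        (by convert SetLike.mul_mem_graded hq' hl' using 2; ring)
        (fun h ↦ (z.isPrime.mem_or_mem h).elim (fun h ↦ hz (z.isPrime.mem_of_pow_mem _ h))
          (fun h ↦ hlz (z.isPrime.mem_of_pow_mem _ h)))
      convert h3 using 1
      have n1 := algebraMap_ne_zero hq0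
      have n2 := algebraMap_ne_zero (ne_zero_of_notMem 𝒜 hlz)
      rw [← e1]
      simp only [map_mul, map_pow, div_pow, mul_pow, pow_mul]
      field_simp
    have h4 := mul_mem h1 h2
    rw [inv_div, ← mul_assoc, div_mul_cancel₀ _ h0] at h4
    exact h4

end ProjModel

theorem List.prod_map_div_div_pow {ι F : Type*} [Field F] (L : List ι) (f g : ι → F) (c : F) :
    (L.map fun i ↦ f i / (g i / c)).prod = (L.map f).prod / ((L.map g).prod / c ^ L.length) := by
  induction L with
  | nil => simp
  | cons i L ih =>
    simp only [List.map_cons, List.prod_cons, ih, List.length_cons, pow_succ']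
    simp only [div_eq_mul_inv, mul_inv, inv_inv]
    ring

theorem List.prod_map_flatMap {ι κ F : Type*} [CommMonoid F] (L : List ι) (g : ι → List κ)
    (f : κ → F) : ((L.flatMap g).map f).prod = (L.map fun i ↦ ((g i).map f).prod).prod := by
  induction L with
  | nil => rfl
  | cons i L ih =>
    rw [List.flatMap_cons, List.map_append, List.prod_append, ih, List.map_cons, List.prod_cons]

theorem List.prod_map_flatten_replicate {ι F : Type*} [CommMonoid F] (L : List ι) (m : ℕ)
    (f : ι → F) : ((List.replicate m L).flatten.map f).prod = (L.map f).prod ^ m := by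
  rw [List.map_flatten, List.prod_flatten, List.map_replicate, List.map_replicate,
    List.prod_replicate]

theorem RingHom.map_list_prod_map {ι R S : Type*} [CommSemiring R] [CommSemiring S] (f : R →+* S)
    (L : List ι) (g : ι → R) : f (L.map g).prod = (L.map fun i ↦ f (g i)).prod := by
  rw [map_list_prod, List.map_map]
  rfl

namespace CubicSurface

variable {k E : Type u} [Field k] [Field E] [Algebra k E] (a b n : k)

instance : CompactSpace (Proj (gr a b n)) := by
  refine ⟨?_⟩
  have h : (Set.univ : Set (Proj (gr a b n))) =
      ⋃ i, (Proj.basicOpen (gr a b n) (coord a b n i) : Set (Proj (gr a b n))) := by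
    refine (Set.eq_univ_of_forall fun x ↦ ?_).symm
    obtain ⟨i, hi⟩ := exists_coord_notMem a b n x
    exact Set.mem_iUnion.mpr ⟨i, hi⟩
  rw [h]
  exact isCompact_iUnion fun i ↦
    (Proj.isAffineOpen_basicOpen (gr a b n) _ (coord_mem a b n i) one_pos).isCompact

variable {a b n} in
theorem TritangentPlane.plane_ne_zero (T : TritangentPlane a b n) : linMk a b n T.plane ≠ 0 :=
  linMk_ne_zero a b n (z := T.p 0) (by rw [T.plane_p]; exact one_ne_zero)

variable {a b n} in
theorem TritangentPlane.line_ne_zero (T : TritangentPlane a b n) (i : Fin 3) :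
    linMk a b n (T.line i) ≠ 0 :=
  linMk_ne_zero a b n (z := T.q i) (by rw [T.line_q]; exact one_ne_zero)

variable {a b n} in
theorem TritangentPlane.line_mul (T : TritangentPlane a b n) :
    linMk a b n (T.line 0) * linMk a b n (T.line 1) * linMk a b n (T.line 2) =
      linMk a b n T.plane * Ideal.Quotient.mk _ (-T.quad) := by
  let π : MvPolynomial (Fin 4) k →+* CoordRing a b n := Ideal.Quotient.mk _
  have h : π (form a b n) = 0 :=
    Ideal.Quotient.eq_zero_iff_mem.mpr (Ideal.mem_span_singleton_self _)
  have h' := (congrArg π T.form_eq).symm.trans h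
  rw [map_add, map_mul, map_mul, map_mul] at h'
  change π _ * π _ * π _ = π _ * π _
  rw [map_neg]
  linear_combination h'

variable {a b n} in
theorem TritangentPlane.prod_div_mem [IsDomain (CoordRing a b n)] (T : TritangentPlane a b n)
    {f : Fin 3 → FractionRing (CoordRing a b n)} {x : Proj (gr a b n)} {l : CoordRing a b n}
    (hf : ∀ i, ProjModel.IsLocalEq (gr a b n) (linMk a b n T.plane) (linMk a b n (T.line i)) x (f i))
    (hl : l ∈ gr a b n 1) (hlx : l ∉ x.asHomogeneousIdeal) :
    f 0 * f 1 * f 2 / (algebraMap _ _ (linMk a b n T.plane) / algebraMap _ _ l) ∈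
      (ProjModel.model (gr a b n)).reg x := by
  have hQ : (Ideal.Quotient.mk _ (-T.quad) : CoordRing a b n) ∈ gr a b n 2 :=
    mk_mem a b n T.quad_isHomogeneous.neg
  exact ProjModel.prod_div_mem (h := linMk a b n T.plane) (l := l)
    (α := fun i ↦ linMk a b n (T.line i)) (Q := Ideal.Quotient.mk _ (-T.quad)) (f := f) (x := x)
    (linMk_mem a b n T.plane) hQ T.plane_ne_zero (fun i ↦ linMk_mem a b n (T.line i)) T.line_mul hf
    hl hlx

variable [IsDomain (CoordRing a b n)]
  [IsDomain (CoordRing (algebraMap k E a) (algebraMap k E b) (algebraMap k E n))]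

theorem map_extendMap_surjective (hns : Nonsingular a b n) (Ts : List (TritangentPlane a b n))
    (y₀ : Proj (gr (algebraMap k E a) (algebraMap k E b) (algebraMap k E n)))
    (H : ∀ φ, (ProjModel.model (gr (algebraMap k E a) (algebraMap k E b) (algebraMap k E n))).IsCartier φ →
      ∃ f ≠ 0, ∀ y : Proj (gr (algebraMap k E a) (algebraMap k E b) (algebraMap k E n)),
        (∀ T ∈ Ts, linMk _ _ _ (T.extend E).plane ∉ y.asHomogeneousIdeal) →
        (ProjModel.model (gr (algebraMap k E a) (algebraMap k E b) (algebraMap k E n))).UnitAt y (f * φ y)) :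
    Function.Surjective (SchemePic.map (extendMap E a b n)) := by
  let M := ProjModel.model (gr a b n)
  let M' := ProjModel.model (gr (algebraMap k E a) (algebraMap k E b) (algebraMap k E n))
  let j := extendFrac E a b n
  refine (compatible_extendMap a b n).map_surjective y₀ fun d ↦ ?_
  obtain ⟨f, hf0, hf⟩ := H _ (M'.isCartier_rat d y₀)
  have hex (T : TritangentPlane a b n) (i : Fin 3) (x : Proj (gr a b n)) :
      ∃ f, ProjModel.IsLocalEq (gr a b n) (linMk a b n T.plane) (linMk a b n (T.line i)) x f :=
    T.exists_isLocalEq hns i x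
  choose δ hδ using hex
  let pull (ε : Proj (gr a b n) → FractionRing (CoordRing a b n)) (y) := j (ε (extendMap E a b n y))
  have hδ' (T : TritangentPlane a b n) (i) (y) : ProjModel.IsLocalEq
      (gr (algebraMap k E a) (algebraMap k E b) (algebraMap k E n))
      (linMk _ _ _ (T.extend E).plane) (linMk _ _ _ ((T.extend E).line i)) y (pull (δ T i) y) := by
    have h := (hδ T i (extendMap E a b n y)).map (extend E a b n) (extendFrac_algebraMap a b n)
      (y := y) fun _ h ↦ h
    rwa [extend_linMk, extend_linMk] at h
  have hcar (T : TritangentPlane a b n) (i) : M.IsCartier (δ T i) :=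
    ProjModel.isCartier_of_isLocalEq (linMk_mem _ _ _ _) (linMk_mem _ _ _ _) T.plane_ne_zero
      (T.line_ne_zero i) (hδ T i)
  have hprime (T : TritangentPlane a b n) (i) : M'.IsPrimeDivisor (pull (δ T i)) := by
    obtain ⟨w, hw⟩ := (T.extend E).exists_generic i
    exact ProjModel.isPrimeDivisor_of_isLocalEq (linMk_mem _ _ _ _) (linMk_mem _ _ _ _)
      (T.extend E).plane_ne_zero ((T.extend E).line_ne_zero i) (hδ' T i) w hw
  let h := (Ts.map fun T ↦ linMk (algebraMap k E a) (algebraMap k E b) (algebraMap k E n)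
    (T.extend E).plane).prod
  have hh : h ∈ gr (algebraMap k E a) (algebraMap k E b) (algebraMap k E n) Ts.length := by
    have h1 := SetLike.list_prod_map_mem_graded
      (A := gr (algebraMap k E a) (algebraMap k E b) (algebraMap k E n)) Ts (fun _ ↦ 1)
      (fun T ↦ linMk _ _ _ (T.extend E).plane) fun T _ ↦ linMk_mem _ _ _ _
    simpa using h1
  have hh0 : h ≠ 0 := by
    refine List.prod_ne_zero fun h0 ↦ ?_
    obtain ⟨T, -, hT⟩ := List.mem_map.mp h0
    exact (T.extend E).plane_ne_zero hT
  have hhy (y : Proj (gr (algebraMap k E a) (algebraMap k E b) (algebraMap k E n)))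
      (hy : h ∉ y.asHomogeneousIdeal) : M'.UnitAt y (f * M'.rat d y y₀) := by
    refine hf y fun T hT hm ↦ hy ?_
    exact Ideal.mem_of_dvd _ (List.dvd_prod (List.mem_map_of_mem hT)) hm
  have hψ : M'.IsCartier fun y ↦ f * M'.rat d y y₀ :=
    (M'.isCartier_const hf0).mul (M'.isCartier_rat d y₀)
  obtain ⟨N₁, hN₁⟩ := ProjModel.exists_pow_mem hh hh0 hψ fun y hy ↦ (hhy y hy).mem
  obtain ⟨N₂, hN₂⟩ := ProjModel.exists_pow_mem hh hh0 hψ.inv fun y hy ↦ (hhy y hy).inv.mem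
  let L₀ := Ts.flatMap fun T ↦ [δ T 0, δ T 1, δ T 2]
  let L := (List.replicate (max N₁ N₂) L₀).flatten
  have hLmem {ε} (hε : ε ∈ L) : ∃ T i, ε = δ T i := by
    obtain ⟨l, hl, hεl⟩ := List.mem_flatten.mp hε
    obtain ⟨T, -, hT⟩ := List.mem_flatMap.mp ((List.mem_replicate.mp hl).2 ▸ hεl)
    simp only [List.mem_cons, List.not_mem_nil, or_false] at hT
    rcases hT with rfl | rfl | rfl
    exacts [⟨T, 0, rfl⟩, ⟨T, 1, rfl⟩, ⟨T, 2, rfl⟩]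
  have hL₀ (y : Proj (gr (algebraMap k E a) (algebraMap k E b) (algebraMap k E n))) (l)
      (hl : l ∈ gr (algebraMap k E a) (algebraMap k E b) (algebraMap k E n) 1)
      (hly : l ∉ y.asHomogeneousIdeal) :
      (L₀.map (pull · y)).prod / (algebraMap _ _ h / algebraMap _ _ l ^ Ts.length) ∈ M'.reg y := by
    have h1 : (Ts.map fun T ↦ pull (δ T 0) y * pull (δ T 1) y * pull (δ T 2) y /
        (algebraMap _ _ (linMk (algebraMap k E a) (algebraMap k E b) (algebraMap k E n)
          (T.extend E).plane) / algebraMap _ _ l)).prod ∈ M'.reg y := by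
      refine list_prod_mem fun z hz ↦ ?_
      obtain ⟨T, -, rfl⟩ := List.mem_map.mp hz
      exact (T.extend E).prod_div_mem (f := fun i ↦ pull (δ T i) y) (hδ' T · y) hl hly
    have e1 : (L₀.map (pull · y)).prod =
        (Ts.map fun T ↦ pull (δ T 0) y * pull (δ T 1) y * pull (δ T 2) y).prod := by
      refine (List.prod_map_flatMap _ _ _).trans (congrArg List.prod (List.map_congr_left
        fun T _ ↦ ?_))
      rw [List.map_cons, List.map_cons, List.map_cons, List.map_nil, List.prod_cons, List.prod_cons,
        List.prod_cons, List.prod_nil, mul_one, mul_assoc]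
    have e2 : algebraMap _ (FractionRing (CoordRing (algebraMap k E a) (algebraMap k E b)
        (algebraMap k E n))) h = (Ts.map fun T ↦ algebraMap _ _
        (linMk (algebraMap k E a) (algebraMap k E b) (algebraMap k E n) (T.extend E).plane)).prod :=
      RingHom.map_list_prod_map _ _ _
    rwa [List.prod_map_div_div_pow, ← e1, ← e2] at h1
  have hL (y : Proj (gr (algebraMap k E a) (algebraMap k E b) (algebraMap k E n))) (l)
      (hl : l ∈ gr (algebraMap k E a) (algebraMap k E b) (algebraMap k E n) 1)
      (hly : l ∉ y.asHomogeneousIdeal) :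
      (L.map (pull · y)).prod / (algebraMap _ _ h / algebraMap _ _ l ^ Ts.length) ^ (max N₁ N₂) ∈
        M'.reg y := by
    have h1 := pow_mem (hL₀ y l hl hly) (max N₁ N₂)
    rw [div_pow] at h1
    have e : (L.map (pull · y)).prod = (L₀.map (pull · y)).prod ^ (max N₁ N₂) :=
      List.prod_map_flatten_replicate _ _ _
    rwa [← e] at h1
  have key {z s t : FractionRing (CoordRing (algebraMap k E a) (algebraMap k E b)
      (algebraMap k E n))} {y} (hs : s ≠ 0) (h1 : z * s ∈ M'.reg y) (h2 : t / s ∈ M'.reg y) :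
      z * t ∈ M'.reg y := by
    convert mul_mem h1 h2 using 1
    field_simp
  have hs (i) (y : Proj (gr (algebraMap k E a) (algebraMap k E b) (algebraMap k E n)))
      (hi : coord _ _ _ i ∉ y.asHomogeneousIdeal) :
      (algebraMap _ (FractionRing (CoordRing (algebraMap k E a) (algebraMap k E b)
        (algebraMap k E n))) h / algebraMap _ _ (coord _ _ _ i) ^ Ts.length) ^
        (max N₁ N₂) ≠ 0 :=
    pow_ne_zero _ (div_ne_zero (ProjModel.algebraMap_ne_zero hh0) (pow_ne_zero _
      (ProjModel.algebraMap_ne_zero (ProjModel.ne_zero_of_notMem _ hi))))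
  obtain ⟨L', hL', hu⟩ := FieldModel.exists_prod_of_mul_mem (M := M') (L.map pull) (fun ε hε ↦ by
    obtain ⟨ε, hε', rfl⟩ := List.mem_map.mp hε
    obtain ⟨T, i, rfl⟩ := hLmem hε'
    exact hprime T i) _ hψ
    (fun y ↦ by
      obtain ⟨i, hi⟩ := exists_coord_notMem _ _ _ y
      rw [List.map_map]
      exact key (hs i y hi) (ProjModel.pow_mem_of_le hh (coord_mem _ _ _ i) hi (le_max_left _ _)
        (hN₁ y _ (coord_mem _ _ _ i) hi)) (hL y _ (coord_mem _ _ _ i) hi))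
    (fun y ↦ by
      obtain ⟨i, hi⟩ := exists_coord_notMem _ _ _ y
      rw [List.map_map]
      exact key (hs i y hi) (ProjModel.pow_mem_of_le hh (coord_mem _ _ _ i) hi (le_max_right _ _)
        (hN₂ y _ (coord_mem _ _ _ i) hi)) (hL y _ (coord_mem _ _ _ i) hi))
  obtain ⟨L'', hL'', rfl⟩ : ∃ L'' ⊆ L, L''.map pull = L' := by
    clear hu
    induction L' with
    | nil => exact ⟨[], by simp, rfl⟩
    | cons ε L' ih =>
      obtain ⟨L'', h1, rfl⟩ := ih fun δ h ↦ hL' (List.mem_cons_of_mem _ h)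
      obtain ⟨ε', h2, rfl⟩ := List.mem_map.mp (hL' List.mem_cons_self)
      exact ⟨ε' :: L'', List.cons_subset.mpr ⟨h2, h1⟩, rfl⟩
  refine ⟨fun x ↦ (L''.map (· x)).prod * ((L.map (· x)).prod)⁻¹,
    (FieldModel.isCartier_list_prod L'' fun ε hε ↦ ?_).mul
      (FieldModel.isCartier_list_prod L fun ε hε ↦ ?_).inv, f⁻¹, fun y ↦ ?_⟩
  · obtain ⟨T, i, rfl⟩ := hLmem (hL'' hε)
    exact hcar T i
  · obtain ⟨T, i, rfl⟩ := hLmem hε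
    exact hcar T i
  · have e (L : List _) : j (L.map (· (extendMap E a b n y))).prod =
        ((L.map pull).map (· y)).prod := by
      rw [map_list_prod, List.map_map, List.map_map]
      rfl
    convert (hu y).inv using 1
    rw [map_mul, map_inv₀, e, e]
    simp only [mul_inv, div_eq_mul_inv, inv_inv]
    ring

end CubicSurface

/-! ### Explicit tritangent planes -/

namespace CubicSurface

variable {k : Type u} [Field k]

open MvPolynomial in
theorem form_eq (a b n : k) : form a b n =
    X 1 ^ 3 + X 2 ^ 3 + X 3 ^ 3 + MvPolynomial.C a * X 0 ^ 2 * (X 1 + X 2 + X 3) +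
      MvPolynomial.C (3 * b - n) * X 0 ^ 3 := by
  simp only [form, F, MvPolynomial.smul_eq_C_mul, map_sub, map_mul, map_ofNat]
  ring

/-- The roots of `f₁`, and the inverses of the roots of `g₁` (with `0` as the inverse of `∞`). -/
structure Roots (a b n : k) where
  r : k
  r₂ : k
  r₃ : k
  t : Fin 3 → k
  add_eq : r + r₂ + r₃ = 0
  mul_add_eq : r * r₂ + r * r₃ + r₂ * r₃ = a
  mul_eq : r * r₂ * r₃ = n - 3 * b
  ne : r ≠ r₂
  ne_zero : 4 * a + 3 * r ^ 2 ≠ 0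
  t_add_eq : (4 * a + 3 * r ^ 2) * (t 0 + t 1 + t 2) = 3 * r ^ 2
  t_mul_add_eq : (4 * a + 3 * r ^ 2) * (t 0 * t 1 + t 0 * t 2 + t 1 * t 2) = 3 * r ^ 2
  t_mul_eq : (4 * a + 3 * r ^ 2) * (t 0 * t 1 * t 2) = -a

namespace Roots

variable {a b n : k} (R : Roots a b n)

/-- Extension of scalars of the roots. -/
def map {E : Type v} [Field E] (f : k →+* E) : Roots (f a) (f b) (f n) where
  r := f R.r
  r₂ := f R.r₂
  r₃ := f R.r₃
  t i := f (R.t i)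
  add_eq := by simpa using congrArg f R.add_eq
  mul_add_eq := by simpa using congrArg f R.mul_add_eq
  mul_eq := by simpa [map_ofNat f] using congrArg f R.mul_eq
  ne h := R.ne (f.injective h)
  ne_zero h := R.ne_zero (f.injective (by simpa [map_ofNat f] using h))
  t_add_eq := by simpa [map_ofNat f] using congrArg f R.t_add_eq
  t_mul_add_eq := by simpa [map_ofNat f] using congrArg f R.t_mul_add_eq
  t_mul_eq := by simpa [map_ofNat f] using congrArg f R.t_mul_eq

theorem eval_eq (x : k) : (4 * a + 3 * R.r ^ 2) * x ^ 3 - 3 * R.r ^ 2 * x ^ 2 +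
    3 * R.r ^ 2 * x + a =
      (4 * a + 3 * R.r ^ 2) * ((x - R.t 0) * (x - R.t 1) * (x - R.t 2)) := by
  linear_combination x ^ 2 * R.t_add_eq - x * R.t_mul_add_eq + R.t_mul_eq

theorem eval_t (i : Fin 3) : (4 * a + 3 * R.r ^ 2) * R.t i ^ 3 - 3 * R.r ^ 2 * R.t i ^ 2 +
    3 * R.r ^ 2 * R.t i + a = 0 := by
  rw [R.eval_eq]
  fin_cases i <;> simp

variable (h2 : (2 : k) ≠ 0) (h3 : (3 : k) ≠ 0)

include h2 h3 in
theorem two_mul_t_sub_one_ne_zero (i : Fin 3) : 2 * R.t i - 1 ≠ 0 := by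
  intro h
  have ht := R.eval_t i
  have : 3 * (4 * a + 3 * R.r ^ 2) = 0 := by
    have h' : (2 * R.t i) = 1 := sub_eq_zero.mp h
    linear_combination 8 * ht - ((4 * a + 3 * R.r ^ 2) * (4 * R.t i ^ 2 + 2 * R.t i + 1)
      - 6 * R.r ^ 2 * (2 * R.t i + 1) + 12 * R.r ^ 2) * h
  exact (mul_ne_zero h3 R.ne_zero) this

theorem sub_sq : (R.r₂ - R.r₃) ^ 2 = -(4 * a + 3 * R.r ^ 2) := by
  linear_combination (R.r₂ + R.r₃ + 3 * R.r) * R.add_eq - 4 * R.mul_add_eq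

theorem sub_ne_zero' : R.r₂ - R.r₃ ≠ 0 := by
  intro h
  have := R.sub_sq
  rw [h] at this
  exact R.ne_zero (by linear_combination this)

include h2 in
theorem quadric_coeffs (h3 : (3 : k) ≠ 0) (i : Fin 3) : ∃ m l : k,
    3 / 4 * m ^ 2 + 1 / 4 + R.t i ^ 3 = 0 ∧ 2 * (3 / 4) * m * l + 3 * R.r * R.t i ^ 2 = 0 ∧
      3 / 4 * l ^ 2 + a + R.t i * (a + 3 * R.r ^ 2) = 0 := by
  have h4 : (4 : k) ≠ 0 := by
    have := mul_ne_zero h2 h2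
    norm_num at this
    exact this
  have n1 := R.two_mul_t_sub_one_ne_zero h2 h3 i
  have n2 := R.sub_ne_zero'
  have ht := R.eval_t i
  have hs := R.sub_sq
  refine ⟨R.r * (2 * R.t i - 1) / (R.r₂ - R.r₃),
    -2 * R.t i ^ 2 * (R.r₂ - R.r₃) / (2 * R.t i - 1), ?_, ?_, ?_⟩
  · field_simp
    rw [hs]
    linear_combination -4 * ht
  · field_simp
    ring
  · field_simp
    linear_combination 12 * R.t i ^ 4 * hs - 4 * (3 * R.t i - 1) * ht

open MvPolynomial in
/-- The plane `x₁ + x₂ = 0`. -/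
def planeX : TritangentPlane a b n where
  plane := ![0, 1, 1, 0]
  line := ![![-R.r, 0, 0, 1], ![-R.r₂, 0, 0, 1], ![-R.r₃, 0, 0, 1]]
  p _ := ![0, 1, 0, 0]
  q _ := ![0, 0, 0, 1]
  plane_p _ := by simp [dotProduct, Fin.sum_univ_four]
  plane_q _ := by simp [dotProduct, Fin.sum_univ_four]
  line_p i := by fin_cases i <;> simp [dotProduct, Fin.sum_univ_four]
  line_q i := by fin_cases i <;> simp [dotProduct, Fin.sum_univ_four]
  quad := X 1 ^ 2 - X 1 * X 2 + X 2 ^ 2 + MvPolynomial.C a * X 0 ^ 2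
  quad_isHomogeneous := by
    have h (i j : Fin 4) : (X i * X j : MvPolynomial (Fin 4) k).IsHomogeneous 2 :=
      (isHomogeneous_X k i).mul (isHomogeneous_X k j)
    have h0 (c : k) (i j : Fin 4) : (MvPolynomial.C c * (X i * X j) : MvPolynomial (Fin 4) k).IsHomogeneous 2 :=
      by simpa using (isHomogeneous_C (Fin 4) c).mul (h i j)
    simp only [sq]
    exact (((h 1 1).sub (h 1 2)).add (h 2 2)).add (h0 a 0 0)
  form_eq := by
    have e1 := congrArg (MvPolynomial.C (σ := Fin 4)) R.add_eq
    have e2 := congrArg (MvPolynomial.C (σ := Fin 4)) R.mul_add_eq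
    have e3 := congrArg (MvPolynomial.C (σ := Fin 4)) R.mul_eq
    simp only [map_add, map_mul, map_zero, map_sub, map_ofNat] at e1 e2 e3
    rw [CubicSurface.form_eq]
    simp [lin, Fin.sum_univ_four, map_ofNat (MvPolynomial.C (R := k) (σ := Fin 4))]
    linear_combination X 0 * X 3 ^ 2 * e1 - X 3 * X 0 ^ 2 * e2 + X 0 ^ 3 * e3

open MvPolynomial in
/-- The plane `x₁ + x₃ = 0`. -/
def planeZ : TritangentPlane a b n where
  plane := ![0, 1, 0, 1]
  line := ![![-R.r, 0, 1, 0], ![-R.r₂, 0, 1, 0], ![-R.r₃, 0, 1, 0]]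
  p _ := ![0, 1, 0, 0]
  q _ := ![0, 0, 1, 0]
  plane_p _ := by simp [dotProduct, Fin.sum_univ_four]
  plane_q _ := by simp [dotProduct, Fin.sum_univ_four]
  line_p i := by fin_cases i <;> simp [dotProduct, Fin.sum_univ_four]
  line_q i := by fin_cases i <;> simp [dotProduct, Fin.sum_univ_four]
  quad := X 1 ^ 2 - X 1 * X 3 + X 3 ^ 2 + MvPolynomial.C a * X 0 ^ 2
  quad_isHomogeneous := by
    have h (i j : Fin 4) : (X i * X j : MvPolynomial (Fin 4) k).IsHomogeneous 2 :=
      (isHomogeneous_X k i).mul (isHomogeneous_X k j)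
    have h0 (c : k) (i j : Fin 4) : (MvPolynomial.C c * (X i * X j) : MvPolynomial (Fin 4) k).IsHomogeneous 2 :=
      by simpa using (isHomogeneous_C (Fin 4) c).mul (h i j)
    simp only [sq]
    exact (((h 1 1).sub (h 1 3)).add (h 3 3)).add (h0 a 0 0)
  form_eq := by
    have e1 := congrArg (MvPolynomial.C (σ := Fin 4)) R.add_eq
    have e2 := congrArg (MvPolynomial.C (σ := Fin 4)) R.mul_add_eq
    have e3 := congrArg (MvPolynomial.C (σ := Fin 4)) R.mul_eq
    simp only [map_add, map_mul, map_zero, map_sub, map_ofNat] at e1 e2 e3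
    rw [CubicSurface.form_eq]
    simp [lin, Fin.sum_univ_four, map_ofNat (MvPolynomial.C (R := k) (σ := Fin 4))]
    linear_combination X 0 * X 2 ^ 2 * e1 - X 2 * X 0 ^ 2 * e2 + X 0 ^ 3 * e3

theorem eval_r : R.r ^ 3 + a * R.r + (3 * b - n) = 0 := by
  linear_combination (R.r ^ 2) * R.add_eq - R.r * R.mul_add_eq + R.mul_eq

open MvPolynomial in
/-- The plane `x₁ + x₂ + x₃ = r x₀`. -/
def planeXY : TritangentPlane a b n where
  plane := ![-R.r, 1, 1, 1]
  line := ![![0, -3, -3, 0], ![0, 1, 0, 1], ![0, 0, 1, 1]]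
  p := ![![0, 0, 0, 1], ![0, 0, 1, 0], ![0, 1, 0, 0]]
  q := ![![0, -1 / 3, 0, 1 / 3], ![0, 1, -1, 0], ![0, -1, 1, 0]]
  plane_p i := by fin_cases i <;> simp [dotProduct, Fin.sum_univ_four]
  plane_q i := by fin_cases i <;> simp [dotProduct, Fin.sum_univ_four, div_eq_mul_inv]
  line_p i := by fin_cases i <;> simp [dotProduct, Fin.sum_univ_four]
  line_q i := by fin_cases i <;> simp [dotProduct, Fin.sum_univ_four, div_eq_mul_inv, h3]
  quad := (X 1 + X 2 + X 3) ^ 2 + MvPolynomial.C R.r * ((X 1 + X 2 + X 3) * X 0) + MvPolynomial.C (a + R.r ^ 2) * (X 0 * X 0)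
  quad_isHomogeneous := by
    have h1 : (X 1 + X 2 + X 3 : MvPolynomial (Fin 4) k).IsHomogeneous 1 :=
      ((isHomogeneous_X k 1).add (isHomogeneous_X k 2)).add (isHomogeneous_X k 3)
    have h0 (c : k) {p : MvPolynomial (Fin 4) k} (hp : p.IsHomogeneous 2) :
        (MvPolynomial.C c * p).IsHomogeneous 2 := by simpa using (isHomogeneous_C (Fin 4) c).mul hp
    exact ((h1.pow 2).add (h0 _ (h1.mul (isHomogeneous_X k 0)))).add
      (h0 _ ((isHomogeneous_X k 0).mul (isHomogeneous_X k 0)))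
  form_eq := by
    have e := congrArg (MvPolynomial.C (σ := Fin 4)) R.eval_r
    simp only [map_add, map_mul, map_zero, map_sub, map_ofNat, map_pow] at e
    rw [CubicSurface.form_eq]
    simp [lin, Fin.sum_univ_four, map_ofNat (MvPolynomial.C (R := k) (σ := Fin 4))]
    linear_combination X 0 ^ 3 * e

open MvPolynomial in
/-- The plane `x₃ - r x₀ = t (x₁ + x₂)`, with given coefficients of its residual conic. -/
def planeOfCoeffs {i : Fin 3} {m l : k} (e1 : 3 / 4 * m ^ 2 + 1 / 4 + R.t i ^ 3 = 0)
    (e2 : 2 * (3 / 4) * m * l + 3 * R.r * R.t i ^ 2 = 0)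
    (e3 : 3 / 4 * l ^ 2 + a + R.t i * (a + 3 * R.r ^ 2) = 0) : TritangentPlane a b n :=
  { plane := ![-R.r, -R.t i, -R.t i, 1]
    line := ![![0, 3 / 4, 3 / 4, 0], ![-l, 1 - m, -1 - m, 0], ![l, 1 + m, -1 + m, 0]]
    p _ := ![0, 0, 0, 1]
    q := ![![0, 4 / 3, 0, 4 / 3 * R.t i], ![0, 1 / 2, -1 / 2, 0], ![0, 1 / 2, -1 / 2, 0]]
    plane_p i := by simp [dotProduct, Fin.sum_univ_four]
    plane_q i := by fin_cases i <;> simp [dotProduct, Fin.sum_univ_four] <;> ring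
    line_p i := by fin_cases i <;> simp [dotProduct, Fin.sum_univ_four]
    line_q i := by
      have h4 : (4 : k) ≠ 0 := by
        have := mul_ne_zero h2 h2
        norm_num at this
        exact this
      fin_cases i <;> simp [dotProduct, Fin.sum_univ_four] <;> field_simp <;> ring
    quad := X 3 * X 3 + X 3 * (MvPolynomial.C (R.t i) * (X 1 + X 2) + MvPolynomial.C R.r * X 0) +
      (MvPolynomial.C (R.t i) * (X 1 + X 2) + MvPolynomial.C R.r * X 0) ^ 2 + MvPolynomial.C a * (X 0 * X 0)
    quad_isHomogeneous := by
      have h0 (c : k) {n} {p : MvPolynomial (Fin 4) k} (hp : p.IsHomogeneous n) :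
        (MvPolynomial.C c * p).IsHomogeneous n := by simpa using (isHomogeneous_C (Fin 4) c).mul hp
      have h1 : (MvPolynomial.C (R.t i) * (X 1 + X 2) + MvPolynomial.C R.r * X 0 : MvPolynomial (Fin 4) k).IsHomogeneous 1 :=
        (h0 _ ((isHomogeneous_X k 1).add (isHomogeneous_X k 2))).add (h0 _ (isHomogeneous_X k 0))
      exact ((((isHomogeneous_X k 3).mul (isHomogeneous_X k 3)).add
        ((isHomogeneous_X k 3).mul h1)).add (h1.pow 2)).add
          (h0 _ ((isHomogeneous_X k 0).mul (isHomogeneous_X k 0)))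
    form_eq := by
      have h4 : (4 : k) ≠ 0 := by
        have := mul_ne_zero h2 h2
        norm_num at this
        exact this
      have e4 : 4 * (3 / 4 : k) = 3 := by field_simp
      have e5 : 1 / 4 = 1 - (3 / 4 : k) := by field_simp; norm_num
      rw [e5] at e1
      have e := R.eval_r
      generalize (3 / 4 : k) = γ at *
      apply_fun (MvPolynomial.C (σ := Fin 4)) at e e1 e2 e3 e4
      simp only [map_add, map_mul, map_zero, map_sub, map_ofNat, map_pow, map_one] at e e1 e2 e3 e4
      rw [CubicSurface.form_eq]
      simp [lin, Fin.sum_univ_four, map_ofNat (MvPolynomial.C (R := k) (σ := Fin 4))]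
      linear_combination X 0 ^ 3 * e + (X 1 + X 2) ^ 3 * e1 + (X 1 + X 2) ^ 2 * X 0 * e2 +
        (X 1 + X 2) * X 0 ^ 2 * e3 + (X 1 + X 2) * X 1 * X 2 * e4 }

/-- The planes `x₃ - r x₀ = t (x₁ + x₂)`. -/
def planeT (i : Fin 3) : TritangentPlane a b n :=
  R.planeOfCoeffs h2 h3 (R.quadric_coeffs h2 h3 i).choose_spec.choose_spec.1
    (R.quadric_coeffs h2 h3 i).choose_spec.choose_spec.2.1
    (R.quadric_coeffs h2 h3 i).choose_spec.choose_spec.2.2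

theorem planeT_plane (i : Fin 3) :
    (R.planeT h2 h3 i).plane = ![-R.r, -R.t i, -R.t i, 1] := rfl

end Roots

end CubicSurface

/-! ### Complements whose coordinate ring is a unique factorization domain -/

section

variable {P F : Type*} [CommRing P] [Field F]

/-- The fractions of elements in the image of a homomorphism, with denominators that are invertible
in a given subring. -/
def unitFractions (ev : P →+* F) (B : Subring F) : Subring F where
  carrier := {z | ∃ f s, ev s ≠ 0 ∧ (ev s)⁻¹ ∈ B ∧ z = ev f / ev s}
  one_mem' := ⟨1, 1, by simp [B.one_mem]⟩
  zero_mem' := ⟨0, 1, by simp [B.one_mem]⟩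
  mul_mem' := by
    rintro _ _ ⟨f, s, h0, h, rfl⟩ ⟨f', s', h0', h', rfl⟩
    refine ⟨f * f', s * s', ?_⟩
    rw [map_mul, map_mul, mul_inv]
    exact ⟨mul_ne_zero h0 h0', B.mul_mem h h', by rw [div_mul_div_comm]⟩
  add_mem' := by
    rintro _ _ ⟨f, s, h0, h, rfl⟩ ⟨f', s', h0', h', rfl⟩
    refine ⟨f * s' + s * f', s * s', ?_⟩
    rw [map_mul, mul_inv, map_add, map_mul, map_mul]
    exact ⟨mul_ne_zero h0 h0', B.mul_mem h h', div_add_div _ _ h0 h0'⟩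
  neg_mem' := by
    rintro _ ⟨f, s, h0, h, rfl⟩
    exact ⟨-f, s, h0, h, by rw [map_neg, neg_div]⟩

variable {ev : P →+* F} {B : Subring F}

theorem map_mem_unitFractions (f : P) : ev f ∈ unitFractions ev B :=
  ⟨f, 1, by simp [B.one_mem]⟩

theorem inv_map_mem_unitFractions {f : P} (h0 : ev f ≠ 0) (h : (ev f)⁻¹ ∈ B) :
    (ev f)⁻¹ ∈ unitFractions ev B :=
  ⟨1, f, h0, h, by simp⟩

theorem uniqueFactorizationMonoid_of_le_unitFractions [IsDomain P] [UniqueFactorizationMonoid P]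
    (hinj : Function.Injective ev) (hev : ∀ f, ev f ∈ B) (h : B ≤ unitFractions ev B) :
    UniqueFactorizationMonoid B := by
  let ψ : P →+* B := ev.codRestrict B hev
  let := ψ.toAlgebra
  have hψ : Function.Injective ψ := fun x y hxy ↦ hinj (congrArg Subtype.val hxy)
  have : IsLocalization ((IsUnit.submonoid B).comap ψ) B := by
    refine ⟨fun y ↦ y.2, fun z ↦ ?_, fun {x y} hxy ↦ ⟨1, by rw [hψ hxy]⟩⟩
    obtain ⟨f, s, h0, hs, e⟩ := h z.2
    refine ⟨(f, ⟨s, IsUnit.of_mul_eq_one ⟨_, hs⟩ (Subtype.ext (mul_inv_cancel₀ h0))⟩),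
      Subtype.ext ?_⟩
    change (z : F) * ev s = ev f
    rw [e, div_mul_cancel₀ _ h0]
  exact UniqueFactorizationMonoid.of_isLocalization ((IsUnit.submonoid B).comap ψ) B

end

namespace ProjModel

variable {E A : Type u} [Field E] [CommRing A] [IsDomain A] [Algebra E A] {𝒜 : ℕ → Submodule E A}
  [GradedAlgebra 𝒜] {H : A}

variable (𝒜) in
/-- The functions on a basic open set as elements of the field of fractions. -/
def awayToFrac (hH0 : H ≠ 0) : HomogeneousLocalization.Away 𝒜 H →+* FractionRing A :=
  (IsLocalization.Away.lift H (g := algebraMap A (FractionRing A))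
    (algebraMap_ne_zero hH0).isUnit).comp
      (algebraMap (HomogeneousLocalization.Away 𝒜 H) (Localization.Away H))

theorem awayToFrac_mk {d : ℕ} (hH : H ∈ 𝒜 d) (hH0 : H ≠ 0) (n : ℕ) {a : A} (ha : a ∈ 𝒜 (n • d)) :
    awayToFrac 𝒜 hH0 (HomogeneousLocalization.Away.mk 𝒜 hH n a ha) =
      algebraMap A (FractionRing A) a / algebraMap A (FractionRing A) H ^ n := by
  rw [eq_div_iff (pow_ne_zero _ (algebraMap_ne_zero hH0))]
  have h1 : algebraMap (HomogeneousLocalization.Away 𝒜 H) (Localization.Away H)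
      (HomogeneousLocalization.Away.mk 𝒜 hH n a ha) * algebraMap A _ H ^ n = algebraMap A _ a := by
    rw [HomogeneousLocalization.algebraMap_apply, HomogeneousLocalization.Away.val_mk,
      ← map_pow, Localization.mk_eq_mk']
    exact IsLocalization.mk'_spec (Localization.Away H) a (⟨H ^ n, n, rfl⟩ : Submonoid.powers H)
  have h2 := congrArg (IsLocalization.Away.lift H (g := algebraMap A (FractionRing A))
    (algebraMap_ne_zero hH0).isUnit) h1
  rw [map_mul, map_pow, IsLocalization.Away.lift_eq, IsLocalization.Away.lift_eq] at h2
  exact h2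

theorem awayToFrac_injective {d : ℕ} (hH : H ∈ 𝒜 d) (hH0 : H ≠ 0) :
    Function.Injective (awayToFrac 𝒜 hH0) := by
  rw [injective_iff_map_eq_zero]
  intro c hc
  obtain ⟨n, a, ha, rfl⟩ := HomogeneousLocalization.Away.mk_surjective 𝒜 hH c
  rw [awayToFrac_mk, div_eq_zero_iff] at hc
  have ha0 := hc.resolve_right (pow_ne_zero _ (algebraMap_ne_zero hH0))
  rw [FaithfulSMul.algebraMap_eq_zero_iff] at ha0
  exact HomogeneousLocalization.mk_eq_zero_of_num _ (Subtype.ext ha0)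

theorem mem_range_awayToFrac {d : ℕ} (hH : H ∈ 𝒜 d) (hH0 : H ≠ 0) {z : FractionRing A} :
    z ∈ (awayToFrac 𝒜 hH0).range ↔ ∃ n, ∃ a ∈ 𝒜 (n • d),
      z = algebraMap A (FractionRing A) a / algebraMap A (FractionRing A) H ^ n := by
  constructor
  · rintro ⟨c, rfl⟩
    obtain ⟨n, a, ha, rfl⟩ := HomogeneousLocalization.Away.mk_surjective 𝒜 hH c
    exact ⟨n, a, ha, awayToFrac_mk hH hH0 n ha⟩
  · rintro ⟨n, a, ha, rfl⟩
    exact ⟨_, awayToFrac_mk hH hH0 n ha⟩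

theorem exists_unitAt_of_uniqueFactorizationMonoid {d : ℕ} (hd : 0 < d) (hH : H ∈ 𝒜 d)
    (hH0 : H ≠ 0) [UniqueFactorizationMonoid (awayToFrac 𝒜 hH0).range]
    {φ : Proj 𝒜 → FractionRing A} (hφ : (model 𝒜).IsCartier φ) :
    ∃ f ≠ 0, ∀ x : Proj 𝒜, H ∉ x.asHomogeneousIdeal → (model 𝒜).UnitAt x (f * φ x) := by
  let e : HomogeneousLocalization.Away 𝒜 H ≃+* (awayToFrac 𝒜 hH0).range :=
    RingEquiv.ofBijective (awayToFrac 𝒜 hH0).rangeRestrict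
      ⟨fun x y h ↦ awayToFrac_injective hH hH0 (congrArg Subtype.val h),
        (awayToFrac 𝒜 hH0).rangeRestrict_surjective⟩
  have : IsDomain (HomogeneousLocalization.Away 𝒜 H) := e.toMulEquiv.isDomain _
  have : UniqueFactorizationMonoid (HomogeneousLocalization.Away 𝒜 H) :=
    e.symm.toMulEquiv.uniqueFactorizationMonoid ‹_›
  let ι := Proj.awayι 𝒜 H hH hd
  have hι (x : Proj 𝒜) (hx : H ∉ x.asHomogeneousIdeal) : ∃ y, ι y = x := by
    have h : x ∈ ι.opensRange := by
      rw [Proj.opensRange_awayι]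
      exact hx
    exact h
  have hne : ¬ HomogeneousIdeal.irrelevant 𝒜 ≤ ⊥ := fun h ↦ hH0 (by
    have := h (HomogeneousIdeal.mem_irrelevant_of_mem 𝒜 hd hH)
    exact this)
  let w : Proj 𝒜 := generic 𝒜 hne
  obtain ⟨w', hw'⟩ := hι w fun h ↦ hH0 h
  have hreg (x : Proj 𝒜) : φ x / φ w ∈ (model 𝒜).reg w := by
    obtain ⟨-, U, hU, hu⟩ := hφ x
    exact (hu w (generic_mem 𝒜 hne hU)).mem
  have hφ' : ((model 𝒜).restrict ι).IsCartier fun y ↦ φ (ι y) * (φ w)⁻¹ :=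
    ((model 𝒜).compatible_restrict ι).isCartier
      (hφ.mul ((model 𝒜).isCartier_const (inv_ne_zero (hφ w).1)))
  obtain ⟨f, hf⟩ := ((model 𝒜).restrict ι).exists_unitAt_of_isCartier hφ' fun y ↦ ⟨w', by
    rw [FieldModel.reg_restrict, hw']
    exact hreg _⟩
  have hf' (x : Proj 𝒜) (hx : H ∉ x.asHomogeneousIdeal) :
      (model 𝒜).UnitAt x (f * (φ w)⁻¹ * φ x) := by
    obtain ⟨y, rfl⟩ := hι x hx
    rw [mul_assoc, mul_comm (φ w)⁻¹]
    exact (FieldModel.unitAt_restrict _ _).mp (hf y)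
  refine ⟨_, fun h ↦ ?_, hf'⟩
  have h1 := (hf' w fun h ↦ hH0 h).ne_zero
  rw [h] at h1
  exact h1 (zero_mul _)

end ProjModel

/-! ### The complement of the tritangent planes -/

namespace CubicSurface

section

variable {S : Type*} [CommRing S]

/-- The coefficient of `X²Z` in the equation of the cubic surface, in terms of the linear forms
`X = x₁ + x₂`, `tX = x₃ - r x₀`, `Z = x₁ + x₃` and `uZ = x₂ - s x₀`. -/
def coeffP (r s t u : S) : S :=
  (u + 1) * (t * (r - s) * (-t * (r + 2 * s) - 2 * (2 * r + s)) +
    2 * (r ^ 2 + r * s + s ^ 2) * (1 + t)) - 3 * (s + r * u) * (r + s + 2 * s * t)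

/-- The coefficient of `XZ²` in the equation of the cubic surface, in terms of the linear forms
`X = x₁ + x₂`, `tX = x₃ - r x₀`, `Z = x₁ + x₃` and `uZ = x₂ - s x₀`. -/
def coeffQ (r s t u : S) : S :=
  3 * (s + r * u) ^ 2 + (u + 1) ^ 2 * (t * (r - s) * (2 * r + s) - (r ^ 2 + r * s + s ^ 2))

theorem sub_pow_mul_form {r s t u X Z x₀ : S}
    (h : (r - s) * x₀ = (u + 1) * Z - (1 + t) * X) :
    (r - s) ^ 3 * ((Z - (t * X + r * x₀)) ^ 3 + (X - (Z - (t * X + r * x₀))) ^ 3 +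
      (t * X + r * x₀) ^ 3 + (-(r ^ 2 + r * s + s ^ 2)) * x₀ ^ 2 * (Z - (t * X + r * x₀) +
        (X - (Z - (t * X + r * x₀))) + (t * X + r * x₀)) + r * s * (r + s) * x₀ ^ 3) =
      (r - s) * (X * Z * (X * coeffP r s t u + Z * coeffQ r s t u)) := by
  trans ((r - s) * Z - ((r - s) * t * X + r * ((r - s) * x₀))) ^ 3 +
    ((r - s) * X - ((r - s) * Z - ((r - s) * t * X + r * ((r - s) * x₀)))) ^ 3 +
    ((r - s) * t * X + r * ((r - s) * x₀)) ^ 3 + (-(r ^ 2 + r * s + s ^ 2)) * ((r - s) * x₀) ^ 2 *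
      ((r - s) * X + (r - s) * t * X + r * ((r - s) * x₀)) + r * s * (r + s) * ((r - s) * x₀) ^ 3
  · ring
  · rw [h, coeffP, coeffQ]
    ring

theorem exists_combination (r s t u : S) : ∃ α β, α * coeffQ r s t u + β * coeffP r s t u =
    -3 * (r - s) ^ 4 * ((1 + t) * ((4 * -(r ^ 2 + r * s + s ^ 2) + 3 * r ^ 2) * t ^ 3 -
      3 * r ^ 2 * t ^ 2 + 3 * r ^ 2 * t - (r ^ 2 + r * s + s ^ 2))) := by
  let c := t * (r - s) * (-t * (r + 2 * s) - 2 * (2 * r + s)) +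
    2 * (r ^ 2 + r * s + s ^ 2) * (1 + t)
  let p₁ := c - 3 * r * (r + s + 2 * s * t)
  let p₀ := c - 3 * s * (r + s + 2 * s * t)
  let d := t * (r - s) * (2 * r + s) - (r ^ 2 + r * s + s ^ 2)
  refine ⟨p₁ ^ 2, -((6 * r * s + 2 * d) * p₁ + (3 * r ^ 2 + d) * (p₁ * u - p₀)), ?_⟩
  simp only [coeffP, coeffQ, p₁, p₀, c, d]
  ring

end

namespace Roots

variable {k : Type u} [Field k] {a b n : k} (R : Roots a b n)

theorem a_eq : a = -(R.r ^ 2 + R.r * R.r₂ + R.r₂ ^ 2) := by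
  linear_combination -R.mul_add_eq + (R.r + R.r₂) * R.add_eq

theorem sub_eq : 3 * b - n = R.r * R.r₂ * (R.r + R.r₂) := by
  linear_combination R.mul_eq - R.r * R.r₂ * R.add_eq

theorem mem_unitFractions {F : Type u} [Field F] (R : Roots a b n) (κ : k →+* F) (h3 : (3 : k) ≠ 0)
    {B : Subring F} (hκ : ∀ c, κ c ∈ B) {x₀ x₁ x₂ x₃ : F}
    (hG : x₁ ^ 3 + x₂ ^ 3 + x₃ ^ 3 + κ a * x₀ ^ 2 * (x₁ + x₂ + x₃) + κ (3 * b - n) * x₀ ^ 3 = 0)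
    (hX : x₁ + x₂ ≠ 0) (hZ : x₁ + x₃ ≠ 0)
    (hXY : x₁ + x₂ + (x₃ - κ R.r * x₀) ≠ 0)
    (hT : ∀ i, x₃ - κ R.r * x₀ - κ (R.t i) * (x₁ + x₂) ≠ 0)
    (hY' : (x₃ - κ R.r * x₀) / (x₁ + x₂) ∈ B) (hW' : (x₂ - κ R.r₂ * x₀) / (x₁ + x₃) ∈ B)
    (hZ' : (x₁ + x₃) / (x₁ + x₂) ∈ B) (hX' : (x₁ + x₂) / (x₁ + x₃) ∈ B)
    (hXY' : (x₁ + x₂) / (x₁ + x₂ + (x₃ - κ R.r * x₀)) ∈ B)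
    (hT' : ∀ i, (x₁ + x₂) / (x₃ - κ R.r * x₀ - κ (R.t i) * (x₁ + x₂)) ∈ B)
    {ev : MvPolynomial (Fin 2) k →+* F} (hC : ∀ c, ev (.C c) = κ c)
    (h0 : ev (.X 0) = (x₃ - κ R.r * x₀) / (x₁ + x₂))
    (h1 : ev (.X 1) = (x₂ - κ R.r₂ * x₀) / (x₁ + x₃)) :
    coeffP (MvPolynomial.C R.r) (.C R.r₂) (.X 0) (.X (1 : Fin 2)) ≠ 0 ∧
    coeffQ (MvPolynomial.C R.r) (.C R.r₂) (.X 0) (.X (1 : Fin 2)) ≠ 0 ∧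
    (x₁ + x₂) / (x₁ + x₃) ∈ unitFractions ev B ∧
    (x₁ + x₂) / (x₁ + x₂ + (x₃ - κ R.r * x₀)) ∈ unitFractions ev B ∧
    (∀ i, (x₁ + x₂) / (x₃ - κ R.r * x₀ - κ (R.t i) * (x₁ + x₂)) ∈ unitFractions ev B) ∧
    x₀ / (x₁ + x₂) ∈ unitFractions ev B ∧ x₁ / (x₁ + x₂) ∈ unitFractions ev B ∧
    x₂ / (x₁ + x₂) ∈ unitFractions ev B ∧ x₃ / (x₁ + x₂) ∈ unitFractions ev B := by
  let p := coeffP (MvPolynomial.C R.r) (.C R.r₂) (.X 0) (.X (1 : Fin 2))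
  let q := coeffQ (MvPolynomial.C R.r) (.C R.r₂) (.X 0) (.X (1 : Fin 2))
  change p ≠ 0 ∧ q ≠ 0 ∧ _
  have ha := congrArg κ R.a_eq
  have hc := congrArg κ R.sub_eq
  have hr : κ R.r - κ R.r₂ ≠ 0 := by
    rw [← map_sub]
    exact (map_ne_zero κ).mpr (sub_ne_zero.mpr R.ne)
  simp only [map_neg, map_add, map_mul, map_pow] at ha hc
  have hp : ev p = coeffP (κ R.r) (κ R.r₂) (ev (.X 0)) (ev (.X 1)) := by
    simp only [p, coeffP, map_add, map_sub, map_mul, map_pow, map_neg, hC, map_ofNat, map_one]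
  have hq : ev q = coeffQ (κ R.r) (κ R.r₂) (ev (.X 0)) (ev (.X 1)) := by
    simp only [q, coeffQ, map_add, map_sub, map_mul, map_pow, hC, map_ofNat, map_one]
  obtain ⟨α, β, hαβ⟩ : ∃ α β, α * q + β * p = _ :=
    exists_combination (MvPolynomial.C R.r) (.C R.r₂) (.X 0) (.X (1 : Fin 2))
  set S := unitFractions ev B
  have hevB (f) : ev f ∈ B := by
    induction f using MvPolynomial.induction_on with
    | C c => exact hC c ▸ hκ c
    | add f g hf hg => exact map_add ev f g ▸ B.add_mem hf hg
    | mul_X f i hf =>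
      rw [map_mul]
      refine B.mul_mem hf ?_
      fin_cases i
      · exact h0 ▸ hY'
      · exact h1 ▸ hW'
  have hκS (c) : κ c ∈ S := hC c ▸ map_mem_unitFractions _
  have hκB (c) : (κ c)⁻¹ ∈ B := map_inv₀ κ c ▸ hκ c⁻¹
  -- coordinates
  have eY : ev (.X 0) * (x₁ + x₂) = x₃ - κ R.r * x₀ := by rw [h0, div_mul_cancel₀ _ hX]
  have eW : ev (.X 1) * (x₁ + x₃) = x₂ - κ R.r₂ * x₀ := by rw [h1, div_mul_cancel₀ _ hZ]
  have e0 : (κ R.r - κ R.r₂) * x₀ = (ev (.X 1) + 1) * (x₁ + x₃) -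
      (1 + ev (.X 0)) * (x₁ + x₂) := by linear_combination eY - eW
  have e3 : x₃ = ev (.X 0) * (x₁ + x₂) + κ R.r * x₀ := by linear_combination -eY
  have e4 := sub_pow_mul_form e0
  rw [← e3, add_sub_cancel_right, add_sub_cancel_left, ← hp, ← hq] at e4
  rw [← ha, ← hc, hG, mul_zero] at e4
  have e5 : (x₁ + x₂) * ev p + (x₁ + x₃) * ev q = 0 := by
    have := (mul_eq_zero.mp e4.symm).resolve_left hr
    exact (mul_eq_zero.mp this).resolve_left (mul_ne_zero hX hZ)
  have e6 : ev p = -((x₁ + x₃) / (x₁ + x₂) * ev q) := by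
    field_simp
    linear_combination e5
  -- the resultant
  have hXY₁ : (x₁ + x₂) / (x₁ + x₂ + (x₃ - κ R.r * x₀)) = (ev (1 + .X 0))⁻¹ := by
    rw [map_add, map_one, h0]
    field_simp
  have hXYne : ev (1 + .X 0) ≠ 0 := by
    rw [map_add, map_one, h0]
    field_simp
    exact div_ne_zero hXY hX
  have hT₁ (i) : (x₁ + x₂) / (x₃ - κ R.r * x₀ - κ (R.t i) * (x₁ + x₂)) =
      (ev (.X 0 - .C (R.t i)))⁻¹ := by
    rw [map_sub, hC, h0]
    field_simp
  have hTne (i) : ev (.X 0 - .C (R.t i)) ≠ 0 := by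
    have h := hT i
    rw [map_sub, hC, h0]
    field_simp
    exact div_ne_zero (by rwa [mul_comm (x₁ + x₂)]) hX
  let ρ : k := -3 * (R.r - R.r₂) ^ 4 * (4 * a + 3 * R.r ^ 2)
  have hρ : κ ρ ≠ 0 := (map_ne_zero κ).mpr (mul_ne_zero (mul_ne_zero (neg_ne_zero.mpr h3)
    (pow_ne_zero _ (sub_ne_zero.mpr R.ne))) R.ne_zero)
  have e7 : ev q * (ev α - ev β * ((x₁ + x₃) / (x₁ + x₂))) = κ ρ * (ev (1 + .X 0) *
      (ev (.X 0 - .C (R.t 0)) * ev (.X 0 - .C (R.t 1)) * ev (.X 0 - .C (R.t 2)))) := by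
    have h := congrArg ev hαβ
    have h' := (R.map κ).eval_eq (ev (.X 0))
    simp only [map_add, map_sub, map_mul, map_pow, map_neg, hC, map_ofNat, map_one, Roots.map, ρ]
      at h h' ⊢
    rw [ha] at h' ⊢
    linear_combination h - ev β * e6 - 3 * (κ R.r - κ R.r₂) ^ 4 * (1 + ev (.X 0)) * h'
  have hne : κ ρ * (ev (1 + .X 0) *
      (ev (.X 0 - .C (R.t 0)) * ev (.X 0 - .C (R.t 1)) * ev (.X 0 - .C (R.t 2)))) ≠ 0 :=
    mul_ne_zero hρ (mul_ne_zero hXYne (mul_ne_zero (mul_ne_zero (hTne 0) (hTne 1)) (hTne 2)))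
  have hXYB : (ev (1 + .X 0))⁻¹ ∈ B := hXY₁ ▸ hXY'
  have hTB (i) : (ev (.X 0 - .C (R.t i)))⁻¹ ∈ B := hT₁ i ▸ hT' i
  have hq0 : ev q ≠ 0 := left_ne_zero_of_mul (e7 ▸ hne)
  have hqB : (ev q)⁻¹ ∈ B := by
    have h : (ev q)⁻¹ = (ev α - ev β * ((x₁ + x₃) / (x₁ + x₂))) * (κ ρ * (ev (1 + .X 0) *
        (ev (.X 0 - .C (R.t 0)) * ev (.X 0 - .C (R.t 1)) * ev (.X 0 - .C (R.t 2)))))⁻¹ := by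
      rw [← e7]
      have := right_ne_zero_of_mul (e7 ▸ hne)
      rw [mul_inv, mul_left_comm, mul_inv_cancel₀ this, mul_one]
    rw [h, mul_inv, mul_inv, mul_inv, mul_inv]
    exact B.mul_mem (B.sub_mem (hevB _) (B.mul_mem (hevB _) hZ')) (B.mul_mem (hκB _)
      (B.mul_mem hXYB (B.mul_mem (B.mul_mem (hTB 0) (hTB 1)) (hTB 2))))
  have hp0 : ev p ≠ 0 := by
    rw [e6]
    exact neg_ne_zero.mpr (mul_ne_zero (div_ne_zero hZ hX) hq0)
  have hpB : (ev p)⁻¹ ∈ B := by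
    rw [e6, inv_neg, mul_inv, inv_div]
    exact B.neg_mem (B.mul_mem hX' hqB)
  have hm : (x₁ + x₃) / (x₁ + x₂) ∈ S := by
    have h : (x₁ + x₃) / (x₁ + x₂) = -(ev p * (ev q)⁻¹) := by
      rw [e6]
      field_simp
    rw [h]
    exact S.neg_mem (S.mul_mem (map_mem_unitFractions _) (inv_map_mem_unitFractions hq0 hqB))
  have hm' : (x₁ + x₂) / (x₁ + x₃) ∈ S := by
    have h : (x₁ + x₂) / (x₁ + x₃) = -(ev q * (ev p)⁻¹) := by
      rw [e6]
      field_simp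
    rw [h]
    exact S.neg_mem (S.mul_mem (map_mem_unitFractions _) (inv_map_mem_unitFractions hp0 hpB))
  have hevS (f) : ev f ∈ S := map_mem_unitFractions f
  have h₀ : x₀ / (x₁ + x₂) ∈ S := by
    have h : x₀ / (x₁ + x₂) = κ (R.r - R.r₂)⁻¹ * ((ev (.X 1) + 1) * ((x₁ + x₃) / (x₁ + x₂)) -
        (1 + ev (.X 0))) := by
      rw [map_inv₀, map_sub]
      field_simp
      linear_combination e0
    rw [h]
    exact S.mul_mem (hκS _) (S.sub_mem (S.mul_mem (S.add_mem (hevS _) S.one_mem) hm)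
      (S.add_mem S.one_mem (hevS _)))
  have h₃ : x₃ / (x₁ + x₂) ∈ S := by
    have h : x₃ / (x₁ + x₂) = ev (.X 0) + κ R.r * (x₀ / (x₁ + x₂)) := by
      field_simp
      linear_combination -eY
    rw [h]
    exact S.add_mem (hevS _) (S.mul_mem (hκS _) h₀)
  have h₁ : x₁ / (x₁ + x₂) ∈ S := by
    have h : x₁ / (x₁ + x₂) = (x₁ + x₃) / (x₁ + x₂) - x₃ / (x₁ + x₂) := by
      field_simp
      ring
    rw [h]
    exact S.sub_mem hm h₃
  have h₂ : x₂ / (x₁ + x₂) ∈ S := by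
    have h : x₂ / (x₁ + x₂) = 1 - x₁ / (x₁ + x₂) := by
      field_simp
      ring
    rw [h]
    exact S.sub_mem S.one_mem h₁
  refine ⟨fun h ↦ hp0 (h ▸ map_zero ev), fun h ↦ hq0 (h ▸ map_zero ev), hm', ?_, fun i ↦ ?_,
    h₀, h₁, h₂, h₃⟩
  · rw [hXY₁]
    exact inv_map_mem_unitFractions hXYne hXYB
  · rw [hT₁]
    exact inv_map_mem_unitFractions (hTne i) (hTB i)

end Roots

end CubicSurface

theorem MvPolynomial.eval₂Hom_div_injective {σ k A F : Type*} [Field k] [CommRing A] [Field F]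
    {ι : A →+* F} (hι : Function.Injective ι) {κ : k →+* A} {θ : A →+* MvPolynomial σ k}
    (hθ : ∀ c, θ (κ c) = .C c) {num den : σ → A} (hnum : ∀ i, θ (num i) = .X i * θ (den i))
    (hden : ∀ i, θ (den i) ≠ 0) :
    Function.Injective (MvPolynomial.eval₂Hom (ι.comp κ) fun i ↦ ι (num i) / ι (den i)) := by
  have key (f : MvPolynomial σ k) : ∃ h d, θ d ≠ 0 ∧
      ι d * MvPolynomial.eval₂Hom (ι.comp κ) (fun i ↦ ι (num i) / ι (den i)) f = ι h ∧
      θ h = θ d * f := by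
    induction f using MvPolynomial.induction_on with
    | C c =>
      refine ⟨κ c, 1, by simp, ?_, ?_⟩
      · rw [MvPolynomial.eval₂Hom_C, map_one, one_mul]
        rfl
      · rw [hθ, map_one, one_mul]
    | add f g hf hg =>
      obtain ⟨h, d, hd, e, e'⟩ := hf
      obtain ⟨h₂, d₂, hd₂, e₂, e₂'⟩ := hg
      refine ⟨h * d₂ + d * h₂, d * d₂, by rw [map_mul]; exact mul_ne_zero hd hd₂, ?_, ?_⟩
      · rw [map_add, map_add, map_mul, map_mul, map_mul, ← e, ← e₂]
        ring
      · rw [map_add, map_mul, map_mul, map_mul, e', e₂']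
        ring
    | mul_X f i hf =>
      obtain ⟨h, d, hd, e, e'⟩ := hf
      refine ⟨h * num i, d * den i, by rw [map_mul]; exact mul_ne_zero hd (hden i), ?_, ?_⟩
      · have h0 : ι (den i) ≠ 0 := (map_ne_zero_iff _ hι).mpr fun h ↦ hden i (by rw [h, map_zero])
        rw [map_mul, map_mul, map_mul, ← e, MvPolynomial.eval₂Hom_X']
        field_simp
      · rw [map_mul, map_mul, e', hnum]
        ring
  rw [injective_iff_map_eq_zero]
  intro f hf
  obtain ⟨h, d, hd, e, e'⟩ := key f
  rw [hf, mul_zero, eq_comm, map_eq_zero_iff _ hι] at e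
  rw [e, map_zero, eq_comm] at e'
  exact (mul_eq_zero.mp e').resolve_left hd

theorem ProjModel.div_mem_range_awayToFrac {E A : Type u} [Field E] [CommRing A] [IsDomain A]
    [Algebra E A] {𝒜 : ℕ → Submodule E A} [GradedAlgebra 𝒜] {H D L : A} {m : ℕ}
    (hH : H ∈ 𝒜 (1 + m)) (hH0 : H ≠ 0) (hD : D ∈ 𝒜 1) (h : D ∣ H) (hL : L ∈ 𝒜 1) :
    algebraMap A (FractionRing A) L / algebraMap A (FractionRing A) D ∈
      (awayToFrac 𝒜 hH0).range := by
  obtain ⟨D', rfl⟩ := h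
  have h0 := left_ne_zero_of_mul hH0
  refine (mem_range_awayToFrac hH hH0).mpr ⟨1, L * D', ?_, ?_⟩
  · rw [one_nsmul]
    exact SetLike.mul_mem_graded hL (mem_of_mul_mem hD h0 hH)
  · have h1 := algebraMap_ne_zero h0
    have h2 := algebraMap_ne_zero (right_ne_zero_of_mul hH0)
    rw [map_mul, map_mul]
    field_simp

namespace CubicSurface

variable {k : Type u} [Field k] (a b n : k)

theorem linMk_eq (v : Fin 4 → k) : linMk a b n v =
    ∑ i, algebraMap k (CoordRing a b n) (v i) * coord a b n i := by
  change Ideal.Quotient.mk _ _ = _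
  rw [lin, map_sum]
  refine Finset.sum_congr rfl fun i _ ↦ ?_
  rw [map_mul]
  rfl

theorem coord_relation : coord a b n 1 ^ 3 + coord a b n 2 ^ 3 + coord a b n 3 ^ 3 +
    algebraMap k _ a * coord a b n 0 ^ 2 * (coord a b n 1 + coord a b n 2 + coord a b n 3) +
    algebraMap k _ (3 * b - n) * coord a b n 0 ^ 3 = 0 := by
  let π : MvPolynomial (Fin 4) k →+* CoordRing a b n := Ideal.Quotient.mk _
  have h : π (form a b n) = 0 :=
    Ideal.Quotient.eq_zero_iff_mem.mpr (Ideal.mem_span_singleton_self _)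
  have h' := (congrArg π (form_eq a b n)).symm.trans h
  simp only [map_add, map_mul, map_pow] at h'
  exact h'

namespace Roots

variable {a b n} (R : Roots a b n)

/-- The equations of the tritangent planes whose complement is considered. -/
def planes : List (Fin 4 → k) :=
  [![0, 1, 1, 0], ![-R.r, 1, 1, 1], ![-R.r, -R.t 0, -R.t 0, 1], ![-R.r, -R.t 1, -R.t 1, 1],
    ![-R.r, -R.t 2, -R.t 2, 1], ![0, 1, 0, 1]]

/-- The product of the equations of the tritangent planes. -/
def planesMk : CoordRing a b n := (R.planes.map (linMk a b n)).prod

theorem planesMk_mem : R.planesMk ∈ gr a b n (1 + 5) := by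
  have h := SetLike.list_prod_map_mem_graded (A := gr a b n) R.planes (fun _ ↦ 1)
    (linMk a b n) fun v _ ↦ linMk_mem _ _ _ _
  exact h

theorem planes_ne_zero {v : Fin 4 → k} (hv : v ∈ R.planes) : linMk a b n v ≠ 0 := by
  suffices h : ∃ z : Fin 4 → k, v ⬝ᵥ z ≠ 0 from linMk_ne_zero _ _ _ h.choose_spec
  simp only [planes, List.mem_cons, List.not_mem_nil, or_false] at hv
  rcases hv with rfl | rfl | rfl | rfl | rfl | rfl
  · exact ⟨![0, 1, 0, 0], by simp [dotProduct, Fin.sum_univ_four]⟩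
  all_goals exact ⟨![0, 0, 0, 1], by simp [dotProduct, Fin.sum_univ_four]⟩

theorem planesMk_ne_zero [IsDomain (CoordRing a b n)] : R.planesMk ≠ 0 := by
  refine List.prod_ne_zero fun h ↦ ?_
  obtain ⟨v, hv, e⟩ := List.mem_map.mp h
  exact R.planes_ne_zero hv e

theorem dvd_planesMk {v : Fin 4 → k} (hv : v ∈ R.planes) : linMk a b n v ∣ R.planesMk :=
  List.dvd_prod (List.mem_map_of_mem hv)

/-- The coordinates of a rational parametrization of the surface. -/
def param : Fin 4 → MvPolynomial (Fin 2) k :=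
  let P := coeffP (MvPolynomial.C R.r) (.C R.r₂) (.X 0) (.X (1 : Fin 2))
  let Q := coeffQ (MvPolynomial.C R.r) (.C R.r₂) (.X 0) (.X (1 : Fin 2))
  let e := MvPolynomial.C (R.r - R.r₂)
  let x₀ := -((.X 1 + 1) * P) - (1 + .X 0) * Q
  let x₃ := .X 0 * (e * Q) + .C R.r * x₀
  ![x₀, -e * P - x₃, e * Q - (-e * P - x₃), x₃]

/-- The parametrization as a ring homomorphism. -/
def paramHom : CoordRing a b n →+* MvPolynomial (Fin 2) k :=
  Ideal.Quotient.lift _ (MvPolynomial.eval₂Hom MvPolynomial.C R.param) fun f hf ↦ by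
    obtain ⟨s, rfl⟩ := Ideal.mem_span_singleton.mp hf
    rw [map_mul]
    refine mul_eq_zero_of_left ?_ _
    rw [form_eq]
    simp only [map_add, map_mul, map_pow, MvPolynomial.eval₂Hom_X', MvPolynomial.eval₂Hom_C]
    let P := coeffP (MvPolynomial.C R.r) (.C R.r₂) (.X 0) (.X (1 : Fin 2))
    let Q := coeffQ (MvPolynomial.C R.r) (.C R.r₂) (.X 0) (.X (1 : Fin 2))
    have h := sub_pow_mul_form (r := MvPolynomial.C R.r) (s := .C R.r₂) (t := .X 0)
      (u := .X (1 : Fin 2)) (x₀ := R.param 0) (X := .C (R.r - R.r₂) * Q)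
      (Z := -.C (R.r - R.r₂) * P) (by
        simp only [param, Matrix.cons_val_zero, map_sub, P, Q]
        ring)
    have ha := congrArg (MvPolynomial.C (σ := Fin 2)) R.a_eq
    have hc := congrArg (MvPolynomial.C (σ := Fin 2)) R.sub_eq
    simp only [map_neg, map_add, map_mul, map_pow] at ha hc
    rw [← ha, ← hc] at h
    have e : (MvPolynomial.C R.r - .C R.r₂ : MvPolynomial (Fin 2) k) ≠ 0 := by
      rw [← map_sub]
      exact (map_ne_zero_iff _ (MvPolynomial.C_injective _ _)).mpr (sub_ne_zero.mpr R.ne)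
    refine (mul_eq_zero.mp (Eq.trans ?_ (h.trans ?_))).resolve_left (pow_ne_zero 3 e)
    · rfl
    · change _ * (_ * (_ * P + _ * Q)) = 0
      ring

theorem paramHom_coord (i : Fin 4) : R.paramHom (coord a b n i) = R.param i :=
  (Ideal.Quotient.lift_mk _ _ _).trans (MvPolynomial.eval₂Hom_X' _ _ _)

theorem paramHom_algebraMap (c : k) : R.paramHom (algebraMap k _ c) = .C c :=
  (Ideal.Quotient.lift_mk _ _ _).trans (MvPolynomial.eval₂Hom_C _ _ _)

theorem paramHom_den_zero : R.paramHom (coord a b n 1 + coord a b n 2) =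
    .C (R.r - R.r₂) * coeffQ (MvPolynomial.C R.r) (.C R.r₂) (.X 0) (.X (1 : Fin 2)) := by
  rw [map_add, paramHom_coord, paramHom_coord]
  change (_ - _) + (_ - (_ - _)) = _
  ring

theorem paramHom_den_one : R.paramHom (coord a b n 1 + coord a b n 3) =
    -.C (R.r - R.r₂) * coeffP (MvPolynomial.C R.r) (.C R.r₂) (.X 0) (.X (1 : Fin 2)) := by
  rw [map_add, paramHom_coord, paramHom_coord]
  change (_ - _) + _ = _
  exact sub_add_cancel _ _

theorem paramHom_num_zero : R.paramHom (coord a b n 3 - algebraMap k _ R.r * coord a b n 0) =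
    .X 0 * R.paramHom (coord a b n 1 + coord a b n 2) := by
  rw [paramHom_den_zero, map_sub, map_mul, paramHom_coord, paramHom_coord, paramHom_algebraMap]
  change (_ + _ * _) - _ = _
  exact add_sub_cancel_right _ _

theorem paramHom_num_one : R.paramHom (coord a b n 2 - algebraMap k _ R.r₂ * coord a b n 0) =
    .X 1 * R.paramHom (coord a b n 1 + coord a b n 3) := by
  rw [paramHom_den_one, map_sub, map_mul, paramHom_coord, paramHom_coord, paramHom_algebraMap]
  simp only [param, Matrix.cons_val, map_sub]
  ring

variable [IsDomain (CoordRing a b n)]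

theorem _root_.CubicSurface.div_pow_mem_of_coord {S : Subring (FractionRing (CoordRing a b n))}
    {l : CoordRing a b n} (hS : ∀ c : k, algebraMap _ _ (algebraMap k (CoordRing a b n) c) ∈ S)
    (hx : ∀ i, algebraMap _ _ (coord a b n i) / algebraMap _ _ l ∈ S) {m : ℕ} {p : CoordRing a b n}
    (hp : p ∈ gr a b n m) : algebraMap _ _ p / algebraMap _ _ l ^ m ∈ S := by
  have hp' := gr_le_span a b n m hp
  clear hp
  induction hp' using Submodule.span_induction with
  | mem p h =>
    obtain ⟨s, hs, rfl⟩ := h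
    have e : algebraMap _ (FractionRing (CoordRing a b n)) (∏ i, coord a b n i ^ s i) /
        algebraMap _ _ l ^ m =
          ∏ i, (algebraMap _ _ (coord a b n i) / algebraMap _ _ l) ^ s i := by
      rw [← (Finset.mem_piAntidiag.mp hs).1]
      simp only [div_pow, Finset.prod_div_distrib, Finset.prod_pow_eq_pow_sum, map_prod, map_pow]
    exact e ▸ S.prod_mem fun i _ ↦ S.pow_mem (hx i) _
  | zero => simp
  | add p q _ _ hp hq =>
    rw [map_add, add_div]
    exact S.add_mem hp hq
  | smul c p _ hp =>
    have e := congrArg (algebraMap _ (FractionRing (CoordRing a b n))) (Algebra.smul_def c p)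
    rw [map_mul] at e
    rw [e, mul_div_assoc]
    exact S.mul_mem (hS c) hp

set_option maxHeartbeats 800000 in
theorem uniqueFactorizationMonoid_range (h3 : (3 : k) ≠ 0) : UniqueFactorizationMonoid
    (ProjModel.awayToFrac (gr a b n) R.planesMk_ne_zero).range := by
  let A := CoordRing a b n
  let ι : A →+* FractionRing A := algebraMap A (FractionRing A)
  have hι : Function.Injective ι := IsFractionRing.injective A (FractionRing A)
  let B := (ProjModel.awayToFrac (gr a b n) R.planesMk_ne_zero).range
  let x := coord a b n
  let num : Fin 2 → A := ![x 3 - algebraMap k A R.r * x 0, x 2 - algebraMap k A R.r₂ * x 0]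
  let den : Fin 2 → A := ![x 1 + x 2, x 1 + x 3]
  let ev := MvPolynomial.eval₂Hom (ι.comp (algebraMap k A)) fun i ↦ ι (num i) / ι (den i)
  have hx (i) : x i ∈ gr a b n 1 := coord_mem a b n i
  have hcx (c : k) (i) : algebraMap k A c * x i ∈ gr a b n 1 := by
    rw [← Algebra.smul_def]
    exact Submodule.smul_mem _ _ (hx i)
  have hconst (c : k) : ι (algebraMap k A c) ∈ B := by
    refine (ProjModel.mem_range_awayToFrac R.planesMk_mem R.planesMk_ne_zero).mpr
      ⟨0, algebraMap k A c, ?_, ?_⟩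
    · rw [zero_nsmul]
      exact SetLike.algebraMap_mem_graded _ c
    · rw [pow_zero, div_one]
  have pX : ![0, 1, 1, 0] ∈ R.planes := by simp [planes]
  have pXY : ![-R.r, 1, 1, 1] ∈ R.planes := by simp [planes]
  have pT (i : Fin 3) : ![-R.r, -R.t i, -R.t i, 1] ∈ R.planes := by
    fin_cases i <;> simp [planes]
  have pZ : ![0, 1, 0, 1] ∈ R.planes := by simp [planes]
  have eX : linMk a b n ![0, 1, 1, 0] = x 1 + x 2 := by
    rw [linMk_eq, Fin.sum_univ_four]
    simp [x]
  have eXY : linMk a b n ![-R.r, 1, 1, 1] = x 1 + x 2 + (x 3 - algebraMap k A R.r * x 0) := by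
    rw [linMk_eq, Fin.sum_univ_four]
    simp [x, A]
    ring
  have eT (i) : linMk a b n ![-R.r, -R.t i, -R.t i, 1] =
      x 3 - algebraMap k A R.r * x 0 - algebraMap k A (R.t i) * (x 1 + x 2) := by
    rw [linMk_eq, Fin.sum_univ_four]
    simp [x, A]
    ring
  have eZ : linMk a b n ![0, 1, 0, 1] = x 1 + x 3 := by
    rw [linMk_eq, Fin.sum_univ_four]
    simp [x]
  have hB {v : Fin 4 → k} {D L : A} (hv : v ∈ R.planes) (e : linMk a b n v = D)
      (hL : L ∈ gr a b n 1) : ι L / ι D ∈ B :=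
    ProjModel.div_mem_range_awayToFrac R.planesMk_mem R.planesMk_ne_zero
      (e ▸ linMk_mem a b n v) (e ▸ R.dvd_planesMk hv) hL
  have hne {v : Fin 4 → k} {D : A} (hv : v ∈ R.planes) (e : linMk a b n v = D) : ι D ≠ 0 :=
    ProjModel.algebraMap_ne_zero (e ▸ R.planes_ne_zero hv)
  have hC (c : k) : ev (.C c) = ι (algebraMap k A c) := MvPolynomial.eval₂Hom_C _ _ _
  have hev (i) : ev (.X i) = ι (num i) / ι (den i) := MvPolynomial.eval₂Hom_X' _ _ _
  have hXm := add_mem (hx 1) (hx 2)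
  have hZm := add_mem (hx 1) (hx 3)
  have hY := hB pX eX (sub_mem (hx 3) (hcx R.r 0))
  have hW := hB pZ eZ (sub_mem (hx 2) (hcx R.r₂ 0))
  have hG := congrArg ι (coord_relation a b n)
  obtain ⟨hP, hQ, mX, mXY, mT, m₀, m₁, m₂, m₃⟩ := R.mem_unitFractions (ι.comp (algebraMap k A)) h3
    (B := B) hconst (x₀ := ι (x 0)) (x₁ := ι (x 1)) (x₂ := ι (x 2)) (x₃ := ι (x 3))
    (by simpa using hG) (by simpa using hne pX eX) (by simpa using hne pZ eZ)
    (by simpa using hne pXY eXY) (fun i ↦ by simpa using hne (pT i) (eT i))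
    (by simpa using hY) (by simpa using hW) (by simpa using hB pX eX hZm)
    (by simpa using hB pZ eZ hXm) (by simpa using hB pXY eXY hXm)
    (fun i ↦ by simpa using hB (pT i) (eT i) hXm) (ev := ev) hC (by simpa [num, den] using hev 0)
    (by simpa [num, den] using hev 1)
  have hr : (MvPolynomial.C (R.r - R.r₂) : MvPolynomial (Fin 2) k) ≠ 0 :=
    (map_ne_zero_iff _ (MvPolynomial.C_injective _ _)).mpr (sub_ne_zero.mpr R.ne)
  have hinj : Function.Injective ev := by
    refine MvPolynomial.eval₂Hom_div_injective hι (θ := R.paramHom) R.paramHom_algebraMap ?_ ?_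
    · intro i
      fin_cases i
      · exact R.paramHom_num_zero
      · exact R.paramHom_num_one
    · intro i
      fin_cases i
      · exact R.paramHom_den_zero.trans_ne (mul_ne_zero hr hQ)
      · exact R.paramHom_den_one.trans_ne (mul_ne_zero (neg_ne_zero.mpr hr) hP)
  let S := unitFractions ev B
  have hevB (f) : ev f ∈ B := by
    induction f using MvPolynomial.induction_on with
    | C c => exact hC c ▸ hconst c
    | add f g hf hg => exact map_add ev f g ▸ B.add_mem hf hg
    | mul_X f i hf =>
      rw [map_mul]
      refine B.mul_mem hf ?_
      fin_cases i
      · exact hev 0 ▸ hY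
      · exact hev 1 ▸ hW
  refine uniqueFactorizationMonoid_of_le_unitFractions hinj hevB fun z hz ↦ ?_
  obtain ⟨N, p, hp, rfl⟩ := (ProjModel.mem_range_awayToFrac R.planesMk_mem R.planesMk_ne_zero).mp hz
  have hX0 := hne pX eX
  have hcoord (i) : ι (x i) / ι (x 1 + x 2) ∈ S := by
    rw [map_add]
    fin_cases i
    exacts [m₀, m₁, m₂, m₃]
  have hpS : ι p / ι (x 1 + x 2) ^ (N • (1 + 5)) ∈ S :=
    div_pow_mem_of_coord (S := S) (fun c ↦ hC c ▸ map_mem_unitFractions _) hcoord hp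
  have hHS : ι (x 1 + x 2) ^ (1 + 5) / ι R.planesMk ∈ S := by
    have e : R.planesMk = (x 1 + x 2) * ((x 1 + x 2 + (x 3 - algebraMap k A R.r * x 0)) *
        ((x 3 - algebraMap k A R.r * x 0 - algebraMap k A (R.t 0) * (x 1 + x 2)) *
        ((x 3 - algebraMap k A R.r * x 0 - algebraMap k A (R.t 1) * (x 1 + x 2)) *
        ((x 3 - algebraMap k A R.r * x 0 - algebraMap k A (R.t 2) * (x 1 + x 2)) *
        (x 1 + x 3))))) := by
      rw [← eXY, ← eT, ← eT, ← eT, ← eZ, ← eX]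
      simp [planesMk, planes]
    have e' : ι (x 1 + x 2) ^ (1 + 5) / ι R.planesMk =
        ι (x 1 + x 2) / ι (x 1 + x 2 + (x 3 - algebraMap k A R.r * x 0)) *
        (ι (x 1 + x 2) / ι (x 3 - algebraMap k A R.r * x 0 - algebraMap k A (R.t 0) * (x 1 + x 2)) *
        (ι (x 1 + x 2) / ι (x 3 - algebraMap k A R.r * x 0 - algebraMap k A (R.t 1) * (x 1 + x 2)) *
        (ι (x 1 + x 2) / ι (x 3 - algebraMap k A R.r * x 0 - algebraMap k A (R.t 2) * (x 1 + x 2)) *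
        (ι (x 1 + x 2) / ι (x 1 + x 3))))) := by
      rw [e, map_mul, map_mul, map_mul, map_mul, map_mul]
      simp only [div_mul_div_comm]
      rw [pow_add, pow_one, mul_div_mul_left _ _ hX0]
      congr 1
      ring
    rw [e']
    refine S.mul_mem ?_ (S.mul_mem ?_ (S.mul_mem ?_ (S.mul_mem ?_ ?_)))
    · simpa using mXY
    · simpa using mT 0
    · simpa using mT 1
    · simpa using mT 2
    · simpa using mX
  have e : ι p / ι R.planesMk ^ N = ι p / ι (x 1 + x 2) ^ (N • (1 + 5)) *
      (ι (x 1 + x 2) ^ (1 + 5) / ι R.planesMk) ^ N := by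
    rw [smul_eq_mul, mul_comm N, pow_mul, div_pow, div_mul_div_cancel₀]
    exact pow_ne_zero _ (pow_ne_zero _ hX0)
  change ι p / ι R.planesMk ^ N ∈ S
  rw [e]
  exact S.mul_mem hpS (S.pow_mem hHS N)

end Roots

end CubicSurface

theorem Ideal.IsPrime.exists_mem_of_list_prod_mem {R : Type*} [CommRing R] {I : Ideal R}
    (hI : I.IsPrime) (L : List R) (h : L.prod ∈ I) : ∃ x ∈ L, x ∈ I :=
  (hI.multiset_prod_mem_iff_exists_mem L).mp (by rwa [Multiset.prod_coe])

namespace CubicSurface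

variable {k E : Type u} [Field k] [Field E] [Algebra k E] {a b n : k}

namespace Roots

/-- The tritangent planes whose complement is considered. -/
def tritangentPlanes (R : Roots a b n) (h2 : (2 : k) ≠ 0) (h3 : (3 : k) ≠ 0) :
    List (TritangentPlane a b n) :=
  [R.planeX, R.planeXY h3, R.planeT h2 h3 0, R.planeT h2 h3 1, R.planeT h2 h3 2, R.planeZ]

theorem map_tritangentPlanes (R : Roots a b n) (h2 : (2 : k) ≠ 0) (h3 : (3 : k) ≠ 0) :
    (R.tritangentPlanes h2 h3).map (fun T ↦ (T.extend E).plane) =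
      (R.map (algebraMap k E)).planes := by
  simp only [tritangentPlanes, planes, List.map_cons, List.map_nil, List.cons.injEq, and_true]
  refine ⟨?_, ?_, ?_, ?_, ?_, ?_⟩ <;> funext i <;> fin_cases i <;>
    simp [TritangentPlane.extend, planeX, planeXY, planeT_plane, planeZ, Roots.map]

end Roots

variable [IsDomain (CoordRing a b n)]
  [IsDomain (CoordRing (algebraMap k E a) (algebraMap k E b) (algebraMap k E n))]

theorem map_extendMap_bijective [IsAlgClosed E] (R : Roots a b n) (h2 : (2 : k) ≠ 0)
    (h3 : (3 : k) ≠ 0) (hns : Nonsingular a b n)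
    (y₀ : Proj (gr (algebraMap k E a) (algebraMap k E b) (algebraMap k E n))) :
    Function.Bijective (SchemePic.map (extendMap E a b n)) := by
  refine ⟨map_extendMap_injective a b n y₀,
    map_extendMap_surjective a b n hns (R.tritangentPlanes h2 h3) y₀ fun φ hφ ↦ ?_⟩
  let R' := R.map (algebraMap k E)
  have h3' : (3 : E) ≠ 0 := by
    have := (map_ne_zero (algebraMap k E)).mpr h3
    rwa [map_ofNat] at this
  have := R'.uniqueFactorizationMonoid_range h3'
  obtain ⟨f, hf0, hf⟩ := ProjModel.exists_unitAt_of_uniqueFactorizationMonoid (by norm_num)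
    R'.planesMk_mem R'.planesMk_ne_zero hφ
  refine ⟨f, hf0, fun y hy ↦ hf y fun h ↦ ?_⟩
  obtain ⟨v, hv, hvy⟩ := y.isPrime.exists_mem_of_list_prod_mem _ h
  obtain ⟨v, hv', rfl⟩ := List.mem_map.mp hv
  change v ∈ (R.map (algebraMap k E)).planes at hv'
  rw [← R.map_tritangentPlanes h2 h3] at hv'
  obtain ⟨T, hT, rfl⟩ := List.mem_map.mp hv'
  exact hy T hT hvy

end CubicSurface

/-! ### Irreducibility -/

namespace CubicSurface

variable {k : Type u} [Field k]

theorem irreducible_X_pow_three_add (h3 : (3 : k) ≠ 0) :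
    Irreducible (X ^ 3 + C (X ^ 3 + 1) : k[X][X]) := by
  have hprime : Prime (X - C (-1) : k[X]) := prime_X_sub_C _
  have hm : (X ^ 3 + C (X ^ 3 + 1) : k[X][X]).Monic := monic_X_pow_add_C _ (by norm_num)
  have hdeg : (X ^ 3 + C (X ^ 3 + 1) : k[X][X]).degree = 3 := degree_X_pow_add_C (by norm_num) _
  have e : (X ^ 3 + 1 : k[X]) = (X - C (-1)) * (X ^ 2 - X + 1) := by
    rw [map_neg, map_one]
    ring
  have hI : (Ideal.span {(X - C (-1) : k[X])}).IsPrime :=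
    (Ideal.span_singleton_prime hprime.ne_zero).mpr hprime
  refine irreducible_of_eisenstein_criterion hI ?_ (fun i hi ↦ ?_) ?_ ?_ hm.isPrimitive
  · rw [hm.leadingCoeff, Ideal.mem_span_singleton]
    exact fun h ↦ hprime.not_isUnit (isUnit_of_dvd_one h)
  · rw [hdeg] at hi
    have hi' : i < 3 := by exact_mod_cast hi
    rw [coeff_add, coeff_X_pow, if_neg hi'.ne, zero_add, coeff_C]
    split_ifs
    · rw [e]
      exact Ideal.mul_mem_right _ _ (Ideal.mem_span_singleton_self _)
    · exact zero_mem _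
  · rw [hdeg]
    norm_num
  · rw [coeff_add, coeff_X_pow, if_neg (by norm_num), zero_add, coeff_C_zero,
      Ideal.span_singleton_pow, Ideal.mem_span_singleton, e, sq]
    intro h
    have h1 := (mul_dvd_mul_iff_left hprime.ne_zero).mp h
    rw [dvd_iff_isRoot] at h1
    refine h3 ?_
    simpa [IsRoot, one_add_one_eq_two, two_add_one_eq_three] using h1

theorem irreducible_of_map_eq {R : Type*} [CommRing R] [IsDomain R] (h3 : (3 : k) ≠ 0) (φ : R →+* k[X])
    {r s : R} (hr : φ r = 0) (hs : φ s = X ^ 3 + 1) : Irreducible (X ^ 3 + (C r * X + C s)) := by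
  have hmon : (X ^ 3 + (C r * X + C s)).Monic :=
    monic_X_pow_add (degree_linear_lt.trans_le (by norm_num))
  have h := irreducible_X_pow_three_add h3
  have hφ : (X ^ 3 + (C r * X + C s)).map φ = X ^ 3 + C (X ^ 3 + 1) := by
    simp [hr, hs]
  rw [← hφ] at h
  exact hmon.irreducible_of_irreducible_map φ _ h

theorem _root_.RingEquiv.irreducible_of_map {R S : Type*} [CommRing R] [CommRing S] (e : R ≃+* S)
    {x : R} (h : Irreducible (e x)) : Irreducible x :=
  (MulEquiv.irreducible_iff e).mp h

variable (k) in
theorem exists_ringEquiv_polynomial : ∃ e : MvPolynomial (Fin 4) k ≃+* (MvPolynomial (Fin 3) k)[X],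
    (∀ c, e (.C c) = C (.C c)) ∧
      e (.X 0) = C (.X 2) ∧ e (.X 1) = C (.X 0) ∧ e (.X 2) = C (.X 1) ∧ e (.X 3) = X := by
  let e₁ : MvPolynomial (Fin 4) k ≃+* MvPolynomial (Fin 4) k :=
    (MvPolynomial.renameEquiv k (Equiv.swap (0 : Fin 4) 3)).toRingEquiv
  let e₂ : MvPolynomial (Fin 4) k ≃+* (MvPolynomial (Fin 3) k)[X] :=
    (MvPolynomial.finSuccEquiv k 3).toRingEquiv
  have h₁ (i : Fin 4) : e₁ (.X i) = .X (Equiv.swap 0 3 i) := MvPolynomial.rename_X _ _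
  have h₁' (c : k) : e₁ (.C c) = .C c := MvPolynomial.rename_C _ _
  have h₂ (i : Fin 3) : e₂ (.X i.succ) = C (.X i) := MvPolynomial.finSuccEquiv_X_succ
  have h₂' : e₂ (.X 0) = X := MvPolynomial.finSuccEquiv_X_zero
  have h₂'' (c : k) : e₂ (.C c) = C (.C c) :=
    (MvPolynomial.finSuccEquiv k 3).commutes c
  clear_value e₁ e₂
  refine ⟨e₁.trans e₂, fun c ↦ ?_, ?_, ?_, ?_, ?_⟩
  · rw [RingEquiv.trans_apply, h₁', h₂'']
  · rw [RingEquiv.trans_apply, h₁, show Equiv.swap (0 : Fin 4) 3 0 = Fin.succ 2 by decide, h₂]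
  · rw [RingEquiv.trans_apply, h₁, show Equiv.swap (0 : Fin 4) 3 1 = Fin.succ 0 by decide, h₂]
  · rw [RingEquiv.trans_apply, h₁, show Equiv.swap (0 : Fin 4) 3 2 = Fin.succ 1 by decide, h₂]
  · rw [RingEquiv.trans_apply, h₁, show Equiv.swap (0 : Fin 4) 3 3 = 0 by decide, h₂']

theorem irreducible_form (h3 : (3 : k) ≠ 0) (a b n : k) : Irreducible (form a b n) := by
  obtain ⟨e, eC, e0, e1, e2, e3⟩ := exists_ringEquiv_polynomial k
  apply e.irreducible_of_map
  let r : MvPolynomial (Fin 3) k := .C a * .X 2 ^ 2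
  let s : MvPolynomial (Fin 3) k := .X 0 ^ 3 + .X 1 ^ 3 + .C a * .X 2 ^ 2 * (.X 0 + .X 1) +
    .C (3 * b - n) * .X 2 ^ 3
  have hform : e (form a b n) = X ^ 3 + (C r * X + C s) := by
    rw [form_eq]
    simp only [map_add, map_mul, map_pow, e0, e1, e2, e3, eC, r, s]
    ring
  rw [hform]
  apply irreducible_of_map_eq h3 (MvPolynomial.eval₂Hom (C : k →+* k[X]) ![(X : k[X]), 1, 0])
  · simp [r]
  · simp [s]

theorem isDomain_coordRing (h3 : (3 : k) ≠ 0) (a b n : k) : IsDomain (CoordRing a b n) := by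
  have h := irreducible_form h3 a b n
  have : (Ideal.span {form a b n}).IsPrime :=
    (Ideal.span_singleton_prime h.ne_zero).mpr h.prime
  exact Ideal.Quotient.isDomain _

end CubicSurface

/-! ### Smoothness -/

theorem RingHom.FormallySmooth.exists_lift {k S B C : Type*} [CommRing k] [CommRing S] [CommRing B]
    [CommRing C] {φ : k →+* S} (hφ : φ.FormallySmooth) (i : k →+* B) {π : B →+* C}
    (hπ : Function.Surjective π) (hker : IsNilpotent (RingHom.ker π)) (ψ : S →+* C)
    (hψ : ψ.comp φ = π.comp i) : ∃ ψ' : S →+* B, ψ'.comp φ = i ∧ π.comp ψ' = ψ := by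
  algebraize [φ, i, π.comp i]
  let f : S →ₐ[k] C := { ψ with commutes' := fun r ↦ RingHom.congr_fun hψ r }
  let g : B →ₐ[k] C := { π with commutes' := fun r ↦ rfl }
  have hk : IsNilpotent (RingHom.ker (g : B →+* C)) := hker
  refine ⟨(Algebra.FormallySmooth.liftOfSurjective f g hπ hk).toRingHom, ?_, ?_⟩
  · exact RingHom.ext fun r ↦ AlgHom.commutes (Algebra.FormallySmooth.liftOfSurjective f g hπ hk) r
  · exact RingHom.ext fun r ↦ Algebra.FormallySmooth.liftOfSurjective_apply f g hπ hk r

namespace CubicSurface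

variable {k : Type u} [Field k] (a b n : k)

section Chart

variable {B : Type*} [CommRing B]

/-- The affine equation of the cubic surface in the chart `x₀ ≠ 0`. -/
def affineForm (i : k →+* B) (y : Fin 3 → B) : B :=
  y 0 ^ 3 + y 1 ^ 3 + y 2 ^ 3 + i a * (y 0 + y 1 + y 2) + i (3 * b - n)

theorem map_affineForm {C : Type*} [CommRing C] (i : k →+* B) (π : B →+* C) (y : Fin 3 → B) :
    π (affineForm a b n i y) = affineForm a b n (π.comp i) fun j ↦ π (y j) := by
  simp only [affineForm, map_add, map_mul, map_pow, RingHom.comp_apply]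

/-- The coordinate functions in the chart `x₀ ≠ 0`. -/
def chart (j : Fin 3) : HomogeneousLocalization.Away (gr a b n) (coord a b n 0) :=
  HomogeneousLocalization.mk ⟨1, ⟨coord a b n j.succ, coord_mem a b n _⟩,
    ⟨coord a b n 0 ^ 1, (pow_one (coord a b n 0)).symm ▸ coord_mem a b n 0⟩, ⟨1, rfl⟩⟩

theorem affineForm_chart :
    affineForm a b n (ProjModel.scalars (gr a b n) _) (chart a b n) = 0 := by
  let A := CoordRing a b n
  let L := Localization (Submonoid.powers (coord a b n 0))
  let v : HomogeneousLocalization.Away (gr a b n) (coord a b n 0) →+* L := algebraMap _ _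
  have hv : Function.Injective v := HomogeneousLocalization.val_injective _
  have hu : IsUnit (algebraMap A L (coord a b n 0)) :=
    IsLocalization.map_units L ⟨coord a b n 0, Submonoid.mem_powers _⟩
  have hc (j : Fin 3) : v (chart a b n j) * algebraMap A L (coord a b n 0) =
      algebraMap A L (coord a b n j.succ) := by
    have h := IsLocalization.mk'_spec L (coord a b n j.succ)
      (⟨coord a b n 0 ^ 1, ⟨1, rfl⟩⟩ : Submonoid.powers (coord a b n 0))
    rw [← Localization.mk_eq_mk'] at h
    refine Eq.trans ?_ h
    change _ = v (chart a b n j) * algebraMap A L (coord a b n 0 ^ 1)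
    rw [pow_one]
  have hs (c : k) : v (ProjModel.scalars (gr a b n) _ c) = algebraMap A L (algebraMap k A c) := rfl
  have hrel := congrArg (algebraMap A L) (coord_relation (a := a) (b := b) (n := n))
  simp only [map_add, map_mul, map_pow, map_zero] at hrel
  refine hv (((hu.pow 3).mul_left_eq_zero.mp ?_).trans (map_zero v).symm)
  rw [map_affineForm, affineForm, RingHom.comp_apply, RingHom.comp_apply, hs, hs]
  have h1 := hc 0
  have h2 := hc 1
  have h3 := hc 2
  change _ = algebraMap A L (coord a b n 1) at h1
  change _ = algebraMap A L (coord a b n 2) at h2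
  change _ = algebraMap A L (coord a b n 3) at h3
  rw [← h1, ← h2, ← h3] at hrel
  linear_combination hrel

variable {a b n}

theorem exists_ringHom_of_affineForm_eq_zero {i : k →+* B} {y : Fin 3 → B}
    (h : affineForm a b n i y = 0) :
    ∃ ψ : HomogeneousLocalization.Away (gr a b n) (coord a b n 0) →+* B,
      ψ.comp (ProjModel.scalars (gr a b n) _) = i ∧ ∀ j, ψ (chart a b n j) = y j := by
  let e : MvPolynomial (Fin 4) k →+* B := MvPolynomial.eval₂Hom i ![1, y 0, y 1, y 2]
  have he : e (form a b n) = 0 := by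
    rw [form_eq, ← h]
    simp [e, affineForm]
  let θ : CoordRing a b n →+* B := Ideal.Quotient.lift _ e fun f hf ↦ by
    obtain ⟨s, rfl⟩ := Ideal.mem_span_singleton.mp hf
    rw [map_mul, he, zero_mul]
  have h0 : θ (coord a b n 0) = 1 := MvPolynomial.eval₂_X _ _ _
  have hu : IsUnit (θ (coord a b n 0)) := h0 ▸ isUnit_one
  let L := Localization (Submonoid.powers (coord a b n 0))
  let v : HomogeneousLocalization.Away (gr a b n) (coord a b n 0) →+* L := algebraMap _ _
  refine ⟨(Localization.awayLift θ _ hu).comp v, RingHom.ext fun c ↦ ?_, fun j ↦ ?_⟩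
  · refine (IsLocalization.Away.lift_eq _ hu (algebraMap k _ c)).trans ?_
    exact MvPolynomial.eval₂_C _ _ _
  · refine (Localization.awayLift_mk θ (coord a b n 0) (coord a b n j.succ) 1 (by rw [h0, one_mul])
      1).trans ?_
    rw [one_pow, mul_one]
    refine (MvPolynomial.eval₂_X _ _ _).trans ?_
    fin_cases j <;> rfl

end Chart

variable {a b n}

theorem formallySmooth_scalars (hX : Smooth (toSpec a b n)) :
    (ProjModel.scalars (gr a b n) (.powers (coord a b n 0))).FormallySmooth := by
  have h : Smooth (Proj.awayι (gr a b n) _ (coord_mem a b n 0) one_pos ≫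
      ProjModel.structureMap (gr a b n)) := by
    have : Smooth (ProjModel.structureMap (gr a b n)) := hX
    infer_instance
  rw [ProjModel.awayι_structureMap] at h
  exact (RingHom.smooth_def.mp ((HasRingHomProperty.Spec_iff (P := @Smooth)).mp h)).1

theorem exists_lift_of_smooth (hX : Smooth (toSpec a b n)) {L : Type*} [Field L] (i : k →+* L)
    {N : ℕ} (hN : 1 ≤ N) (p : Fin 3 → L[X])
    (hp : X ^ N ∣ affineForm a b n ((C : L →+* L[X]).comp i) p) :
    ∃ p' : Fin 3 → L[X], (∀ j, X ^ N ∣ p' j - p j) ∧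
      X ^ (N + 1) ∣ affineForm a b n ((C : L →+* L[X]).comp i) p' := by
  let I : Ideal L[X] := Ideal.span {X ^ (N + 1)}
  let J : Ideal L[X] := Ideal.span {X ^ N}
  have hIJ : I ≤ J := Ideal.span_singleton_le_span_singleton.mpr (pow_dvd_pow _ N.le_succ)
  let π : L[X] ⧸ I →+* L[X] ⧸ J := Ideal.Quotient.factor hIJ
  have hπ : Function.Surjective π := Ideal.Quotient.factor_surjective hIJ
  have hker : IsNilpotent (RingHom.ker π) := by
    refine ⟨2, ?_⟩
    refine le_bot_iff.mp ((pow_two (RingHom.ker π)).le.trans (Ideal.mul_le.mpr fun f hf g hg ↦ ?_))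
    obtain ⟨f, rfl⟩ := Ideal.Quotient.mk_surjective f
    obtain ⟨g, rfl⟩ := Ideal.Quotient.mk_surjective g
    have hf' : X ^ N ∣ f := Ideal.mem_span_singleton.mp (Ideal.Quotient.eq_zero_iff_mem.mp hf)
    have hg' : X ^ N ∣ g := Ideal.mem_span_singleton.mp (Ideal.Quotient.eq_zero_iff_mem.mp hg)
    rw [← map_mul, Ideal.mem_bot, Ideal.Quotient.eq_zero_iff_mem, Ideal.mem_span_singleton]
    refine (pow_dvd_pow _ (by omega : N + 1 ≤ N + N)).trans ?_
    rw [pow_add]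
    exact mul_dvd_mul hf' hg'
  have h0 : affineForm a b n ((Ideal.Quotient.mk J).comp ((C : L →+* L[X]).comp i))
      (fun j ↦ Ideal.Quotient.mk J (p j)) = 0 := by
    rw [← map_affineForm]
    exact Ideal.Quotient.eq_zero_iff_mem.mpr (Ideal.mem_span_singleton.mpr hp)
  obtain ⟨ψ, hψ, hψc⟩ := exists_ringHom_of_affineForm_eq_zero h0
  obtain ⟨ψ', hψ', hπψ⟩ := (formallySmooth_scalars hX).exists_lift
    ((Ideal.Quotient.mk I).comp ((C : L →+* L[X]).comp i)) hπ hker ψ (hψ.trans rfl)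
  choose p' hp' using fun j ↦ Ideal.Quotient.mk_surjective (ψ' (chart a b n j))
  refine ⟨p', fun j ↦ ?_, ?_⟩
  · rw [← Ideal.mem_span_singleton]
    refine Ideal.Quotient.eq.mp ?_
    change π (Ideal.Quotient.mk I (p' j)) = _
    rw [hp', ← hψc, ← hπψ]
    rfl
  · rw [← Ideal.mem_span_singleton]
    refine Ideal.Quotient.eq_zero_iff_mem.mp ?_
    rw [map_affineForm, ← hψ', funext hp', ← map_affineForm, affineForm_chart, map_zero]

/-- The affine equation of a smooth cubic surface has no singular point. -/
theorem not_singular_of_smooth (hX : Smooth (toSpec a b n)) (h3 : (3 : k) ≠ 0) {L : Type*} [Field L]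
    (i : k →+* L) (ξ : Fin 3 → L) (h1 : ∀ j, 3 * ξ j ^ 2 + i a = 0)
    (h0 : 2 * i a * (ξ 0 + ξ 1 + ξ 2) + 3 * i (3 * b - n) = 0) : False := by
  have h3' : (3 : L) ≠ 0 := by
    have := (map_ne_zero i).mpr h3
    rwa [map_ofNat i] at this
  have hg : ξ 0 ^ 3 + ξ 1 ^ 3 + ξ 2 ^ 3 + i a * (ξ 0 + ξ 1 + ξ 2) + i (3 * b - n) = 0 := by
    refine (mul_eq_zero.mp ?_).resolve_left h3'
    linear_combination ξ 0 * h1 0 + ξ 1 * h1 1 + ξ 2 * h1 2 + h0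
  have c1 (j) : 3 * (C (ξ j) : L[X]) ^ 2 + C (i a) = 0 := by
    have h := congrArg (C : L →+* L[X]) (h1 j)
    simpa only [map_add, map_mul, map_pow, map_ofNat (C : L →+* L[X]), map_zero] using h
  have cg : (C (ξ 0) : L[X]) ^ 3 + C (ξ 1) ^ 3 + C (ξ 2) ^ 3 +
      C (i a) * (C (ξ 0) + C (ξ 1) + C (ξ 2)) + C (i (3 * b - n)) = 0 := by
    have h := congrArg (C : L →+* L[X]) hg
    simpa only [map_add, map_mul, map_pow, map_zero] using h
  have hX0 : (X : L[X]) ≠ 0 := X_ne_zero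
  by_cases hξ : ξ 0 = 0
  · have ha : i a = 0 := by simpa [hξ] using h1 0
    have hz (j) : ξ j = 0 := by simpa [ha, h3'] using h1 j
    have hc : i (3 * b - n) = 0 := by simpa [hz, ha] using hg
    have e (y : Fin 3 → L[X]) : affineForm a b n ((C : L →+* L[X]).comp i) y =
        y 0 ^ 3 + y 1 ^ 3 + y 2 ^ 3 := by
      simp [affineForm, RingHom.comp_apply, ha, hc]
    obtain ⟨p, hp, hpX⟩ := exists_lift_of_smooth hX i (N := 3) (by norm_num) ![X, 0, 0]
      (by simp [e])
    obtain ⟨q₀, e₀⟩ := hp 0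
    obtain ⟨q₁, e₁⟩ := hp 1
    obtain ⟨q₂, e₂⟩ := hp 2
    obtain ⟨s, hs⟩ := hpX
    simp only [Matrix.cons_val] at e₀ e₁ e₂
    rw [e, sub_eq_iff_eq_add.mp e₀, sub_eq_iff_eq_add.mp e₁, sub_eq_iff_eq_add.mp e₂] at hs
    have h : (X : L[X]) ∣ 1 := by
      refine ⟨s - (3 * X * q₀ + 3 * X ^ 3 * q₀ ^ 2 + X ^ 5 * (q₀ ^ 3 + q₁ ^ 3 + q₂ ^ 3)), ?_⟩
      refine mul_left_cancel₀ (pow_ne_zero 3 hX0) ?_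
      linear_combination hs
    exact not_isUnit_X (isUnit_of_dvd_one h)
  · have e (y : Fin 3 → L[X]) : affineForm a b n ((C : L →+* L[X]).comp i) y =
        y 0 ^ 3 + y 1 ^ 3 + y 2 ^ 3 + C (i a) * (y 0 + y 1 + y 2) + C (i (3 * b - n)) := rfl
    obtain ⟨p, hp, hpX⟩ := exists_lift_of_smooth hX i (N := 2) (by norm_num)
      ![C (ξ 0) + X, C (ξ 1), C (ξ 2)] (by
        refine ⟨3 * C (ξ 0) + X, ?_⟩
        rw [e]
        simp only [Matrix.cons_val]
        linear_combination cg + X * c1 0)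
    obtain ⟨q₀, e₀⟩ := hp 0
    obtain ⟨q₁, e₁⟩ := hp 1
    obtain ⟨q₂, e₂⟩ := hp 2
    obtain ⟨s, hs⟩ := hpX
    simp only [Matrix.cons_val] at e₀ e₁ e₂
    rw [e, sub_eq_iff_eq_add.mp e₀, sub_eq_iff_eq_add.mp e₁, sub_eq_iff_eq_add.mp e₂] at hs
    have h : (X : L[X]) ∣ C (3 * ξ 0) := by
      refine ⟨s - (1 + 6 * C (ξ 0) * q₀ + 3 * X * q₀ + 3 * X * (C (ξ 0) + X) * q₀ ^ 2 +
        3 * X * C (ξ 1) * q₁ ^ 2 + 3 * X * C (ξ 2) * q₂ ^ 2 +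
        X ^ 3 * (q₀ ^ 3 + q₁ ^ 3 + q₂ ^ 3)), ?_⟩
      refine mul_left_cancel₀ (pow_ne_zero 2 hX0) ?_
      rw [map_mul, map_ofNat (C : L →+* L[X])]
      linear_combination hs - cg - X * c1 0 - X ^ 2 * (q₀ * c1 0 + q₁ * c1 1 + q₂ * c1 2)
    rw [X_dvd_iff, coeff_C_zero] at h
    exact mul_ne_zero h3' hξ h

theorem not_singular_of_smooth_of_ne_zero (hX : Smooth (toSpec a b n)) (h3 : (3 : k) ≠ 0)
    {L : Type*} [Field L] (i : k →+* L) (y : Fin 4 → L) (hy0 : y 0 ≠ 0)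
    (hj : ∀ m : Fin 3, 3 * y m.succ ^ 2 + i a * y 0 ^ 2 = 0)
    (h0 : y 0 * (2 * i a * (y 1 + y 2 + y 3) + 3 * i (3 * b - n) * y 0) = 0) : False := by
  refine not_singular_of_smooth hX h3 i (fun m ↦ y m.succ / y 0) (fun m ↦ ?_) ?_
  · rw [div_pow, mul_div_assoc', div_add' _ _ _ (pow_ne_zero 2 hy0), hj, zero_div]
  · have h := (mul_eq_zero.mp h0).resolve_left hy0
    change 2 * i a * (y 1 / y 0 + y 2 / y 0 + y 3 / y 0) + _ = 0
    rw [← add_div, ← add_div, mul_div_assoc', div_add' _ _ _ hy0, h, zero_div]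

variable (a b n) in
theorem pderiv_succ_form (m : Fin 3) : MvPolynomial.pderiv m.succ (form a b n) =
    3 * .X m.succ ^ 2 + .C a * .X 0 ^ 2 := by
  rw [form_eq]
  fin_cases m <;>
    simp [MvPolynomial.pderiv_X, Derivation.leibniz, Derivation.leibniz_pow]

variable (a b n) in
theorem pderiv_zero_form : MvPolynomial.pderiv 0 (form a b n) =
    2 * .C a * .X 0 * (.X 1 + .X 2 + .X 3) + 3 * .C (3 * b - n) * .X 0 ^ 2 := by
  rw [form_eq]
  simp [MvPolynomial.pderiv_X, Derivation.leibniz, Derivation.leibniz_pow]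
  ring

/-- A smooth cubic surface stays nonsingular over an extension field. -/
theorem nonsingular_of_smooth (hX : Smooth (toSpec a b n)) (h3 : (3 : k) ≠ 0) {K : Type u} [Field K]
    [Algebra k K] :
    Nonsingular (algebraMap k K a) (algebraMap k K b) (algebraMap k K n) := by
  intro x
  by_contra! h
  let A := CoordRing (algebraMap k K a) (algebraMap k K b) (algebraMap k K n)
  let P : Ideal A := x.asHomogeneousIdeal.toIdeal
  have hP : P.IsPrime := x.isPrime
  let L := FractionRing (A ⧸ P)
  let φ : A →+* L := (algebraMap (A ⧸ P) L).comp (Ideal.Quotient.mk P)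
  have hφ (f : A) : φ f = 0 ↔ f ∈ P := by
    rw [← Ideal.Quotient.eq_zero_iff_mem]
    exact map_eq_zero_iff _ (IsFractionRing.injective (A ⧸ P) L)
  let ε : MvPolynomial (Fin 4) K →+* L := φ.comp (Ideal.Quotient.mk _)
  let j : K →+* L := φ.comp (algebraMap K A)
  let i : k →+* L := j.comp (algebraMap k K)
  let y (m : Fin 4) : L := φ (coord _ _ _ m)
  have hεC (c : K) : ε (.C c) = j c := rfl
  have hεX (m : Fin 4) : ε (.X m) = y m := rfl
  have h3' : (3 : L) ≠ 0 := by
    have := (map_ne_zero i).mpr h3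
    rwa [map_ofNat i] at this
  have hd (m : Fin 4) : ε (MvPolynomial.pderiv m (form (algebraMap k K a) (algebraMap k K b)
      (algebraMap k K n))) = 0 := (hφ _).mpr (h m)
  have hc : j (3 * algebraMap k K b - algebraMap k K n) = i (3 * b - n) := by
    simp only [i, RingHom.comp_apply, map_sub, map_mul, map_ofNat (algebraMap k K)]
  have hj (m : Fin 3) : 3 * y m.succ ^ 2 + i a * y 0 ^ 2 = 0 := by
    have h := (congrArg ε (pderiv_succ_form _ _ _ m)).symm.trans (hd m.succ)
    simp only [map_add, map_mul, map_pow, map_ofNat ε, hεC, hεX] at h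
    exact h
  have h0 : y 0 * (2 * i a * (y 1 + y 2 + y 3) + 3 * i (3 * b - n) * y 0) = 0 := by
    have h := (congrArg ε (pderiv_zero_form _ _ _)).symm.trans (hd 0)
    simp only [map_add, map_mul, map_pow, map_ofNat ε, hεC, hεX] at h
    rw [← hc, ← h]
    change y 0 * (2 * j (algebraMap k K a) * (y 1 + y 2 + y 3) + _) = _
    ring
  obtain ⟨c, hcx⟩ := exists_coord_notMem _ _ _ x
  have hy0 : y 0 ≠ 0 := by
    intro hy
    refine hcx ((hφ _).mp ?_)
    induction c using Fin.cases with
    | zero => exact hy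
    | succ m => simpa [hy, h3'] using hj m
  exact not_singular_of_smooth_of_ne_zero hX h3 i y hy0 hj h0

end CubicSurface

/-! ### The splitting field -/

/-- Vieta's formulas for a cubic polynomial that splits. -/
theorem Polynomial.Splits.exists_roots_cubic {K : Type*} [Field K] {α β γ δ : K} (hα : α ≠ 0)
    (h : (C α * X ^ 3 + C β * X ^ 2 + C γ * X + C δ : K[X]).Splits) :
    ∃ x y z, β = α * -(x + y + z) ∧ γ = α * (x * y + x * z + y * z) ∧ δ = α * -(x * y * z) := by
  have h' : ((⟨α, β, γ, δ⟩ : Cubic K).toPoly.map (RingHom.id K)).Splits := by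
    rwa [Polynomial.map_id]
  obtain ⟨x, y, z, hr⟩ := (Cubic.splits_iff_roots_eq_three hα).mp h'
  exact ⟨x, y, z, Cubic.b_eq_three_roots hα hr, Cubic.c_eq_three_roots hα hr,
    Cubic.d_eq_three_roots hα hr⟩

theorem isSplit_baseChange_of_isPullback {k K : Type u} [Field k] [Field K] [Algebra k K]
    {X X' Y : Scheme.{u}} {f : X ⟶ Spec (.of k)} {ψ : X' ⟶ X} {q : X' ⟶ Spec (.of K)}
    (hψ : IsPullback ψ q f (Spec.map (CommRingCat.ofHom (algebraMap k K)))) {φ : Y ⟶ X'}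
    {p : Y ⟶ Spec (.of (AlgebraicClosure K))}
    (hφ : IsPullback φ p q (Spec.map (CommRingCat.ofHom (algebraMap K (AlgebraicClosure K)))))
    (hb : Function.Bijective (SchemePic.map φ)) : IsSplit (BaseChange.toSpec f K) := by
  refine isSplit_of_iso hψ.isoPullback (p := p) ?_ hb
  rw [hψ.isoPullback_hom_snd]
  exact hφ

namespace CubicSurface

section Field

variable {K : Type u} [Field K] {a b n r : K}

theorem exists_roots_f₁ (hr : r ^ 3 + a * r + (3 * b - n) = 0) (hf : (f₁ a b n).Splits) :
    ∃ r₂ r₃, r + r₂ + r₃ = 0 ∧ r * r₂ + r * r₃ + r₂ * r₃ = a ∧ r * r₂ * r₃ = n - 3 * b := by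
  have h : (C 1 * X ^ 3 + C 0 * X ^ 2 + C a * X + C (3 * b - n) : K[X]).Splits := by
    simpa [f₁] using hf
  obtain ⟨x, y, z, h1, h2, h3⟩ := h.exists_roots_cubic one_ne_zero
  have h0 : (r - x) * ((r - y) * (r - z)) = 0 := by
    linear_combination hr - r ^ 2 * h1 - r * h2 - h3
  rcases mul_eq_zero.mp h0 with h | h
  · obtain rfl := sub_eq_zero.mp h
    exact ⟨y, z, by linear_combination h1, by linear_combination -h2,
      by linear_combination h3⟩
  rcases mul_eq_zero.mp h with h | h
  · obtain rfl := sub_eq_zero.mp h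
    exact ⟨x, z, by linear_combination h1, by linear_combination -h2,
      by linear_combination h3⟩
  · obtain rfl := sub_eq_zero.mp h
    exact ⟨x, y, by linear_combination h1, by linear_combination -h2,
      by linear_combination h3⟩

theorem exists_roots_g₁ (hD : 4 * a + 3 * r ^ 2 ≠ 0) (hg : (g₁ a r).Splits) :
    ∃ t : Fin 3 → K, (4 * a + 3 * r ^ 2) * (t 0 + t 1 + t 2) = 3 * r ^ 2 ∧
      (4 * a + 3 * r ^ 2) * (t 0 * t 1 + t 0 * t 2 + t 1 * t 2) = 3 * r ^ 2 ∧
      (4 * a + 3 * r ^ 2) * (t 0 * t 1 * t 2) = -a := by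
  by_cases ha : a = 0
  · subst ha
    have hr : 3 * r ^ 2 ≠ 0 := by simpa using hD
    have hdeg : (g₁ 0 r).degree ≠ 0 := by
      have e : g₁ 0 r = C (3 * r ^ 2) * X ^ 2 + C (-(3 * r ^ 2)) * X + C (3 * r ^ 2) := by
        simp [g₁, sub_eq_add_neg]
      rw [e, degree_quadratic hr]
      norm_num
    obtain ⟨x, hx⟩ := hg.exists_eval_eq_zero hdeg
    have hx' : 3 * r ^ 2 * (x * (1 - x)) = 3 * r ^ 2 := by
      have h : 3 * r ^ 2 * x ^ 2 - 3 * r ^ 2 * x + 3 * r ^ 2 = 0 := by simpa [g₁] using hx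
      linear_combination -h
    refine ⟨![0, x, 1 - x], ?_, ?_, ?_⟩ <;> simp only [Matrix.cons_val]
    · ring
    · linear_combination hx'
    · ring
  · have e : g₁ a r = C a * X ^ 3 + C (3 * r ^ 2) * X ^ 2 + C (-(3 * r ^ 2)) * X +
        C (4 * a + 3 * r ^ 2) := by
      rw [g₁, C_neg]
      ring
    rw [e] at hg
    obtain ⟨x, y, z, e1, e2, e3⟩ := hg.exists_roots_cubic ha
    have hx : x ≠ 0 := by
      rintro rfl
      exact hD (e3.trans (by ring))
    have hy : y ≠ 0 := by
      rintro rfl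
      exact hD (e3.trans (by ring))
    have hz : z ≠ 0 := by
      rintro rfl
      exact hD (e3.trans (by ring))
    refine ⟨![x⁻¹, y⁻¹, z⁻¹], ?_, ?_, ?_⟩ <;> simp only [Matrix.cons_val] <;> rw [e3]
    · field_simp
      linear_combination e2
    · field_simp
      linear_combination -e1
    · field_simp

end Field

variable {k : Type u} [Field k] {a b n : k} {K : Type u} [Field K]

theorem four_mul_add_ne_zero_of_smooth (h2 : (2 : k) ≠ 0) (h3 : (3 : k) ≠ 0)
    (hX : Smooth (toSpec a b n)) (i : k →+* K) {r : K}
    (hr : r ^ 3 + i a * r + (3 * i b - i n) = 0) : 4 * i a + 3 * r ^ 2 ≠ 0 := by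
  intro h
  have h2' : (2 : K) ≠ 0 := by
    have := (map_ne_zero i).mpr h2
    rwa [map_ofNat i] at this
  have hc : i (3 * b - n) = 3 * i b - i n := by rw [map_sub, map_mul, map_ofNat i]
  obtain ⟨s, rfl⟩ : ∃ s, r = 2 * s := ⟨r / 2, by field_simp⟩
  have ha : 3 * s ^ 2 + i a = 0 := by
    refine (mul_eq_zero.mp ?_).resolve_left (mul_ne_zero h2' h2')
    linear_combination h
  refine not_singular_of_smooth hX h3 i ![-s, -s, s] (fun j ↦ ?_) ?_
  · fin_cases j <;> simpa using ha
  · simp only [Matrix.cons_val]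
    rw [hc]
    linear_combination 3 * hr - 8 * s * ha

theorem nonempty_roots_of_smooth (h2 : (2 : k) ≠ 0) (h3 : (3 : k) ≠ 0) (hX : Smooth (toSpec a b n))
    (i : k →+* K) {r : K} (hr : r ^ 3 + i a * r + (3 * i b - i n) = 0)
    (hf : (f₁ (i a) (i b) (i n)).Splits) (hg : (g₁ (i a) r).Splits) :
    Nonempty (Roots (i a) (i b) (i n)) := by
  have hc : i (3 * b - n) = 3 * i b - i n := by rw [map_sub, map_mul, map_ofNat i]
  have hD := four_mul_add_ne_zero_of_smooth h2 h3 hX i hr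
  obtain ⟨r₂, r₃, e1, e2, e3⟩ := exists_roots_f₁ hr hf
  obtain ⟨t, t1, t2, t3⟩ := exists_roots_g₁ hD hg
  refine ⟨⟨r, r₂, r₃, t, e1, e2, e3, ?_, hD, t1, t2, t3⟩⟩
  rintro rfl
  have e4 : r₃ = -2 * r := by linear_combination e1
  subst e4
  have ha : 3 * r ^ 2 + i a = 0 := by linear_combination -e2
  refine not_singular_of_smooth hX h3 i ![r, r, -r] (fun j ↦ ?_) ?_
  · fin_cases j <;> simpa using ha
  · simp only [Matrix.cons_val]
    rw [hc]
    linear_combination 2 * r * ha + 3 * e3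

theorem nonempty_proj [IsDomain (CoordRing a b n)] : Nonempty (Proj (gr a b n)) := by
  have h : coord a b n 0 ≠ 0 := by
    have e : linMk a b n (Pi.single 0 1) = coord a b n 0 :=
      congrArg (Ideal.Quotient.mk _) (by simp [lin, Pi.single_apply])
    rw [← e]
    exact linMk_ne_zero a b n (z := Pi.single 0 1) (by simp)
  refine ⟨ProjModel.generic (gr a b n) fun hle ↦ h ?_⟩
  exact hle (HomogeneousIdeal.mem_irrelevant_of_mem (gr a b n) one_pos (coord_mem a b n 0))

theorem isSplit_baseChange [Algebra k K] (h2 : (2 : k) ≠ 0) (h3 : (3 : k) ≠ 0)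
    (hX : Smooth (toSpec a b n))
    (R : Roots (algebraMap k K a) (algebraMap k K b) (algebraMap k K n)) :
    IsSplit (BaseChange.toSpec (toSpec a b n) K) := by
  have h2' : (2 : K) ≠ 0 := by
    have := (map_ne_zero (algebraMap k K)).mpr h2
    rwa [map_ofNat (algebraMap k K)] at this
  have h3' : (3 : K) ≠ 0 := by
    have := (map_ne_zero (algebraMap k K)).mpr h3
    rwa [map_ofNat (algebraMap k K)] at this
  have h3'' : (3 : AlgebraicClosure K) ≠ 0 := by
    have := (map_ne_zero (algebraMap K (AlgebraicClosure K))).mpr h3'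
    rwa [map_ofNat (algebraMap K (AlgebraicClosure K))] at this
  have := isDomain_coordRing h3' (algebraMap k K a) (algebraMap k K b) (algebraMap k K n)
  have := isDomain_coordRing h3'' (algebraMap K (AlgebraicClosure K) (algebraMap k K a))
    (algebraMap K (AlgebraicClosure K) (algebraMap k K b))
    (algebraMap K (AlgebraicClosure K) (algebraMap k K n))
  obtain ⟨y₀⟩ := nonempty_proj (a := algebraMap K (AlgebraicClosure K) (algebraMap k K a))
    (b := algebraMap K (AlgebraicClosure K) (algebraMap k K b))
    (n := algebraMap K (AlgebraicClosure K) (algebraMap k K n))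
  have hK := isPullback_extendMap (E := K) a b n
  have hE := isPullback_extendMap (E := AlgebraicClosure K) (algebraMap k K a) (algebraMap k K b)
    (algebraMap k K n)
  exact isSplit_baseChange_of_isPullback hK hE
    (map_extendMap_bijective R h2' h3' (nonsingular_of_smooth hX h3) y₀)

end CubicSurface

end

theorem mainTheorem7 {k : Type u} [Field k] [PerfectField k] (h2 : (2 : k) ≠ 0) (h3 : (3 : k) ≠ 0)
    (a b n : k) (hX : Smooth (CubicSurface.toSpec a b n))
    {l : Type v} [Field l] [Algebra k l] (r : l)
    (hr : aeval r (CubicSurface.f₁ a b n) = 0) (hl : Algebra.adjoin k {r} = ⊤)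
    (K : Type u) [Field K] [Algebra k K] [Algebra l K] [IsScalarTower k l K]
    [IsSplittingField l K
      ((CubicSurface.f₁ a b n).map (algebraMap k l) * CubicSurface.g₁ (algebraMap k l a) r)] :
    IsSplit (BaseChange.toSpec (CubicSurface.toSpec a b n) K) := by
  have hmap (c : k) : algebraMap l K (algebraMap k l c) = algebraMap k K c :=
    (IsScalarTower.algebraMap_apply k l K c).symm
  have hr' : algebraMap l K r ^ 3 + algebraMap k K a * algebraMap l K r +
      (3 * algebraMap k K b - algebraMap k K n) = 0 := by
    have h := congrArg (algebraMap l K) hr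
    simpa [CubicSurface.f₁, hmap, map_ofNat (algebraMap k K)] using h
  have hf : ((CubicSurface.f₁ a b n).map (algebraMap k l)).map (algebraMap l K) =
      CubicSurface.f₁ (algebraMap k K a) (algebraMap k K b) (algebraMap k K n) := by
    simp [CubicSurface.f₁, hmap, map_ofNat (algebraMap k K)]
  have hg : (CubicSurface.g₁ (algebraMap k l a) r).map (algebraMap l K) =
      CubicSurface.g₁ (algebraMap k K a) (algebraMap l K r) := by
    simp [CubicSurface.g₁, hmap, map_ofNat (algebraMap l K)]
  have hsplit := IsSplittingField.splits K
    ((CubicSurface.f₁ a b n).map (algebraMap k l) * CubicSurface.g₁ (algebraMap k l a) r)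
  have hD := CubicSurface.four_mul_add_ne_zero_of_smooth h2 h3 hX (algebraMap k K) hr'
  rw [Polynomial.map_mul, hf, hg, splits_mul] at hsplit
  · obtain ⟨R⟩ := CubicSurface.nonempty_roots_of_smooth h2 h3 hX (algebraMap k K) hr'
      hsplit.1 hsplit.2
    exact CubicSurface.isSplit_baseChange h2 h3 hX R
  · intro h
    simpa [CubicSurface.f₁, coeff_X, coeff_C] using congrArg (coeff · 3) h
  · intro h
    refine hD ?_
    simpa [CubicSurface.g₁] using congrArg (eval 0) h
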